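/- Let $\mathbb{T}^3=(\mathbb{R}/2\pi\mathbb{Z})^3$, write $v^{\rm h}=(v^1,v^2)$, and for functions $v$ on $\mathbb{T}^3$ let $$\|v\|_{\dot B^{-1}_{\infty,\infty}}=\sup_{s>0}s^{1/2}\|e^{s\Delta}v\|_{L^\infty}.$$ For every viscosity $\nu>0$ and every $0<\delta<1$ there exist mean-free, divergence-free vector fields $u_{\rm in},\bar u_{\rm in}\in C^\infty(\mathbb{T}^3;\mathbb{R}^3)$ with vanishing third component such that $\bar u_{\rm in}$ is a 2.75D shear datum, i.e. $$\bar u_{\rm in}(x)=\big(f(\lambda x_1+x_2,x_3),\,-\lambda f(\lambda x_1+x_2,x_3)-g(x_3),\,0\big)$$ for some $\lambda\in\mathbb{Z}$, $f\in C^\infty(\mathbb{T}^2)$, $g\in C^\infty(\mathbb{T})$, such that $$\|u_{\rm in}-\bar u_{\rm in}\|_{\dot B^{-1}_{\infty,\infty}}=\|u^{\rm h}_{\rm in}-\bar u^{\rm h}_{\rm in}\|_{\dot B^{-1}_{\infty,\infty}}<\delta,$$ and such that the following holds for some time $0<T<\delta$. (i) For some integer $r\ge1$, with $k_j=2^{3j}T^{-1/2}$,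 $$u_{\rm in}(x)=\Big(\sum_{j=1}^r\tfrac1j\Big)^{-1/3}\sum_{j=1}^{r^3}\frac{k_j}{\sqrt j}\big(v_j\cos(\mathbf k_j\cdot x)+v_j'\cos(\mathbf k_j'\cdot x)\big),$$ where $(v_j,v_j',\mathbf k_j,\mathbf k_j')$ equals $\big((1,-1,0),(1,0,0),(1,1,k_j),(0,-1,k_j+1)\big)$ for $1\le j\le r$, $\big((1,0,0),(1,1,0),(0,1,k_j),(-1,1,k_j)\big)$ for $r<j\le r^2$, and $\big((1,1,0),(0,1,0),(1,-1,k_j),(1,0,k_j)\big)$ for $r^2<j\le r^3$. (ii) The Cauchy problem $$\partial_tu+u\cdot\nabla u+\nabla P=\nu\Delta u,\qquad \operatorname{div}u=0,\qquad u|_{t=0}=u_{\rm in}$$ has a solution $u\in C([0,T]\times\mathbb{T}^3)\cap C^\infty((0,T]\times\mathbb{T}^3)$ with pressure $P\in C^\infty((0,T]\times\mathbb{T}^3)$. It is unique among all solutions that are smooth on $(0,T]\times\mathbb{T}^3$, with a smooth pressure on $(0,T]\times\mathbb{T}^3$, and attain $u_{\rm in}$ in $L^2(\mathbb{T}^3)$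 as $t\to0^+$. (iii) This solution exhibits isotropic norm inflation at time $T$: $$\inf_{\mathbf e\in\mathbb{R}^3,\ |\mathbf e|=1}\|u(T,\cdot)\cdot\mathbf e\|_{\dot B^{-1}_{\infty,\infty}}>\frac1\delta .$$ -/

import Mathlib

open Real Set Filter Topology MeasureTheory
open scoped ContDiff ENNReal

noncomputable section

/-- Three-dimensional Euclidean space. Functions on the torus `𝕋³ = (ℝ / 2πℤ)³` are represented
by functions on this space that are `2π`-periodic in each coordinate. -/
abbrev E3 : Type := EuclideanSpace ℝ (Fin 3)

/-- `2π`-periodicity in each coordinate. -/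
def TorusPeriodic {F : Type*} (v : E3 → F) : Prop :=
  ∀ (i : Fin 3) (x : E3), v (x + EuclideanSpace.single i (2 * π)) = v x

/-- The fundamental cell `(0, 2π]³` of the torus. -/
def torusCell : Set E3 := {x | ∀ i, x i ∈ Ioc 0 (2 * π)}

/-- Divergence of a vector field. -/
def vdiv (v : E3 → E3) (x : E3) : ℝ :=
  ∑ i : Fin 3, (fderiv ℝ v x (EuclideanSpace.single i 1)) i

/-- Horizontal part `(v¹, v²)` of a vector. -/
def horiz (w : E3) : EuclideanSpace ℝ (Fin 2) := !₂[w 0, w 1]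

/-- The heat semigroup `e^{sΔ}`, `s > 0`, as convolution with the Gaussian on `ℝ³`. -/
def heatFlow {F : Type*} [NormedAddCommGroup F] [NormedSpace ℝ F]
    (s : ℝ) (v : E3 → F) (x : E3) : F :=
  ∫ y : E3, ((4 * π * s) ^ (-(3 / 2) : ℝ) * Real.exp (-‖y‖ ^ 2 / (4 * s))) • v (x - y)

/-- The norm of the homogeneous Besov space `Ḃ^{-1}_{∞,∞}`:
`sup_{s > 0} s^{1/2} ‖e^{sΔ} v‖_{L^∞}`, as an extended nonnegative number. -/
def besovNorm {F : Type*} [NormedAddCommGroup F] [NormedSpace ℝ F] (v : E3 → F) : ℝ≥0∞ :=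
  ⨆ (s : ℝ) (_ : 0 < s), ENNReal.ofReal (√s) * eLpNorm (heatFlow s v) ⊤ volume

/-- Smooth, mean-free, divergence-free vector fields on the torus with vanishing third
component. -/
structure IsAdmissibleDatum (v : E3 → E3) : Prop where
  periodic : TorusPeriodic v
  smooth : ContDiff ℝ ∞ v
  mean_free : ∫ x in torusCell, v x = 0
  div_free : ∀ x, vdiv v x = 0
  third_zero : ∀ x, v x 2 = 0

/-- Initial data of 2.75D shear flows:
`(f(λx₁ + x₂, x₃), -λ f(λx₁ + x₂, x₃) - g(x₃), 0)` with `λ` an integer and `f`, `g` smooth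
functions on `𝕋²`, `𝕋`. -/
def IsShearDatum (v : E3 → E3) : Prop :=
  ∃ (lam : ℤ) (f : ℝ → ℝ → ℝ) (g : ℝ → ℝ),
    ContDiff ℝ ∞ (fun y : ℝ × ℝ => f y.1 y.2) ∧
    (∀ a b, f (a + 2 * π) b = f a b ∧ f a (b + 2 * π) = f a b) ∧
    ContDiff ℝ ∞ g ∧ (∀ b, g (b + 2 * π) = g b) ∧
    ∀ x : E3, v x =
      !₂[f (lam * x 0 + x 1) (x 2), -lam * f (lam * x 0 + x 1) (x 2) - g (x 2), 0]

/-- The frequencies `k_j = 2^{3j} T^{-1/2}`. -/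
def freq (T : ℝ) (j : ℕ) : ℝ := 2 ^ (3 * j) * T ^ (-(1 / 2) : ℝ)

/-- First amplitude vector `v_j`. -/
def ampV (r j : ℕ) : E3 :=
  if j ≤ r then !₂[1, -1, 0] else if j ≤ r ^ 2 then !₂[1, 0, 0] else !₂[1, 1, 0]

/-- Second amplitude vector `v'_j`. -/
def ampV' (r j : ℕ) : E3 :=
  if j ≤ r then !₂[1, 0, 0] else if j ≤ r ^ 2 then !₂[1, 1, 0] else !₂[0, 1, 0]

/-- First wave vector `𝐤_j`. -/
def waveK (r : ℕ) (T : ℝ) (j : ℕ) : E3 :=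
  if j ≤ r then !₂[1, 1, freq T j]
  else if j ≤ r ^ 2 then !₂[0, 1, freq T j] else !₂[1, -1, freq T j]

/-- Second wave vector `𝐤'_j`. -/
def waveK' (r : ℕ) (T : ℝ) (j : ℕ) : E3 :=
  if j ≤ r then !₂[0, -1, freq T j + 1]
  else if j ≤ r ^ 2 then !₂[-1, 1, freq T j] else !₂[1, 0, freq T j]

/-- `Γ₂(r) = (∑_{j=1}^r 1/j)^{1/3}`. -/
def Gam2 (r : ℕ) : ℝ := (∑ j ∈ Finset.Icc 1 r, 1 / (j : ℝ)) ^ (1 / 3 : ℝ)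

/-- The superposition of plane waves
`Γ₂(r)⁻¹ ∑_{j=1}^{r³} (k_j / √j) (v_j cos(𝐤_j · x) + v'_j cos(𝐤'_j · x))`. -/
def planeWaveDatum (r : ℕ) (T : ℝ) (x : E3) : E3 :=
  (1 / Gam2 r) • ∑ j ∈ Finset.Icc 1 (r ^ 3),
    (freq T j / √(j : ℝ)) •
      (Real.cos (inner ℝ (waveK r T j) x) • ampV r j
        + Real.cos (inner ℝ (waveK' r T j) x) • ampV' r j)

/-- `u` is a solution, smooth on `(0, T] × 𝕋³`, of the Cauchy problem for the Navier-Stokes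
equations with viscosity `ν` and initial data `uin`: there is a smooth pressure on the torus such
that the equations hold on `(0, T] × 𝕋³`, and the initial data is attained in `L²(𝕋³)`. -/
structure IsSmoothNSSolution (ν T : ℝ) (uin : E3 → E3) (u : ℝ → E3 → E3) : Prop where
  smooth : ContDiffOn ℝ ∞ (fun z : ℝ × E3 => u z.1 z.2) (Ioc 0 T ×ˢ univ)
  periodic : ∀ t ∈ Ioc 0 T, TorusPeriodic (u t)
  div_free : ∀ t ∈ Ioc 0 T, ∀ x, vdiv (u t) x = 0
  momentum : ∃ P : ℝ → E3 → ℝ,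
    ContDiffOn ℝ ∞ (fun z : ℝ × E3 => P z.1 z.2) (Ioc 0 T ×ˢ univ) ∧
    (∀ t ∈ Ioc 0 T, TorusPeriodic (P t)) ∧
    ∀ t ∈ Ioc 0 T, ∀ x,
      derivWithin (fun s => u s x) (Ioc 0 T) t + fderiv ℝ (u t) x (u t x) + gradient (P t) x
        = ν • Laplacian.laplacian (u t) x
  initial : Tendsto (fun t => ∫ x in torusCell, ‖u t x - uin x‖ ^ 2) (𝓝[>] 0) (𝓝 0)

end

/-!
Why the theorem holds. The datum is a superposition of plane waves with lacunary frequencies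
`k_j = 8^j N`, `T = N⁻²`, amplitudes `k_j / √j` and three groups of polarisations. The number `r` is
fixed first, with `Γ₂(r)` large, and `N` is then sent to infinity.

*Smallness.* Gaussian sums along a lacunary sequence telescope against a bounded increasing function
(`sum_lacunary_le`), so any part of the datum has norm at most `8 / Γ₂(r)` in `Ḃ^{-1}_{∞,∞}`
(`besovNorm_datum_le`). The waves `v_j cos(𝐤_j · x)` with `j ≤ r` form the shear datum.

*Existence.* The solution is sought as a Fourier series with absolutely summable coefficients
`U + W`, where `U` is the heat flow of the datum. The coefficients of `U` have `ℓ¹` norm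
`C ≲_r T^{-1/2}`, which is critical, so the terms linear in `W` are not small on `[0, 2T]`; they are
absorbed by the damping `e^{-μt}` with `μ` a large multiple (depending on `r`) of `1 / T`, at the
price of a constant `e^{2μT}`. Since the datum is horizontal and its horizontal frequencies are
bounded by `1`, the self-interaction of `U` loses no derivative and has `ℓ¹` norm `≲ T C² ≲_r 1`,
whereas the quadratic term in `W` carries a factor `T^{1/2}`. A contraction argument
(`exists_mild_correction`) yields `W` of `ℓ¹` norm `O_r(1)`. Parabolic smoothing turns the mild
solution into a smooth one (`smoothFam_of_mild`, `isSmoothNSSolution_velocity`); uniqueness is the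
energy method, as the constructed solution has bounded gradient
(`IsSmoothNSSolution.eq_of_bounded_gradient`).

*Inflation.* The two waves with the same index `j` interact into a frequency `𝐤_j - 𝐤'_j` that only
depends on the group and is generated by no other pair (`signedFreq_add_eq_lowFreq_iff`). Each pair
contributes about `k_j² / (j Γ₂²) · k_j⁻²`, so that the low mode of each group has size
`≳ (∑ 1/j) / Γ₂² ≳ Γ₂(r)` (`exists_nsDuhamel_datum_lowFreq`, `Gam2_pow_three_sub_one_le`), while all
interactions with `W` contribute `O_r(T^{1/2})` to a low mode. The directions of the three
low modes span `ℝ³` (`exists_abs_sum_mul_lowDir`), and a single Fourier mode bounds the Besov norm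
from below (`ofReal_norm_coeff_le_besovNorm`), whence inflation in every direction.
-/


/-! ### Convolution of summable families on the frequency lattice -/

/-- The lattice of frequencies of the torus. -/
abbrev Freq : Type := Fin 3 → ℤ

/-- Convolution of two families indexed by the lattice; for families that are not absolutely
summable the value may be the junk value of `tsum`. -/
noncomputable def conv {R : Type*} [NormedCommRing R] (a b : Freq → R) (n : Freq) : R :=
  ∑' m, a m * b (n - m)

/-- The shear `(n, m) ↦ (m, n - m)` of pairs of frequencies. -/
def freqShear : Freq × Freq ≃ Freq × Freq where
  toFun p := (p.2, p.1 - p.2)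
  invFun p := (p.1 + p.2, p.1)
  left_inv p := by ext <;> simp
  right_inv p := by ext <;> simp

section conv
variable {R : Type*} [NormedCommRing R] {a b c : Freq → R}

lemma summable_norm_mul_freqShear (ha : Summable fun n => ‖a n‖) (hb : Summable fun n => ‖b n‖) :
    Summable fun p : Freq × Freq => ‖a p.2 * b (p.1 - p.2)‖ :=
  (freqShear.summable_iff (f := fun x : Freq × Freq => ‖a x.1 * b x.2‖)).2 (ha.mul_norm hb)

lemma summable_mul_norm_freqShear (ha : Summable fun n => ‖a n‖) (hb : Summable fun n => ‖b n‖) :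
    Summable fun p : Freq × Freq => ‖a p.2‖ * ‖b (p.1 - p.2)‖ :=
  (freqShear.summable_iff (f := fun x : Freq × Freq => ‖a x.1‖ * ‖b x.2‖)).2
    (Summable.mul_of_nonneg ha hb (fun _ => norm_nonneg _) (fun _ => norm_nonneg _))

lemma summable_norm_conv_term (ha : Summable fun n => ‖a n‖) (hb : Summable fun n => ‖b n‖)
    (n : Freq) : Summable fun m => ‖a m * b (n - m)‖ :=
  (summable_norm_mul_freqShear ha hb).prod_factor n

lemma norm_conv_le (ha : Summable fun n => ‖a n‖) (hb : Summable fun n => ‖b n‖) (n : Freq) :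
    ‖conv a b n‖ ≤ ∑' m, ‖a m‖ * ‖b (n - m)‖ :=
  (norm_tsum_le_tsum_norm (summable_norm_conv_term ha hb n)).trans
    ((summable_norm_conv_term ha hb n).tsum_le_tsum (fun _ => norm_mul_le _ _)
      ((summable_mul_norm_freqShear ha hb).prod_factor n))

lemma summable_tsum_mul_norm (ha : Summable fun n => ‖a n‖) (hb : Summable fun n => ‖b n‖) :
    Summable fun n => ∑' m, ‖a m‖ * ‖b (n - m)‖ :=
  (summable_mul_norm_freqShear ha hb).prod

lemma summable_norm_conv (ha : Summable fun n => ‖a n‖) (hb : Summable fun n => ‖b n‖) :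
    Summable fun n => ‖conv a b n‖ :=
  Summable.of_nonneg_of_le (fun _ => norm_nonneg _) (norm_conv_le ha hb)
    (summable_tsum_mul_norm ha hb)

lemma tsum_norm_conv_le (ha : Summable fun n => ‖a n‖) (hb : Summable fun n => ‖b n‖) :
    ∑' n, ‖conv a b n‖ ≤ (∑' n, ‖a n‖) * ∑' n, ‖b n‖ := by
  have h := summable_mul_norm_freqShear ha hb
  refine ((summable_norm_conv ha hb).tsum_le_tsum (norm_conv_le ha hb)
    (summable_tsum_mul_norm ha hb)).trans (le_of_eq ?_)
  rw [← h.tsum_prod, Summable.tsum_mul_tsum ha hb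
    (Summable.mul_of_nonneg ha hb (fun _ => norm_nonneg _) (fun _ => norm_nonneg _))]
  exact freqShear.tsum_eq (fun x : Freq × Freq => ‖a x.1‖ * ‖b x.2‖)

lemma norm_conv_le_mul (ha : Summable fun n => ‖a n‖) (hb : Summable fun n => ‖b n‖) (n : Freq) :
    ‖conv a b n‖ ≤ (∑' n, ‖a n‖) * ∑' n, ‖b n‖ :=
  ((summable_norm_conv ha hb).le_tsum n fun _ _ => norm_nonneg _).trans (tsum_norm_conv_le ha hb)

section complete
variable [CompleteSpace R]

lemma conv_term_summable (ha : Summable fun n => ‖a n‖) (hb : Summable fun n => ‖b n‖) (n : Freq) :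
    Summable fun m => a m * b (n - m) :=
  (summable_norm_conv_term ha hb n).of_norm

lemma conv_add_left (ha : Summable fun n => ‖a n‖) (hb : Summable fun n => ‖b n‖)
    (hc : Summable fun n => ‖c n‖) : conv (a + b) c = conv a c + conv b c := by
  funext n
  simp only [conv, Pi.add_apply, add_mul]
  exact (conv_term_summable ha hc n).tsum_add (conv_term_summable hb hc n)

lemma conv_sub_left (ha : Summable fun n => ‖a n‖) (hb : Summable fun n => ‖b n‖)
    (hc : Summable fun n => ‖c n‖) : conv (a - b) c = conv a c - conv b c := by
  funext n
  simp only [conv, Pi.sub_apply, sub_mul]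
  exact (conv_term_summable ha hc n).tsum_sub (conv_term_summable hb hc n)

lemma conv_add_right (ha : Summable fun n => ‖a n‖) (hb : Summable fun n => ‖b n‖)
    (hc : Summable fun n => ‖c n‖) : conv c (a + b) = conv c a + conv c b := by
  funext n
  simp only [conv, Pi.add_apply, mul_add]
  exact (conv_term_summable hc ha n).tsum_add (conv_term_summable hc hb n)

lemma conv_sub_right (ha : Summable fun n => ‖a n‖) (hb : Summable fun n => ‖b n‖)
    (hc : Summable fun n => ‖c n‖) : conv c (a - b) = conv c a - conv c b := by
  funext n
  simp only [conv, Pi.sub_apply, mul_sub]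
  exact (conv_term_summable hc ha n).tsum_sub (conv_term_summable hc hb n)

lemma mul_conv (r : R) (n : Freq) (ha : Summable fun n => ‖a n‖) (hb : Summable fun n => ‖b n‖) :
    r * conv a b n = conv (fun m => r * a m) b n := by
  simp only [conv, mul_assoc]
  exact ((conv_term_summable ha hb n).tsum_mul_left r).symm

lemma conv_mul (r : R) (n : Freq) (ha : Summable fun n => ‖a n‖) (hb : Summable fun n => ‖b n‖) :
    r * conv a b n = conv a (fun m => r * b m) n := by
  simp only [conv, mul_left_comm _ r]
  exact ((conv_term_summable ha hb n).tsum_mul_left r).symm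

/-- Leibniz rule: multiplication by an additive function of the frequency is a derivation of the
convolution algebra. -/
lemma smul_conv_eq_add [NormedAlgebra ℂ R] {q : Freq → ℂ} (hq : ∀ m n, q (m + n) = q m + q n)
    (n : Freq) (ha : Summable fun n => ‖a n‖) (hb : Summable fun n => ‖b n‖)
    (ha' : Summable fun n : Freq => ‖q n • a n‖) (hb' : Summable fun n : Freq => ‖q n • b n‖) :
    q n • conv a b n = conv (fun m => q m • a m) b n + conv a (fun m => q m • b m) n := by
  simp only [conv]
  rw [← (conv_term_summable ha' hb n).tsum_add (conv_term_summable ha hb' n),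
    ← (conv_term_summable ha hb n).tsum_const_smul]
  refine tsum_congr fun m => ?_
  rw [smul_mul_assoc, mul_smul_comm, ← add_smul, ← hq, add_sub_cancel]

/-- A continuous ring homomorphism intertwines the convolutions. -/
lemma map_conv {S : Type*} [NormedCommRing S] (φ : R →+* S) (hφ : Continuous φ)
    (ha : Summable fun n => ‖a n‖) (hb : Summable fun n => ‖b n‖) (n : Freq) :
    φ (conv a b n) = conv (fun m => φ (a m)) (fun m => φ (b m)) n := by
  simp only [conv]
  rw [(conv_term_summable ha hb n).map_tsum φ hφ]
  simp

lemma tsum_conv (ha : Summable fun n => ‖a n‖) (hb : Summable fun n => ‖b n‖) :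
    ∑' n, conv a b n = (∑' n, a n) * ∑' n, b n := by
  have h := (summable_norm_mul_freqShear ha hb).of_norm
  simp only [conv]
  rw [← h.tsum_prod, tsum_mul_tsum_of_summable_norm ha hb]
  exact freqShear.tsum_eq (fun x : Freq × Freq => a x.1 * b x.2)

end complete

lemma conv_neg_star [StarRing R] [NormedStarGroup R] (a b : Freq → R) (n : Freq) :
    star (conv a b (-n)) = conv (fun m => star (a (-m))) (fun m => star (b (-m))) n := by
  simp only [conv]
  rw [← (Equiv.neg Freq).tsum_eq, tsum_star]
  refine tsum_congr fun m => ?_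
  simp only [Equiv.neg_apply, star_mul']
  congr 3
  abel

/-- Convolution is compatible with any character of the lattice. -/
lemma conv_mul_char (e : Freq → R) (he : ∀ m n, e (m + n) = e m * e n) (a b : Freq → R)
    (n : Freq) [CompleteSpace R] (ha : Summable fun n => ‖a n‖) (hb : Summable fun n => ‖b n‖) :
    conv a b n * e n = conv (fun m => a m * e m) (fun m => b m * e m) n := by
  simp only [conv]
  rw [← (conv_term_summable ha hb n).tsum_mul_right]
  refine tsum_congr fun m => ?_
  rw [← add_sub_cancel m n, he, add_sub_cancel]
  ring

/-! ### Polynomial weights -/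

/-- The weight `1 + |n₁| + |n₂| + |n₃|` of a frequency. -/
noncomputable def freqWeight (n : Freq) : ℝ := 1 + ∑ i, |(n i : ℝ)|

lemma one_le_freqWeight (n : Freq) : 1 ≤ freqWeight n :=
  le_add_of_nonneg_right (Finset.sum_nonneg fun _ _ => abs_nonneg _)

lemma freqWeight_pos (n : Freq) : 0 < freqWeight n := one_pos.trans_le (one_le_freqWeight n)

lemma abs_le_freqWeight (n : Freq) (i : Fin 3) : |(n i : ℝ)| ≤ freqWeight n := by
  have := Finset.single_le_sum (f := fun i => |(n i : ℝ)|) (fun _ _ => abs_nonneg _)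
    (Finset.mem_univ i)
  simp only [freqWeight]
  linarith

lemma freqWeight_add_le (m n : Freq) : freqWeight (m + n) ≤ freqWeight m * freqWeight n := by
  have h : ∑ i, |((m + n) i : ℝ)| ≤ ∑ i, |(m i : ℝ)| + ∑ i, |(n i : ℝ)| := by
    rw [← Finset.sum_add_distrib]
    exact Finset.sum_le_sum fun i _ => by simpa using abs_add_le (m i : ℝ) (n i)
  have h1 : 0 ≤ ∑ i, |(m i : ℝ)| := Finset.sum_nonneg fun _ _ => abs_nonneg _
  have h2 : 0 ≤ ∑ i, |(n i : ℝ)| := Finset.sum_nonneg fun _ _ => abs_nonneg _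
  simp only [freqWeight]
  nlinarith

/-- The weighted `ℓ¹` spaces with weight `freqWeight ^ k` are convolution algebras. -/
lemma summable_freqWeight_conv [CompleteSpace R] (k : ℕ)
    (ha : Summable fun n => freqWeight n ^ k * ‖a n‖)
    (hb : Summable fun n => freqWeight n ^ k * ‖b n‖) :
    Summable fun n => freqWeight n ^ k * ‖conv a b n‖ := by
  have key : ∀ c : Freq → R, Summable (fun n => freqWeight n ^ k * ‖c n‖) →
      Summable (fun n => ‖c n‖) := fun c hc =>
    Summable.of_nonneg_of_le (fun _ => norm_nonneg _) (fun n =>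
      le_mul_of_one_le_left (norm_nonneg _) (one_le_pow₀ (one_le_freqWeight n))) hc
  have hW : ∀ c : Freq → R, Summable (fun n => freqWeight n ^ k * ‖c n‖) →
      Summable (fun n => ‖freqWeight n ^ k * ‖c n‖‖) := fun c hc => hc.norm
  refine Summable.of_nonneg_of_le (fun n => by have := freqWeight_pos n; positivity) (fun n => ?_)
    (summable_tsum_mul_norm (hW a ha) (hW b hb))
  refine (mul_le_mul_of_nonneg_left (norm_conv_le (key a ha) (key b hb) n)
    (pow_nonneg (freqWeight_pos n).le k)).trans ?_
  rw [← tsum_mul_left]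
  refine Summable.tsum_le_tsum (fun m => ?_)
    (((summable_mul_norm_freqShear (key a ha) (key b hb)).prod_factor n).mul_left _)
    ((summable_mul_norm_freqShear (hW a ha) (hW b hb)).prod_factor n)
  have h1 : freqWeight n ^ k ≤ freqWeight m ^ k * freqWeight (n - m) ^ k := by
    rw [← mul_pow]
    refine pow_le_pow_left₀ (freqWeight_pos n).le ?_ k
    simpa using freqWeight_add_le m (n - m)
  have h2 := pow_nonneg (freqWeight_pos m).le k
  have h3 := pow_nonneg (freqWeight_pos (n - m)).le k
  rw [norm_mul, norm_mul, norm_norm, norm_norm, norm_of_nonneg h2, norm_of_nonneg h3]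
  calc _ ≤ (freqWeight m ^ k * freqWeight (n - m) ^ k) * (‖a m‖ * ‖b (n - m)‖) := by gcongr
    _ = _ := by ring

end conv

/-! ### A quadratic fixed point problem -/

/-- Contraction argument for `w = E + B(V, w) + B(w, V) + B(w, w)` in the ball of radius `R`, with
a symmetry `J` inherited by the fixed point. -/
theorem exists_quadratic_fixedPoint {X : Type*} [NormedAddCommGroup X] [CompleteSpace X]
    (B : X → X → X) (hl : ∀ x y z, B (x - y) z = B x z - B y z)
    (hr : ∀ x y z, B x (y - z) = B x y - B x z) (V E : X) (J : X → X) (hJc : Continuous J)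
    (hJ0 : J 0 = 0)
    (hJ : ∀ w, J w = w → J (E + (B V w + B w V) + B w w) = E + (B V w + B w V) + B w w)
    {β R : ℝ} (hβ0 : 0 ≤ β) (hR : 0 ≤ R) (hβ : ∀ x y, ‖B x y‖ ≤ β * ‖x‖ * ‖y‖)
    (hV : ∀ w, ‖B V w + B w V‖ ≤ ‖w‖ / 2) (hE : ‖E‖ ≤ R / 4) (hβR : β * R ≤ 1 / 8) :
    ∃ w, ‖w‖ ≤ R ∧ J w = w ∧ w = E + (B V w + B w V) + B w w := by
  set Φ : X → X := fun w => E + (B V w + B w V) + B w w with hΦ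
  set s : Set X := {w | ‖w‖ ≤ R ∧ J w = w} with hs
  have hsc : IsClosed s :=
    (isClosed_le continuous_norm continuous_const).inter (isClosed_eq hJc continuous_id)
  have hmaps : MapsTo Φ s s := by
    rintro w ⟨hw, hJw⟩
    refine ⟨?_, hJ w hJw⟩
    have h1 : ‖B w w‖ ≤ R / 8 := by
      refine (hβ w w).trans ?_
      calc β * ‖w‖ * ‖w‖ ≤ β * R * R := by gcongr
        _ ≤ 1 / 8 * R := by gcongr
        _ = R / 8 := by ring
    calc ‖Φ w‖ ≤ ‖E‖ + ‖B V w + B w V‖ + ‖B w w‖ := norm_add₃_le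
      _ ≤ R / 4 + R / 2 + R / 8 := by
          gcongr
          exact (hV w).trans (by linarith)
      _ ≤ R := by linarith
  have hlip : ∀ x ∈ s, ∀ y ∈ s, dist (Φ x) (Φ y) ≤ 3 / 4 * dist x y := by
    rintro x ⟨hx, -⟩ y ⟨hy, -⟩
    have e1 : Φ x - Φ y
        = (B V (x - y) + B (x - y) V) + (B x (x - y) + B (x - y) y) := by
      simp only [hΦ, hl, hr]
      abel
    rw [dist_eq_norm, dist_eq_norm, e1]
    have h1 : ‖B x (x - y)‖ ≤ 1 / 8 * ‖x - y‖ := (hβ _ _).trans (by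
      gcongr
      exact (mul_le_mul_of_nonneg_left hx hβ0).trans hβR)
    have h2 : ‖B (x - y) y‖ ≤ 1 / 8 * ‖x - y‖ := (hβ _ _).trans (by
      rw [mul_right_comm]
      gcongr
      exact (mul_le_mul_of_nonneg_left hy hβ0).trans hβR)
    have h3 := norm_add_le (B V (x - y) + B (x - y) V) (B x (x - y) + B (x - y) y)
    have h4 := norm_add_le (B x (x - y)) (B (x - y) y)
    have h5 := hV (x - y)
    linarith
  have hcontr : ContractingWith (3 / 4) (hmaps.restrict Φ s s) := by
    refine ⟨by rw [← NNReal.coe_lt_coe]; norm_num, LipschitzWith.of_dist_le_mul ?_⟩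
    rintro ⟨x, hx⟩ ⟨y, hy⟩
    change dist (Φ x) (Φ y) ≤ ((3 / 4 : NNReal) : ℝ) * dist x y
    simpa using hlip x hx y hy
  obtain ⟨w, ⟨hw, hJw⟩, hfix, -⟩ := hcontr.exists_fixedPoint' hsc.isComplete
    hmaps (x := 0) ⟨by simpa using hR, hJ0⟩ (edist_ne_top _ _)
  exact ⟨w, hw, hJw, hfix.symm⟩

/-! ### The Duhamel operator -/

/-- Bounded continuous complex functions of time. -/
abbrev TimeFn : Type := BoundedContinuousFunction ℝ ℂ

/-- Projection of the time line onto `[0, T]`. -/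
noncomputable def timeClamp (T t : ℝ) : ℝ := max 0 (min t T)

lemma continuous_timeClamp (T : ℝ) : Continuous (timeClamp T) := by
  unfold timeClamp; fun_prop

lemma timeClamp_nonneg (T t : ℝ) : 0 ≤ timeClamp T t := le_max_left _ _

lemma timeClamp_le {T : ℝ} (hT : 0 ≤ T) (t : ℝ) : timeClamp T t ≤ T :=
  max_le hT (min_le_right _ _)

lemma timeClamp_le_abs (T t : ℝ) : timeClamp T t ≤ |T| :=
  max_le (abs_nonneg T) ((min_le_right _ _).trans (le_abs_self T))

lemma timeClamp_of_mem {T t : ℝ} (ht : t ∈ Icc 0 T) : timeClamp T t = t := by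
  simp [timeClamp, ht.1, ht.2]

lemma duhamel_integral_bound {γ τ : ℝ} (hτ : 0 ≤ τ) (c : TimeFn) :
    ‖∫ s in (0 : ℝ)..τ, ((rexp (γ * s) : ℝ) : ℂ) * c s‖
      ≤ ‖c‖ * ∫ s in (0 : ℝ)..τ, rexp (γ * s) := by
  rw [← intervalIntegral.integral_const_mul]
  refine intervalIntegral.norm_integral_le_of_norm_le hτ (Eventually.of_forall fun s _ => ?_)
    (Continuous.intervalIntegrable (by fun_prop) _ _)
  rw [norm_mul, Complex.norm_real, norm_of_nonneg (exp_pos _).le, mul_comm]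
  exact mul_le_mul_of_nonneg_right (c.norm_coe_le_norm s) (exp_pos _).le

/-- Solution of `y' = -γ y + c`, `y(0) = 0` on `[0, T]`, extended by constants. -/
noncomputable def duhamel (T γ : ℝ) (c : TimeFn) : TimeFn :=
  BoundedContinuousFunction.ofNormedAddCommGroup
    (fun t => ((rexp (-(γ * timeClamp T t)) : ℝ) : ℂ) *
      ∫ s in (0 : ℝ)..timeClamp T t, ((rexp (γ * s) : ℝ) : ℂ) * c s)
    (by
      have h := continuous_timeClamp T
      refine Continuous.mul (by fun_prop) ?_
      exact (intervalIntegral.continuous_primitive (fun a b =>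
        Continuous.intervalIntegrable (by fun_prop) a b) 0).comp h)
    (rexp (|γ| * |T|) * (‖c‖ * (rexp (|γ| * |T|) * |T|)))
    (by
      intro t
      have h0 := timeClamp_nonneg T t
      have h1 := timeClamp_le_abs T t
      rw [norm_mul, Complex.norm_real, norm_of_nonneg (exp_pos _).le]
      have h2 : ∀ s, 0 ≤ s → s ≤ timeClamp T t → γ * s ≤ |γ| * |T| := fun s hs hs' =>
        mul_le_mul (le_abs_self γ) (hs'.trans h1) hs (abs_nonneg γ)
      gcongr
      · have := mul_le_mul (neg_le_abs γ) h1 h0 (abs_nonneg γ)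
        linarith
      · refine (duhamel_integral_bound h0 c).trans ?_
        gcongr
        have := intervalIntegral.norm_integral_le_of_norm_le_const (a := 0) (b := timeClamp T t)
          (f := fun s => rexp (γ * s)) (C := rexp (|γ| * |T|)) (fun s hs => by
            rw [uIoc_of_le h0] at hs
            rw [norm_of_nonneg (exp_pos _).le]
            exact exp_le_exp.2 (h2 s hs.1.le hs.2))
        refine (le_abs_self _).trans (this.trans ?_)
        rw [sub_zero, abs_of_nonneg h0]
        gcongr)

lemma duhamel_apply (T γ : ℝ) (c : TimeFn) (t : ℝ) :
    duhamel T γ c t = ((rexp (-(γ * timeClamp T t)) : ℝ) : ℂ) *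
      ∫ s in (0 : ℝ)..timeClamp T t, ((rexp (γ * s) : ℝ) : ℂ) * c s := rfl

lemma duhamel_norm_le_div (T : ℝ) {γ : ℝ} (hγ : 0 < γ) (c : TimeFn) :
    ‖duhamel T γ c‖ ≤ ‖c‖ / γ := by
  refine (BoundedContinuousFunction.norm_le (by positivity)).2 fun t => ?_
  rw [duhamel_apply, norm_mul, Complex.norm_real, norm_of_nonneg (exp_pos _).le]
  refine (mul_le_mul_of_nonneg_left (duhamel_integral_bound (timeClamp_nonneg T t) c)
    (exp_pos _).le).trans ?_
  have h : ∫ s in (0 : ℝ)..timeClamp T t, rexp (γ * s) = (rexp (γ * timeClamp T t) - 1) / γ := by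
    rw [intervalIntegral.integral_comp_mul_left (fun x => rexp x) hγ.ne', integral_exp]
    simp [div_eq_inv_mul]
  rw [h]
  have h2 : rexp (-(γ * timeClamp T t)) * rexp (γ * timeClamp T t) = 1 := by
    rw [← exp_add]; simp
  have h3 := exp_pos (-(γ * timeClamp T t))
  calc _ = ‖c‖ / γ * (rexp (-(γ * timeClamp T t)) * rexp (γ * timeClamp T t)
        - rexp (-(γ * timeClamp T t))) := by ring
    _ ≤ ‖c‖ / γ * 1 := by
        gcongr
        rw [h2]; linarith
    _ = _ := mul_one _

lemma duhamel_norm_le_mul {T γ : ℝ} (hT : 0 ≤ T) (hγ : 0 ≤ γ) (c : TimeFn) :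
    ‖duhamel T γ c‖ ≤ T * ‖c‖ := by
  refine (BoundedContinuousFunction.norm_le (by positivity)).2 fun t => ?_
  have h0 := timeClamp_nonneg T t
  rw [duhamel_apply, norm_mul, Complex.norm_real, norm_of_nonneg (exp_pos _).le]
  refine (mul_le_mul_of_nonneg_left (duhamel_integral_bound h0 c) (exp_pos _).le).trans ?_
  have h := intervalIntegral.norm_integral_le_of_norm_le_const (a := 0) (b := timeClamp T t)
    (f := fun s => rexp (γ * s)) (C := rexp (γ * timeClamp T t)) (fun s hs => by
      rw [uIoc_of_le h0] at hs
      rw [norm_of_nonneg (exp_pos _).le]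
      exact exp_le_exp.2 (mul_le_mul_of_nonneg_left hs.2 hγ))
  rw [sub_zero, abs_of_nonneg h0] at h
  have h2 : rexp (-(γ * timeClamp T t)) * rexp (γ * timeClamp T t) = 1 := by
    rw [← exp_add]; simp
  calc _ ≤ rexp (-(γ * timeClamp T t)) * (‖c‖ * (rexp (γ * timeClamp T t) * timeClamp T t)) := by
        gcongr
        exact (le_abs_self _).trans h
    _ = (rexp (-(γ * timeClamp T t)) * rexp (γ * timeClamp T t)) * (timeClamp T t * ‖c‖) := by ring
    _ ≤ T * ‖c‖ := by
        rw [h2, one_mul]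
        exact mul_le_mul_of_nonneg_right (timeClamp_le hT t) (norm_nonneg _)

lemma duhamel_intervalIntegrable (γ : ℝ) (c : TimeFn) (a b : ℝ) :
    IntervalIntegrable (fun s => ((rexp (γ * s) : ℝ) : ℂ) * c s) volume a b :=
  Continuous.intervalIntegrable (by fun_prop) a b

lemma duhamel_sub (T γ : ℝ) (c d : TimeFn) :
    duhamel T γ (c - d) = duhamel T γ c - duhamel T γ d := by
  ext t
  simp only [BoundedContinuousFunction.coe_sub, Pi.sub_apply, duhamel_apply, mul_sub]
  rw [intervalIntegral.integral_sub (duhamel_intervalIntegrable γ c _ _)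
    (duhamel_intervalIntegrable γ d _ _)]
  ring

lemma duhamel_star (T γ : ℝ) (c : TimeFn) : duhamel T γ (star c) = star (duhamel T γ c) := by
  ext t
  simp only [BoundedContinuousFunction.star_apply, duhamel_apply, star_mul',
    RCLike.star_def, Complex.conj_ofReal]
  congr 1
  rw [intervalIntegral.integral_of_le (timeClamp_nonneg T t),
    intervalIntegral.integral_of_le (timeClamp_nonneg T t), ← integral_conj]
  simp only [map_mul, Complex.conj_ofReal]

lemma hasDerivAt_duhamel {T γ t : ℝ} (ht : t ∈ Ioo 0 T) (c : TimeFn) :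
    HasDerivAt (duhamel T γ c) (-(γ : ℂ) * duhamel T γ c t + c t) t := by
  have h1 : HasDerivAt (fun t : ℝ => ((rexp (-(γ * t)) : ℝ) : ℂ))
      ((rexp (-(γ * t)) * (-(γ * 1)) : ℝ) : ℂ) t :=
    (((hasDerivAt_id t).const_mul γ).neg.exp).ofReal_comp
  have h2 : HasDerivAt (fun t : ℝ => ∫ s in (0 : ℝ)..t, ((rexp (γ * s) : ℝ) : ℂ) * c s)
      (((rexp (γ * t) : ℝ) : ℂ) * c t) t := by
    have hc : Continuous fun s => ((rexp (γ * s) : ℝ) : ℂ) * c s := by fun_prop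
    exact intervalIntegral.integral_hasDerivAt_right (hc.intervalIntegrable _ _)
      (hc.stronglyMeasurableAtFilter _ _) hc.continuousAt
  have h3 := h1.mul h2
  have he : duhamel T γ c =ᶠ[𝓝 t] fun t => ((rexp (-(γ * t)) : ℝ) : ℂ) *
      ∫ s in (0 : ℝ)..t, ((rexp (γ * s) : ℝ) : ℂ) * c s := by
    filter_upwards [Ioo_mem_nhds ht.1 ht.2] with x hx
    rw [duhamel_apply, timeClamp_of_mem (Ioo_subset_Icc_self hx)]
  refine (h3.congr_of_eventuallyEq he).congr_deriv ?_
  rw [duhamel_apply, timeClamp_of_mem (Ioo_subset_Icc_self ht)]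
  have h4 : ((rexp (-(γ * t)) : ℝ) : ℂ) * ((rexp (γ * t) : ℝ) : ℂ) = 1 := by
    rw [← Complex.ofReal_mul, ← exp_add]; simp
  rw [← mul_assoc _ _ (c t), h4]
  push_cast
  ring

/-! ### The bilinear operator of the mild Navier-Stokes equations -/

/-- The exponential `t ↦ exp (μ t)`, frozen outside `[0, T]`. -/
noncomputable def expWeight (T μ : ℝ) : TimeFn :=
  BoundedContinuousFunction.ofNormedAddCommGroup
    (fun t => ((rexp (μ * timeClamp T t) : ℝ) : ℂ))
    (by have := continuous_timeClamp T; fun_prop) (rexp (|μ| * |T|))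
    (by
      intro t
      rw [Complex.norm_real, norm_of_nonneg (exp_pos _).le]
      exact exp_le_exp.2 (mul_le_mul (le_abs_self μ) (timeClamp_le_abs T t)
        (timeClamp_nonneg T t) (abs_nonneg μ)))

lemma expWeight_apply (T μ t : ℝ) : expWeight T μ t = ((rexp (μ * timeClamp T t) : ℝ) : ℂ) := rfl

lemma expWeight_norm_le {T μ : ℝ} (hT : 0 ≤ T) (hμ : 0 ≤ μ) : ‖expWeight T μ‖ ≤ rexp (μ * T) := by
  refine (BoundedContinuousFunction.norm_le (exp_pos _).le).2 fun t => ?_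
  rw [expWeight_apply, Complex.norm_real, norm_of_nonneg (exp_pos _).le]
  exact exp_le_exp.2 (mul_le_mul_of_nonneg_left (timeClamp_le hT t) hμ)

lemma expWeight_norm_le_one {T μ : ℝ} (hμ : μ ≤ 0) : ‖expWeight T μ‖ ≤ 1 := by
  refine (BoundedContinuousFunction.norm_le zero_le_one).2 fun t => ?_
  rw [expWeight_apply, Complex.norm_real, norm_of_nonneg (exp_pos _).le]
  exact exp_le_one_iff.2 (mul_nonpos_of_nonpos_of_nonneg hμ (timeClamp_nonneg T t))

lemma expWeight_mul_neg (T μ : ℝ) : expWeight T μ * expWeight T (-μ) = 1 := by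
  ext t
  simp only [BoundedContinuousFunction.coe_mul, Pi.mul_apply, expWeight_apply,
    BoundedContinuousFunction.coe_one, Pi.one_apply]
  rw [← Complex.ofReal_mul, ← exp_add]
  simp

lemma star_expWeight (T μ : ℝ) : star (expWeight T μ) = expWeight T μ := by
  ext t
  simp only [BoundedContinuousFunction.star_apply, expWeight_apply, RCLike.star_def,
    Complex.conj_ofReal]

lemma expWeight_mul_duhamel {T : ℝ} (hT : 0 ≤ T) (γ μ : ℝ) (c : TimeFn) :
    expWeight T μ * duhamel T (γ + μ) c = duhamel T γ (expWeight T μ * c) := by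
  ext t
  simp only [BoundedContinuousFunction.coe_mul, Pi.mul_apply, expWeight_apply, duhamel_apply]
  rw [← mul_assoc, ← Complex.ofReal_mul, ← exp_add]
  congr 1
  · congr 2
    ring
  · refine intervalIntegral.integral_congr fun s hs => ?_
    rw [uIcc_of_le (timeClamp_nonneg T t)] at hs
    rw [timeClamp_of_mem ⟨hs.1, hs.2.trans (timeClamp_le hT t)⟩, ← mul_assoc,
      ← Complex.ofReal_mul, ← exp_add, add_mul]

/-- The squared Euclidean length of a frequency. -/
noncomputable def freqSq (n : Freq) : ℝ := ∑ i, (n i : ℝ) ^ 2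

lemma freqSq_nonneg (n : Freq) : 0 ≤ freqSq n := Finset.sum_nonneg fun _ _ => sq_nonneg _

lemma sq_le_freqSq (n : Freq) (i : Fin 3) : (n i : ℝ) ^ 2 ≤ freqSq n :=
  Finset.single_le_sum (f := fun i => (n i : ℝ) ^ 2) (fun _ _ => sq_nonneg _) (Finset.mem_univ i)

lemma freqSq_neg (n : Freq) : freqSq (-n) = freqSq n := by simp [freqSq]

lemma abs_mul_le_freqSq (n : Freq) (i k : Fin 3) : |(n i : ℝ) * n k| ≤ freqSq n := by
  have h1 := sq_le_freqSq n i
  have h2 := sq_le_freqSq n k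
  rw [abs_le]
  constructor <;> nlinarith [sq_nonneg ((n i : ℝ) - n k), sq_nonneg ((n i : ℝ) + n k)]

lemma abs_div_freqSq_le_one (n : Freq) (i k : Fin 3) :
    |(n i : ℝ) * n k / freqSq n| ≤ 1 := by
  rw [abs_div, abs_of_nonneg (freqSq_nonneg n)]
  exact div_le_one_of_le₀ (abs_mul_le_freqSq n i k) (freqSq_nonneg n)

/-- The symbol `(δ_{ik} - n_i n_k / |n|²) n_l` of the Leray projection composed with `-i ∂_l`; it
vanishes at `n = 0`. -/
noncomputable def lerayMult (i k l : Fin 3) (n : Freq) : ℝ :=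
  ((if i = k then 1 else 0) - (n i : ℝ) * n k / freqSq n) * n l

lemma lerayMult_neg (i k l : Fin 3) (n : Freq) : lerayMult i k l (-n) = -lerayMult i k l n := by
  simp [lerayMult, freqSq_neg]

lemma abs_lerayMult_le (i k l : Fin 3) (n : Freq) : |lerayMult i k l n| ≤ 2 * |(n l : ℝ)| := by
  rw [lerayMult, abs_mul]
  gcongr
  have h1 := abs_div_freqSq_le_one n i k
  have h2 := abs_sub (if i = k then (1 : ℝ) else 0) ((n i : ℝ) * n k / freqSq n)
  have h3 : |(if i = k then (1 : ℝ) else 0)| ≤ 1 := by split_ifs <;> simp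
  linarith

/-- The symbol of the Leray projection annihilates gradients. -/
lemma sum_mul_lerayMult (k l : Fin 3) (n : Freq) : ∑ i, (n i : ℝ) * lerayMult i k l n = 0 := by
  rcases (freqSq_nonneg n).eq_or_lt with h | h
  · have : (n l : ℝ) = 0 := by
      have := sq_le_freqSq n l
      rw [← h] at this
      exact pow_eq_zero_iff two_ne_zero |>.1 (le_antisymm this (sq_nonneg _))
    simp [lerayMult, this]
  · have e : ∀ i, (n i : ℝ) * lerayMult i k l n
        = ((if i = k then (n i : ℝ) else 0) - (n i : ℝ) ^ 2 * (n k / freqSq n)) * n l := by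
      intro i
      simp only [lerayMult]
      split_ifs <;> ring
    simp only [e, ← Finset.sum_mul, Finset.sum_sub_distrib]
    rw [Finset.sum_ite_eq' Finset.univ k, ← freqSq]
    simp [mul_div_cancel₀ _ h.ne']

/-- Fourier coefficients of the Duhamel term `-∫₀ᵗ e^{(ν Δ - μ) (t - s)} ℙ div c(s) ds` for a tensor
field with Fourier coefficients `c`. -/
noncomputable def nsDuhamel (ν μ T : ℝ) (c : Fin 3 → Fin 3 → Freq → TimeFn) (i : Fin 3)
    (n : Freq) : TimeFn :=
  ∑ k, ∑ l, (-Complex.I * (lerayMult i k l n : ℂ)) • duhamel T (ν * freqSq n + μ) (c l k n)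

lemma nsDuhamel_sub (ν μ T : ℝ) (c d : Fin 3 → Fin 3 → Freq → TimeFn) (i : Fin 3) (n : Freq) :
    nsDuhamel ν μ T (fun l k n => c l k n - d l k n) i n
      = nsDuhamel ν μ T c i n - nsDuhamel ν μ T d i n := by
  simp only [nsDuhamel, duhamel_sub, smul_sub, Finset.sum_sub_distrib]

lemma star_nsDuhamel_neg (ν μ T : ℝ) (c : Fin 3 → Fin 3 → Freq → TimeFn) (i : Fin 3) (n : Freq) :
    star (nsDuhamel ν μ T c i (-n)) = nsDuhamel ν μ T (fun l k n => star (c l k (-n))) i n := by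
  simp only [nsDuhamel, star_sum, star_smul, duhamel_star, lerayMult_neg, freqSq_neg]
  simp

lemma expWeight_mul_nsDuhamel {T : ℝ} (hT : 0 ≤ T) (ν μ : ℝ)
    (c : Fin 3 → Fin 3 → Freq → TimeFn) (i : Fin 3) (n : Freq) :
    expWeight T μ * nsDuhamel ν μ T c i n
      = nsDuhamel ν 0 T (fun l k n => expWeight T μ * c l k n) i n := by
  simp only [nsDuhamel, Finset.mul_sum, mul_smul_comm, expWeight_mul_duhamel hT, add_zero]

lemma norm_leray_smul (i k l : Fin 3) (n : Freq) (c : TimeFn) :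
    ‖(-Complex.I * (lerayMult i k l n : ℂ)) • c‖ ≤ 2 * |(n l : ℝ)| * ‖c‖ := by
  rw [norm_smul, norm_mul, norm_neg, Complex.norm_I, one_mul, Complex.norm_real, Real.norm_eq_abs]
  exact mul_le_mul_of_nonneg_right (abs_lerayMult_le i k l n) (norm_nonneg _)

/-- Parabolic smoothing with damping: the gain of one derivative costs `(ν μ)^{-1/2}`. -/
lemma norm_nsDuhamel_le {ν μ : ℝ} (hν : 0 < ν) (hμ : 0 < μ) (T : ℝ)
    (c : Fin 3 → Fin 3 → Freq → TimeFn) (i : Fin 3) (n : Freq) :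
    ‖nsDuhamel ν μ T c i n‖ ≤ (1 / √(ν * μ)) * ∑ k, ∑ l, ‖c l k n‖ := by
  simp only [nsDuhamel, Finset.mul_sum]
  refine norm_sum_le_of_le _ fun k _ => norm_sum_le_of_le _ fun l _ => ?_
  have hγ : 0 < ν * freqSq n + μ := by have := freqSq_nonneg n; positivity
  refine (norm_leray_smul i k l n _).trans ((mul_le_mul_of_nonneg_left
    (duhamel_norm_le_div T hγ _) (by positivity)).trans ?_)
  rw [mul_div_assoc', div_eq_mul_inv, mul_right_comm]
  gcongr
  rw [← div_eq_mul_inv, div_le_div_iff₀ hγ (by positivity)]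
  have h1 : √(ν * μ) = √ν * √μ := Real.sqrt_mul hν.le μ
  have h2 := Real.sq_sqrt hν.le
  have h3 := Real.sq_sqrt hμ.le
  have h4 : ν * |(n l : ℝ)| ^ 2 ≤ ν * freqSq n := by
    rw [sq_abs]; exact mul_le_mul_of_nonneg_left (sq_le_freqSq n l) hν.le
  rw [h1]
  nlinarith [sq_nonneg (√ν * |(n l : ℝ)| - √μ)]

lemma norm_nsDuhamel_le_mul {ν μ T : ℝ} (hν : 0 ≤ ν) (hμ : 0 ≤ μ) (hT : 0 ≤ T)
    (c : Fin 3 → Fin 3 → Freq → TimeFn) (i : Fin 3) (n : Freq) :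
    ‖nsDuhamel ν μ T c i n‖ ≤ ∑ k, ∑ l, 2 * |(n l : ℝ)| * (T * ‖c l k n‖) := by
  simp only [nsDuhamel]
  refine norm_sum_le_of_le _ fun k _ => norm_sum_le_of_le _ fun l _ => ?_
  have hγ : 0 ≤ ν * freqSq n + μ := by have := freqSq_nonneg n; positivity
  exact (norm_leray_smul i k l n _).trans (mul_le_mul_of_nonneg_left
    (duhamel_norm_le_mul hT hγ _) (by positivity))

/-- Parabolic smoothing in the form used for regularity: two derivatives are gained. -/
lemma freqSq_mul_norm_nsDuhamel_le {ν : ℝ} (hν : 0 < ν) (T : ℝ)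
    (c : Fin 3 → Fin 3 → Freq → TimeFn) (i : Fin 3) (n : Freq) :
    ν * freqSq n * ‖nsDuhamel ν 0 T c i n‖ ≤ ∑ k, ∑ l, 2 * |(n l : ℝ)| * ‖c l k n‖ := by
  rcases (freqSq_nonneg n).eq_or_lt with h | h
  · rw [← h, mul_zero, zero_mul]
    positivity
  have hγ : 0 < ν * freqSq n := by positivity
  simp only [nsDuhamel, add_zero]
  refine (mul_le_mul_of_nonneg_left (norm_sum_le_of_le _ fun k _ => norm_sum_le_of_le _
    fun l _ => (norm_leray_smul i k l n _).trans (mul_le_mul_of_nonneg_left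
    (duhamel_norm_le_div T hγ _) (by positivity))) hγ.le).trans (le_of_eq ?_)
  simp only [Finset.mul_sum]
  refine Finset.sum_congr rfl fun k _ => Finset.sum_congr rfl fun l _ => ?_
  field_simp

/-! ### Solution of the perturbed mild equation -/

/-- Absolutely summable families of bounded continuous functions of time. -/
abbrev CoefSpace : Type := lp (fun _ : Freq => TimeFn) 1

lemma CoefSpace.summable_norm (x : CoefSpace) : Summable fun n => ‖x n‖ := by
  simpa using (lp.memℓp x).summable (by simp)

lemma CoefSpace.norm_eq (x : CoefSpace) : ‖x‖ = ∑' n, ‖x n‖ := by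
  simpa using lp.norm_eq_tsum_rpow (p := 1) (by simp) x

/-- An absolutely summable family as an element of `CoefSpace`; junk value `0` otherwise. -/
noncomputable def CoefSpace.mk (c : Freq → TimeFn) : CoefSpace :=
  open Classical in
  if h : Summable fun n => ‖c n‖ then ⟨c, memℓp_gen (by simpa using h)⟩ else 0

lemma CoefSpace.coe_mk {c : Freq → TimeFn} (h : Summable fun n => ‖c n‖) :
    ⇑(CoefSpace.mk c) = c := by
  rw [CoefSpace.mk, dif_pos h]

lemma CoefSpace.norm_mk {c : Freq → TimeFn} (h : Summable fun n => ‖c n‖) :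
    ‖CoefSpace.mk c‖ = ∑' n, ‖c n‖ := by
  rw [CoefSpace.norm_eq, CoefSpace.coe_mk h]

lemma summable_mul_left_norm (θ : TimeFn) {c : Freq → TimeFn} (h : Summable fun n => ‖c n‖) :
    Summable fun n => ‖θ * c n‖ :=
  Summable.of_nonneg_of_le (fun _ => norm_nonneg _) (fun _ => norm_mul_le _ _) (h.mul_left ‖θ‖)

lemma tsum_norm_mul_left_le (θ : TimeFn) {c : Freq → TimeFn} (h : Summable fun n => ‖c n‖) :
    ∑' n, ‖θ * c n‖ ≤ ‖θ‖ * ∑' n, ‖c n‖ := by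
  rw [← tsum_mul_left]
  exact (summable_mul_left_norm θ h).tsum_le_tsum (fun _ => norm_mul_le _ _) (h.mul_left ‖θ‖)

lemma tsum_nsDuhamel_le {ν μ : ℝ} (hν : 0 < ν) (hμ : 0 < μ) (T : ℝ)
    {c : Fin 3 → Fin 3 → Freq → TimeFn} (hc : ∀ l k, Summable fun n => ‖c l k n‖) (i : Fin 3) :
    (Summable fun n => ‖nsDuhamel ν μ T c i n‖) ∧
      ∑' n, ‖nsDuhamel ν μ T c i n‖ ≤ (1 / √(ν * μ)) * ∑ k, ∑ l, ∑' n, ‖c l k n‖ := by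
  have hs : Summable fun n => (1 / √(ν * μ)) * ∑ k, ∑ l, ‖c l k n‖ :=
    (summable_sum fun k _ => summable_sum fun l _ => hc l k).mul_left _
  have hs' := Summable.of_nonneg_of_le (fun _ => norm_nonneg _)
    (fun n => norm_nsDuhamel_le hν hμ T c i n) hs
  refine ⟨hs', (hs'.tsum_le_tsum (fun n => norm_nsDuhamel_le hν hμ T c i n) hs).trans
    (le_of_eq ?_)⟩
  rw [tsum_mul_left, Summable.tsum_finsetSum fun k _ => summable_sum fun l _ => hc l k]
  congr 1
  exact Finset.sum_congr rfl fun k _ => Summable.tsum_finsetSum fun l _ => hc l k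

/-- The reflection `a_n ↦ conj a_{-n}`; its fixed points are the coefficients of real functions. -/
noncomputable def reflectFam (c : Freq → TimeFn) (n : Freq) : TimeFn := star (c (-n))

lemma summable_reflectFam {c : Freq → TimeFn} (h : Summable fun n => ‖c n‖) :
    Summable fun n => ‖reflectFam c n‖ := by
  simpa [reflectFam, norm_star, Function.comp_def] using (Equiv.neg Freq).summable_iff.2 h

lemma tsum_reflectFam (c : Freq → TimeFn) :
    ∑' n, ‖reflectFam c n‖ = ∑' n, ‖c n‖ := by
  simpa [reflectFam, norm_star] using (Equiv.neg Freq).tsum_eq (fun n => ‖c n‖)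

/-- The bilinear operator `B` with `e^{μt} B(x, y)` the Duhamel term of `e^{μt} x ⊗ e^{μt} y`, on
triples of summable families; for `ν, μ > 0` the value is never the junk value of `CoefSpace.mk`. -/
noncomputable def dampedBilin (ν μ T : ℝ) (x y : Fin 3 → CoefSpace) (i : Fin 3) : CoefSpace :=
  CoefSpace.mk (nsDuhamel ν μ T (fun l k n => expWeight T μ * conv (x l) (y k) n) i)

section damped
variable {ν μ T : ℝ}

lemma summable_weight_conv (x y : CoefSpace) :
    Summable fun n => ‖expWeight T μ * conv x y n‖ :=
  summable_mul_left_norm _ (summable_norm_conv x.summable_norm y.summable_norm)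

lemma dampedBilin_coe (hν : 0 < ν) (hμ : 0 < μ) (x y : Fin 3 → CoefSpace) (i : Fin 3) :
    ⇑(dampedBilin ν μ T x y i)
      = nsDuhamel ν μ T (fun l k n => expWeight T μ * conv (x l) (y k) n) i :=
  CoefSpace.coe_mk (tsum_nsDuhamel_le hν hμ T (fun _ _ => summable_weight_conv _ _) i).1

lemma dampedBilin_sub_left (hν : 0 < ν) (hμ : 0 < μ) (x y z : Fin 3 → CoefSpace) :
    dampedBilin ν μ T (x - y) z = dampedBilin ν μ T x z - dampedBilin ν μ T y z := by
  funext i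
  apply lp.ext
  rw [Pi.sub_apply, lp.coeFn_sub]
  simp only [dampedBilin_coe hν hμ]
  funext n
  rw [Pi.sub_apply, ← nsDuhamel_sub]
  congr 1
  funext l k n
  rw [Pi.sub_apply, lp.coeFn_sub, conv_sub_left (x l).summable_norm (y l).summable_norm
    (z k).summable_norm, Pi.sub_apply, mul_sub]

lemma dampedBilin_sub_right (hν : 0 < ν) (hμ : 0 < μ) (x y z : Fin 3 → CoefSpace) :
    dampedBilin ν μ T x (y - z) = dampedBilin ν μ T x y - dampedBilin ν μ T x z := by
  funext i
  apply lp.ext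
  rw [Pi.sub_apply, lp.coeFn_sub]
  simp only [dampedBilin_coe hν hμ]
  funext n
  rw [Pi.sub_apply, ← nsDuhamel_sub]
  congr 1
  funext l k n
  rw [Pi.sub_apply, lp.coeFn_sub, conv_sub_right (y k).summable_norm (z k).summable_norm
    (x l).summable_norm, Pi.sub_apply, mul_sub]

/-- Bound with the exponential weight put on the first factor. -/
lemma norm_dampedBilin_le_left (hν : 0 < ν) (hμ : 0 < μ) {x y : Fin 3 → CoefSpace} {C : ℝ}
    (hC : ∀ l, ∑' n, ‖expWeight T μ * x l n‖ ≤ C) :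
    ‖dampedBilin ν μ T x y‖ ≤ 9 * (1 / √(ν * μ)) * C * ‖y‖ := by
  have hC0 : 0 ≤ C := (tsum_nonneg fun _ => norm_nonneg _).trans (hC 0)
  refine (pi_norm_le_iff_of_nonneg (by positivity)).2 fun i => ?_
  have hs := tsum_nsDuhamel_le hν hμ T
    (c := fun l k n => expWeight T μ * conv (x l) (y k) n) (fun _ _ => summable_weight_conv _ _) i
  rw [dampedBilin, CoefSpace.norm_mk hs.1]
  refine hs.2.trans ?_
  have h1 : ∀ k l, ∑' n, ‖expWeight T μ * conv (x l) (y k) n‖ ≤ C * ‖y‖ := by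
    intro k l
    have e : ∀ n, expWeight T μ * conv (x l) (y k) n
        = conv (fun m => expWeight T μ * x l m) (y k) n := fun n =>
      mul_conv _ n (x l).summable_norm (y k).summable_norm
    simp only [e]
    refine (tsum_norm_conv_le (summable_mul_left_norm _ (x l).summable_norm)
      (y k).summable_norm).trans ?_
    rw [← CoefSpace.norm_eq]
    gcongr
    · exact hC l
    · exact norm_le_pi_norm y k
  calc _ ≤ (1 / √(ν * μ)) * ∑ _k : Fin 3, ∑ _l : Fin 3, C * ‖y‖ := by
        gcongr with k _ l _
        exact h1 k l
    _ = _ := by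
        simp only [Finset.sum_const, Finset.card_univ, Fintype.card_fin, nsmul_eq_mul]
        push_cast
        ring

/-- Bound with the exponential weight put on the second factor. -/
lemma norm_dampedBilin_le_right (hν : 0 < ν) (hμ : 0 < μ) {x y : Fin 3 → CoefSpace} {C : ℝ}
    (hC : ∀ l, ∑' n, ‖expWeight T μ * y l n‖ ≤ C) :
    ‖dampedBilin ν μ T x y‖ ≤ 9 * (1 / √(ν * μ)) * C * ‖x‖ := by
  have hC0 : 0 ≤ C := (tsum_nonneg fun _ => norm_nonneg _).trans (hC 0)
  refine (pi_norm_le_iff_of_nonneg (by positivity)).2 fun i => ?_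
  have hs := tsum_nsDuhamel_le hν hμ T
    (c := fun l k n => expWeight T μ * conv (x l) (y k) n) (fun _ _ => summable_weight_conv _ _) i
  rw [dampedBilin, CoefSpace.norm_mk hs.1]
  refine hs.2.trans ?_
  have h1 : ∀ k l, ∑' n, ‖expWeight T μ * conv (x l) (y k) n‖ ≤ ‖x‖ * C := by
    intro k l
    have e : ∀ n, expWeight T μ * conv (x l) (y k) n
        = conv (x l) (fun m => expWeight T μ * y k m) n := fun n =>
      conv_mul _ n (x l).summable_norm (y k).summable_norm
    simp only [e]
    refine (tsum_norm_conv_le (x l).summable_norm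
      (summable_mul_left_norm _ (y k).summable_norm)).trans ?_
    rw [← CoefSpace.norm_eq]
    gcongr
    · exact norm_le_pi_norm x l
    · exact hC k
  calc _ ≤ (1 / √(ν * μ)) * ∑ _k : Fin 3, ∑ _l : Fin 3, ‖x‖ * C := by
        gcongr with k _ l _
        exact h1 k l
    _ = _ := by
        simp only [Finset.sum_const, Finset.card_univ, Fintype.card_fin, nsmul_eq_mul]
        push_cast
        ring

lemma norm_dampedBilin_le (hν : 0 < ν) (hμ : 0 < μ) (hT : 0 ≤ T) (x y : Fin 3 → CoefSpace) :
    ‖dampedBilin ν μ T x y‖ ≤ 9 * (1 / √(ν * μ)) * rexp (μ * T) * ‖x‖ * ‖y‖ := by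
  refine (norm_dampedBilin_le_left (C := rexp (μ * T) * ‖x‖) hν hμ fun l => ?_).trans
    (le_of_eq (by ring))
  refine (tsum_norm_mul_left_le _ (x l).summable_norm).trans ?_
  rw [← CoefSpace.norm_eq]
  gcongr
  · exact expWeight_norm_le hT hμ.le
  · exact norm_le_pi_norm x l

lemma reflectFam_dampedBilin (hν : 0 < ν) (hμ : 0 < μ) (x y : Fin 3 → CoefSpace) (i : Fin 3) :
    reflectFam (dampedBilin ν μ T x y i)
      = nsDuhamel ν μ T
          (fun l k n => expWeight T μ * conv (reflectFam (x l)) (reflectFam (y k)) n) i := by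
  funext n
  rw [reflectFam, dampedBilin_coe hν hμ, star_nsDuhamel_neg]
  congr 1
  funext l k n
  rw [star_mul', star_expWeight, conv_neg_star]
  rfl

end damped

/-- Solvability of the mild Navier-Stokes equations near a given real field `U` with summable
coefficients: the correction `W` satisfies `U + W = U - ∫ e^{νΔ(t-s)} ℙ div ((U + W) ⊗ (U + W))`,
provided that the damping `μ` absorbs the terms linear in `W` (`hC`) and that the quadratic term is
small on the ball of radius `R` (`hR`). -/
theorem exists_mild_correction {ν μ T C R : ℝ} (hν : 0 < ν) (hμ : 0 < μ) (hT : 0 ≤ T)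
    (U : Fin 3 → Freq → TimeFn) (hU : ∀ l, Summable fun n => ‖U l n‖)
    (hUC : ∀ l, ∑' n, ‖U l n‖ ≤ C) (hreal : ∀ l n, star (U l (-n)) = U l n)
    (hC : 18 * (1 / √(ν * μ)) * C ≤ 1 / 2) (hR0 : 0 ≤ R)
    (hE : ∀ i, ∑' n, ‖nsDuhamel ν μ T
      (fun l k n => expWeight T (-μ) * conv (U l) (U k) n) i n‖ ≤ R / 4)
    (hR : 9 * (1 / √(ν * μ)) * rexp (μ * T) * R ≤ 1 / 8) :
    ∃ W : Fin 3 → Freq → TimeFn, (∀ l, Summable fun n => ‖W l n‖) ∧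
      (∀ l, ∑' n, ‖W l n‖ ≤ rexp (μ * T) * R) ∧ (∀ l n, star (W l (-n)) = W l n) ∧
      ∀ i n, W i n = nsDuhamel ν 0 T
        (fun l k n => conv (U l + W l) (U k + W k) n) i n := by
  -- With `w = e^{-μt} W` and `V = e^{-μt} U` the equation is
  -- `w = B(V, V) + B(V, w) + B(w, V) + B(w, w)` for the damped operator `B`.
  set V : Fin 3 → CoefSpace := fun l => CoefSpace.mk fun n => expWeight T (-μ) * U l n with hVdef
  have hVc : ∀ l, ⇑(V l) = fun n => expWeight T (-μ) * U l n := fun l =>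
    CoefSpace.coe_mk (summable_mul_left_norm _ (hU l))
  have hθV : ∀ l, (fun n => expWeight T μ * V l n) = U l := fun l => by
    funext n
    rw [hVc, ← mul_assoc, expWeight_mul_neg, one_mul]
  have hVr : ∀ l, reflectFam (V l) = V l := fun l => by
    funext n
    rw [reflectFam, hVc, star_mul', star_expWeight, hreal]
  -- `J w = w` expresses that `w` is the coefficient family of a real field.
  set J : (Fin 3 → CoefSpace) → Fin 3 → CoefSpace := fun x l => CoefSpace.mk (reflectFam (x l))
    with hJdef
  have hJc : ∀ x l, ⇑(J x l) = reflectFam (x l) := fun x l =>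
    CoefSpace.coe_mk (summable_reflectFam (x l).summable_norm)
  have hJiso : Isometry J := Isometry.of_dist_eq fun x y => by
    have : ∀ l, J x l - J y l = CoefSpace.mk (reflectFam ((x - y) l)) := fun l => by
      apply lp.ext
      rw [lp.coeFn_sub, hJc, hJc, CoefSpace.coe_mk (summable_reflectFam ((x - y) l).summable_norm)]
      funext n
      simp [reflectFam]
    rw [dist_eq_norm, dist_eq_norm, Pi.norm_def, Pi.norm_def]
    congr 1
    refine Finset.sup_congr rfl fun l _ => ?_
    rw [Pi.sub_apply, this]
    apply NNReal.coe_injective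
    rw [coe_nnnorm, coe_nnnorm, CoefSpace.norm_mk (summable_reflectFam ((x - y) l).summable_norm),
      tsum_reflectFam, ← CoefSpace.norm_eq]
  set B := dampedBilin ν μ T with hB
  have hBr : ∀ x y : Fin 3 → CoefSpace, (∀ l, reflectFam (x l) = x l) →
      (∀ l, reflectFam (y l) = y l) → ∀ i, reflectFam (B x y i) = B x y i := fun x y hx hy i => by
    rw [hB, reflectFam_dampedBilin hν hμ, dampedBilin_coe hν hμ]
    simp only [hx, hy]
  have hEbound : ‖B V V‖ ≤ R / 4 := by
    refine (pi_norm_le_iff_of_nonneg (by positivity)).2 fun i => ?_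
    rw [CoefSpace.norm_eq, hB, dampedBilin_coe hν hμ]
    refine le_of_eq_of_le ?_ (hE i)
    congr 2
    funext n
    congr 2
    funext l k n
    rw [mul_conv _ n (V l).summable_norm (V k).summable_norm, hθV, hVc,
      ← conv_mul _ n (hU l) (hU k)]
  obtain ⟨w, hw, hwJ, hweq⟩ := exists_quadratic_fixedPoint B (dampedBilin_sub_left hν hμ)
    (dampedBilin_sub_right hν hμ) V (B V V) J hJiso.continuous
    (by
      funext l
      apply lp.ext
      rw [hJc]
      funext n
      simp [reflectFam])
    (by
      intro w hw
      have hwr : ∀ l, reflectFam (w l) = w l := fun l => by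
        rw [← hJc w l, hw]
      funext l
      apply lp.ext
      rw [hJc]
      funext n
      have e1 := congrFun (hBr V V hVr hVr l) n
      have e2 := congrFun (hBr V w hVr hwr l) n
      have e3 := congrFun (hBr w V hwr hVr l) n
      have e4 := congrFun (hBr w w hwr hwr l) n
      simp only [reflectFam, Pi.add_apply, lp.coeFn_add, star_add] at *
      rw [e1, e2, e3, e4])
    (β := 9 * (1 / √(ν * μ)) * rexp (μ * T)) (by positivity) hR0
    (norm_dampedBilin_le hν hμ hT)
    (by
      intro w
      have h1 : ‖B V w‖ ≤ 9 * (1 / √(ν * μ)) * C * ‖w‖ :=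
        norm_dampedBilin_le_left hν hμ fun l => by
          simpa only [congrFun (hθV l)] using hUC l
      have h2 : ‖B w V‖ ≤ 9 * (1 / √(ν * μ)) * C * ‖w‖ :=
        norm_dampedBilin_le_right hν hμ fun l => by
          simpa only [congrFun (hθV l)] using hUC l
      refine (norm_add_le _ _).trans ((add_le_add h1 h2).trans ?_)
      have := mul_le_mul_of_nonneg_right hC (norm_nonneg w)
      linarith)
    hEbound hR
  have hwr : ∀ l, reflectFam (w l) = w l := fun l => by
    rw [← hJc w l, hwJ]
  refine ⟨fun l n => expWeight T μ * w l n,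
    fun l => summable_mul_left_norm _ (w l).summable_norm, fun l => ?_, fun l n => ?_,
    fun i n => ?_⟩
  · refine (tsum_norm_mul_left_le _ (w l).summable_norm).trans ?_
    rw [← CoefSpace.norm_eq]
    gcongr
    · exact expWeight_norm_le hT hμ.le
    · exact (norm_le_pi_norm w l).trans hw
  · rw [star_mul', star_expWeight]
    exact congrArg _ (congrFun (hwr l) n)
  · have e : w = B (V + w) (V + w) := by
      have hadd : ∀ x y z, B (x + y) z = B x z + B y z := fun x y z => by
        have := dampedBilin_sub_left (T := T) hν hμ (x + y) y z
        rw [add_sub_cancel_right] at this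
        rw [hB, this, sub_add_cancel]
      have hadd' : ∀ x y z, B x (y + z) = B x y + B x z := fun x y z => by
        have := dampedBilin_sub_right (T := T) hν hμ x (y + z) z
        rw [add_sub_cancel_right] at this
        rw [hB, this, sub_add_cancel]
      rw [hadd, hadd', hadd']
      nth_rewrite 1 [hweq]
      abel
    have e' : ⇑(w i) = ⇑(B (V + w) (V + w) i) := by rw [← e]
    change expWeight T μ * w i n = _
    rw [congrFun e' n, hB, dampedBilin_coe hν hμ, expWeight_mul_nsDuhamel hT]
    congr 1
    funext l k n
    have hs : ∀ l, Summable fun n => ‖(V + w) l n‖ := fun l => CoefSpace.summable_norm _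
    have hs' : Summable fun n => ‖expWeight T μ * (V + w) k n‖ := summable_mul_left_norm _ (hs k)
    have hf : ∀ l, (fun n => expWeight T μ * (V + w) l n)
        = U l + fun n => expWeight T μ * w l n := fun l => by
      funext n
      rw [Pi.add_apply, lp.coeFn_add, Pi.add_apply, mul_add, Pi.add_apply, ← congrFun (hθV l) n]
    rw [conv_mul _ n (hs l) (hs k), mul_conv _ n (hs l) hs', hf, hf]

/-! ### Regularity of the coefficients -/

/-- Evaluation at a time, as a ring homomorphism. -/
noncomputable def evalTime (t : ℝ) : TimeFn →+* ℂ where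
  toFun c := c t
  map_one' := rfl
  map_mul' _ _ := rfl
  map_zero' := rfl
  map_add' _ _ := rfl

lemma continuous_evalTime (t : ℝ) : Continuous (evalTime t) :=
  (BoundedContinuousFunction.evalCLM ℂ t).continuous

lemma conv_apply_time {a b : Freq → TimeFn} (ha : Summable fun n => ‖a n‖)
    (hb : Summable fun n => ‖b n‖) (n : Freq) (t : ℝ) :
    conv a b n t = conv (fun m => a m t) (fun m => b m t) n :=
  map_conv (evalTime t) (continuous_evalTime t) ha hb n

lemma summable_norm_apply {a : Freq → TimeFn} (ha : Summable fun n => ‖a n‖) (t : ℝ) :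
    Summable fun n => ‖a n t‖ :=
  Summable.of_nonneg_of_le (fun _ => norm_nonneg _) (fun n => (a n).norm_coe_le_norm t) ha

/-- Families that decay faster than any power of the frequency, uniformly in time. -/
def RapidDecay (c : Freq → TimeFn) : Prop := ∀ k : ℕ, Summable fun n => freqWeight n ^ k * ‖c n‖

lemma RapidDecay.summable {c : Freq → TimeFn} (h : RapidDecay c) : Summable fun n => ‖c n‖ := by
  simpa using h 0

lemma RapidDecay.add {c d : Freq → TimeFn} (hc : RapidDecay c) (hd : RapidDecay d) :
    RapidDecay fun n => c n + d n := fun k =>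
  Summable.of_nonneg_of_le (fun n => by have := freqWeight_pos n; positivity)
    (fun n => by
      rw [← mul_add]
      exact mul_le_mul_of_nonneg_left (norm_add_le _ _) (pow_nonneg (freqWeight_pos n).le k))
    ((hc k).add (hd k))

/-- A multiplier of at most polynomial growth. -/
def PolyGrowth (q : Freq → ℂ) : Prop := ∃ (C : ℝ) (p : ℕ), ∀ n, ‖q n‖ ≤ C * freqWeight n ^ p

lemma RapidDecay.smul {c : Freq → TimeFn} {q : Freq → ℂ} (hc : RapidDecay c)
    (hq : PolyGrowth q) : RapidDecay fun n => q n • c n := by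
  obtain ⟨C, p, hq⟩ := hq
  refine fun k => Summable.of_nonneg_of_le (fun n => by have := freqWeight_pos n; positivity)
    (fun n => ?_) ((hc (p + k)).mul_left C)
  have := freqWeight_pos n
  rw [norm_smul]
  calc _ ≤ freqWeight n ^ k * (C * freqWeight n ^ p * ‖c n‖) := by gcongr; exact hq n
    _ = _ := by ring

lemma RapidDecay.conv {c d : Freq → TimeFn} (hc : RapidDecay c) (hd : RapidDecay d) :
    RapidDecay (conv c d) := fun k => summable_freqWeight_conv k (hc k) (hd k)

lemma polyGrowth_const (z : ℂ) : PolyGrowth fun _ => z := ⟨‖z‖, 0, fun n => by simp⟩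

lemma polyGrowth_coord (i : Fin 3) : PolyGrowth fun n => ((n i : ℤ) : ℂ) :=
  ⟨1, 1, fun n => by simpa using abs_le_freqWeight n i⟩

lemma PolyGrowth.mul {q r : Freq → ℂ} (hq : PolyGrowth q) (hr : PolyGrowth r) :
    PolyGrowth fun n => q n * r n := by
  obtain ⟨C, p, hq⟩ := hq
  obtain ⟨D, s, hr⟩ := hr
  refine ⟨C * D, p + s, fun n => ?_⟩
  rw [norm_mul, pow_add, mul_mul_mul_comm]
  exact mul_le_mul (hq n) (hr n) (norm_nonneg _) ((norm_nonneg _).trans (hq n))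

lemma polyGrowth_freqSq : PolyGrowth fun n => (freqSq n : ℂ) := by
  refine ⟨3, 2, fun n => ?_⟩
  rw [Complex.norm_real, norm_of_nonneg (freqSq_nonneg n), freqSq]
  have h : ∀ i ∈ Finset.univ, (n i : ℝ) ^ 2 ≤ freqWeight n ^ 2 := fun i _ => by
    rw [← sq_abs]
    exact pow_le_pow_left₀ (abs_nonneg _) (abs_le_freqWeight n i) 2
  simpa using Finset.sum_le_card_nsmul _ _ _ h

lemma polyGrowth_lerayMult (i k l : Fin 3) : PolyGrowth fun n => (lerayMult i k l n : ℂ) := by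
  refine ⟨2, 1, fun n => ?_⟩
  rw [Complex.norm_real, Real.norm_eq_abs, pow_one]
  exact (abs_lerayMult_le i k l n).trans
    (mul_le_mul_of_nonneg_left (abs_le_freqWeight n l) zero_le_two)

/-- Rapidly decaying families with `m` time derivatives on `(0, T)` of the same kind. -/
def SmoothFam (T : ℝ) : ℕ → (Freq → TimeFn) → Prop
  | 0, c => RapidDecay c
  | m + 1, c => RapidDecay c ∧
      ∃ d, SmoothFam T m d ∧ ∀ n, ∀ t ∈ Ioo 0 T, HasDerivAt (c n) (d n t) t

section SmoothFam
variable {T : ℝ}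

lemma SmoothFam.rapidDecay : ∀ {m : ℕ} {c : Freq → TimeFn}, SmoothFam T m c → RapidDecay c
  | 0, _, h => h
  | _ + 1, _, h => h.1

lemma SmoothFam.of_succ : ∀ {m : ℕ} {c : Freq → TimeFn}, SmoothFam T (m + 1) c → SmoothFam T m c
  | 0, _, h => h.1
  | _ + 1, _, ⟨h, d, hd, hcd⟩ => ⟨h, d, hd.of_succ, hcd⟩

lemma SmoothFam.add : ∀ {m : ℕ} {c d : Freq → TimeFn}, SmoothFam T m c → SmoothFam T m d →
    SmoothFam T m fun n => c n + d n
  | 0, _, _, hc, hd => RapidDecay.add hc hd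
  | _ + 1, _, _, ⟨hc, c', hc', hcc'⟩, ⟨hd, d', hd', hdd'⟩ =>
    ⟨hc.add hd, fun n => c' n + d' n, hc'.add hd', fun n t ht => (hcc' n t ht).add (hdd' n t ht)⟩

lemma SmoothFam.smul {q : Freq → ℂ} (hq : PolyGrowth q) : ∀ {m : ℕ} {c : Freq → TimeFn},
    SmoothFam T m c → SmoothFam T m fun n => q n • c n
  | 0, _, hc => RapidDecay.smul hc hq
  | _ + 1, _, ⟨hc, c', hc', hcc'⟩ =>
    ⟨hc.smul hq, fun n => q n • c' n, hc'.smul hq, fun n t ht => (hcc' n t ht).const_smul (q n)⟩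

lemma SmoothFam.zero : ∀ m, SmoothFam T m fun _ => 0
  | 0 => fun k => by simp
  | m + 1 => ⟨fun k => by simp, fun _ => 0, SmoothFam.zero m,
      fun _ t _ => hasDerivAt_const t 0⟩

lemma SmoothFam.sum {m : ℕ} {ι : Type*} (s : Finset ι) {c : ι → Freq → TimeFn}
    (h : ∀ i ∈ s, SmoothFam T m (c i)) : SmoothFam T m fun n => ∑ i ∈ s, c i n := by
  classical
  induction s using Finset.induction_on with
  | empty => simpa using SmoothFam.zero m
  | insert i s hi ih =>
    simp only [Finset.sum_insert hi]
    exact (h i (Finset.mem_insert_self i s)).add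
      (ih fun j hj => h j (Finset.mem_insert_of_mem hj))

lemma hasDerivAt_conv {c d c' d' : Freq → TimeFn} (hc : Summable fun n => ‖c n‖)
    (hd : Summable fun n => ‖d n‖) (hc' : Summable fun n => ‖c' n‖)
    (hd' : Summable fun n => ‖d' n‖)
    (hcc' : ∀ n, ∀ t ∈ Ioo 0 T, HasDerivAt (c n) (c' n t) t)
    (hdd' : ∀ n, ∀ t ∈ Ioo 0 T, HasDerivAt (d n) (d' n t) t) (n : Freq) {t : ℝ}
    (ht : t ∈ Ioo 0 T) :
    HasDerivAt ⇑(conv c d n) ((conv c' d n + conv c d' n) t) t := by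
  have e : ⇑(conv c d n) = fun s => ∑' m, c m s * d (n - m) s := by
    funext s
    exact conv_apply_time hc hd n s
  have hs : ∀ s, Summable fun m => c m s * d (n - m) s := fun s =>
    conv_term_summable (summable_norm_apply hc s) (summable_norm_apply hd s) n
  have hs1 : Summable fun m => c' m t * d (n - m) t :=
    conv_term_summable (summable_norm_apply hc' t) (summable_norm_apply hd t) n
  have hs2 : Summable fun m => c m t * d' (n - m) t :=
    conv_term_summable (summable_norm_apply hc t) (summable_norm_apply hd' t) n
  have hder := hasDerivAt_tsum_of_isPreconnected
    (u := fun m => ‖c' m‖ * ‖d (n - m)‖ + ‖c m‖ * ‖d' (n - m)‖)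
    (((summable_mul_norm_freqShear hc' hd).prod_factor n).add
      ((summable_mul_norm_freqShear hc hd').prod_factor n)) isOpen_Ioo isPreconnected_Ioo
    (fun m s hs => (hcc' m s hs).mul (hdd' (n - m) s hs))
    (fun m s _ => by
      refine (norm_add_le _ _).trans ?_
      rw [norm_mul, norm_mul]
      gcongr <;> exact BoundedContinuousFunction.norm_coe_le_norm _ _) ht (hs t) ht
  rw [e]
  refine hder.congr_deriv ?_
  rw [hs1.tsum_add hs2, BoundedContinuousFunction.coe_add, Pi.add_apply, conv_apply_time hc' hd,
    conv_apply_time hc hd']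
  rfl

lemma SmoothFam.conv : ∀ {m : ℕ} {c d : Freq → TimeFn}, SmoothFam T m c → SmoothFam T m d →
    SmoothFam T m (conv c d)
  | 0, _, _, hc, hd => RapidDecay.conv hc hd
  | _ + 1, _, _, hc@⟨hc0, _, hc', hcc'⟩, hd@⟨hd0, _, hd', hdd'⟩ =>
    ⟨hc0.conv hd0, _, (hc'.conv hd.of_succ).add (hc.of_succ.conv hd'), fun n _ ht =>
      hasDerivAt_conv hc0.summable hd0.summable hc'.rapidDecay.summable hd'.rapidDecay.summable
        hcc' hdd' n ht⟩

end SmoothFam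

lemma abs_intCast_le_sq (k : ℤ) : |(k : ℝ)| ≤ (k : ℝ) ^ 2 := by
  rw [← sq_abs]
  have : (0 : ℝ) ≤ |(k : ℝ)| := abs_nonneg _
  rcases eq_or_ne k 0 with rfl | h
  · simp
  · have h1 : (1 : ℝ) ≤ |(k : ℝ)| := by exact_mod_cast Int.one_le_abs h
    nlinarith

lemma freqWeight_mul_abs_le (n : Freq) (l : Fin 3) :
    freqWeight n * |(n l : ℝ)| ≤ 4 * freqSq n := by
  have h1 : |(n l : ℝ)| ≤ freqSq n := (abs_intCast_le_sq _).trans (sq_le_freqSq n l)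
  have h2 : ∀ i, |(n i : ℝ)| * |(n l : ℝ)| ≤ freqSq n := fun i => by
    rw [← abs_mul]; exact abs_mul_le_freqSq n i l
  rw [freqWeight, add_mul, one_mul, Fin.sum_univ_three]
  nlinarith [h2 0, h2 1, h2 2]

/-- The undamped Duhamel operator gains one derivative, uniformly in time. -/
lemma freqWeight_mul_norm_nsDuhamel_le {ν : ℝ} (hν : 0 < ν) (T : ℝ)
    (c : Fin 3 → Fin 3 → Freq → TimeFn) (i : Fin 3) (n : Freq) :
    freqWeight n * ‖nsDuhamel ν 0 T c i n‖ ≤ 8 / ν * ∑ k, ∑ l, ‖c l k n‖ := by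
  have hw := freqWeight_pos n
  rcases (freqSq_nonneg n).eq_or_lt with h | h
  · have h0 : ∀ l, (n l : ℝ) = 0 := fun l => by
      have := sq_le_freqSq n l
      rw [← h] at this
      exact pow_eq_zero_iff two_ne_zero |>.1 (le_antisymm this (sq_nonneg _))
    have : nsDuhamel ν 0 T c i n = 0 := by simp [nsDuhamel, lerayMult, h0]
    rw [this, norm_zero, mul_zero]
    positivity
  · have h1 := mul_le_mul_of_nonneg_left (freqSq_mul_norm_nsDuhamel_le hν T c i n) hw.le
    have h2 : freqWeight n * ∑ k, ∑ l, 2 * |(n l : ℝ)| * ‖c l k n‖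
        ≤ 8 * freqSq n * ∑ k, ∑ l, ‖c l k n‖ := by
      simp only [Finset.mul_sum]
      refine Finset.sum_le_sum fun k _ => Finset.sum_le_sum fun l _ => ?_
      have := mul_le_mul_of_nonneg_right (freqWeight_mul_abs_le n l) (norm_nonneg (c l k n))
      linarith
    rw [div_mul_eq_mul_div, le_div_iff₀ hν]
    have h3 := h1.trans h2
    refine le_of_mul_le_mul_right ?_ h
    linarith

/-- Coefficients of the heat flow with initial coefficients `a`, on `[0, T]`. -/
noncomputable def heatFam (ν T : ℝ) (a : Freq → ℂ) (n : Freq) : TimeFn :=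
  a n • expWeight T (-(ν * freqSq n))

lemma norm_heatFam_le {ν : ℝ} (hν : 0 ≤ ν) (T : ℝ) (a : Freq → ℂ) (n : Freq) :
    ‖heatFam ν T a n‖ ≤ ‖a n‖ := by
  rw [heatFam, norm_smul]
  exact mul_le_of_le_one_right (norm_nonneg _) (expWeight_norm_le_one (by
    have := freqSq_nonneg n
    simpa using mul_nonneg hν this))

lemma hasDerivAt_heatFam (ν : ℝ) {T t : ℝ} (ht : t ∈ Ioo 0 T) (a : Freq → ℂ) (n : Freq) :
    HasDerivAt (heatFam ν T a n) (-((ν * freqSq n : ℝ) : ℂ) * heatFam ν T a n t) t := by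
  have h1 : HasDerivAt (fun t : ℝ => ((rexp (-(ν * freqSq n) * t) : ℝ) : ℂ))
      ((rexp (-(ν * freqSq n) * t) * (-(ν * freqSq n) * 1) : ℝ) : ℂ) t :=
    (((hasDerivAt_id t).const_mul _).exp).ofReal_comp
  have he : heatFam ν T a n =ᶠ[𝓝 t]
      fun t : ℝ => a n * ((rexp (-(ν * freqSq n) * t) : ℝ) : ℂ) := by
    filter_upwards [Ioo_mem_nhds ht.1 ht.2] with x hx
    simp only [heatFam, BoundedContinuousFunction.coe_smul, expWeight_apply, smul_eq_mul]
    rw [timeClamp_of_mem (Ioo_subset_Icc_self hx)]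
  refine ((h1.const_mul (a n)).congr_of_eventuallyEq he).congr_deriv ?_
  simp only [heatFam, BoundedContinuousFunction.coe_smul, expWeight_apply, smul_eq_mul]
  rw [timeClamp_of_mem (Ioo_subset_Icc_self ht)]
  push_cast
  ring

/-- Time derivative prescribed by the Navier-Stokes equations, in Fourier coefficients. -/
noncomputable def nsVelocity (ν : ℝ) (a : Fin 3 → Freq → TimeFn) (i : Fin 3) (n : Freq) : TimeFn :=
  (-((ν : ℂ) * (freqSq n : ℂ))) • a i n
    + ∑ k, ∑ l, (-Complex.I * (lerayMult i k l n : ℂ)) • conv (a l) (a k) n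

section mild
variable {ν T : ℝ} {a0 : Fin 3 → Freq → ℂ} {a : Fin 3 → Freq → TimeFn}

/-- Mild solutions with absolutely summable coefficients have rapidly decaying coefficients if the
initial coefficients decay rapidly. -/
theorem rapidDecay_of_mild (hν : 0 < ν)
    (ha0 : ∀ i, ∀ k : ℕ, Summable fun n => freqWeight n ^ k * ‖a0 i n‖)
    (hs : ∀ i, Summable fun n => ‖a i n‖)
    (hmild : ∀ i n, a i n = heatFam ν T (a0 i) n
      + nsDuhamel ν 0 T (fun l k => conv (a l) (a k)) i n) (i : Fin 3) : RapidDecay (a i) := by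
  intro k
  induction k generalizing i with
  | zero => simpa using hs i
  | succ k ih =>
    -- one more power of the weight: the Duhamel term gains a derivative over the convolutions,
    -- which decay like the `k`-th power by induction
    have hc : Summable fun n => freqWeight n ^ k *
        (8 / ν * ∑ k', ∑ l, ‖conv (a l) (a k') n‖) := by
      have : ∀ n, freqWeight n ^ k * (8 / ν * ∑ k', ∑ l, ‖conv (a l) (a k') n‖)
          = 8 / ν * ∑ k', ∑ l, freqWeight n ^ k * ‖conv (a l) (a k') n‖ := fun n => by
        simp only [Finset.mul_sum]
        refine Finset.sum_congr rfl fun _ _ => Finset.sum_congr rfl fun _ _ => by ring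
      simp only [this]
      exact (summable_sum fun k' _ => summable_sum fun l _ =>
        summable_freqWeight_conv k (ih l) (ih k')).mul_left _
    refine Summable.of_nonneg_of_le (fun n => by have := freqWeight_pos n; positivity)
      (fun n => ?_) ((ha0 i (k + 1)).add hc)
    have hw := freqWeight_pos n
    rw [hmild i n]
    calc freqWeight n ^ (k + 1) * ‖heatFam ν T (a0 i) n
          + nsDuhamel ν 0 T (fun l k => conv (a l) (a k)) i n‖
        ≤ freqWeight n ^ (k + 1) * (‖a0 i n‖
          + ‖nsDuhamel ν 0 T (fun l k => conv (a l) (a k)) i n‖) := by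
          gcongr
          exact (norm_add_le _ _).trans (by gcongr; exact norm_heatFam_le hν.le T _ n)
      _ = freqWeight n ^ (k + 1) * ‖a0 i n‖ + freqWeight n ^ k *
          (freqWeight n * ‖nsDuhamel ν 0 T (fun l k => conv (a l) (a k)) i n‖) := by ring
      _ ≤ _ := by
          exact add_le_add le_rfl (mul_le_mul_of_nonneg_left
            (freqWeight_mul_norm_nsDuhamel_le hν T _ i n) (pow_nonneg hw.le k))

lemma hasDerivAt_of_mild
    (hmild : ∀ i n, a i n = heatFam ν T (a0 i) n
      + nsDuhamel ν 0 T (fun l k => conv (a l) (a k)) i n) (i : Fin 3) (n : Freq) {t : ℝ}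
    (ht : t ∈ Ioo 0 T) : HasDerivAt (a i n) (nsVelocity ν a i n t) t := by
  have h1 := hasDerivAt_heatFam ν ht (a0 i) n
  have h2 : HasDerivAt (nsDuhamel ν 0 T (fun l k => conv (a l) (a k)) i n)
      (∑ k, ∑ l, (-Complex.I * (lerayMult i k l n : ℂ)) *
        (-((ν * freqSq n + 0 : ℝ) : ℂ) * duhamel T (ν * freqSq n + 0) (conv (a l) (a k) n) t
          + conv (a l) (a k) n t)) t := by
    have e : ⇑(nsDuhamel ν 0 T (fun l k => conv (a l) (a k)) i n)
        = fun s => ∑ k, ∑ l, (-Complex.I * (lerayMult i k l n : ℂ)) *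
          duhamel T (ν * freqSq n + 0) (conv (a l) (a k) n) s := by
      funext s
      simp [nsDuhamel]
    rw [e]
    exact HasDerivAt.fun_sum fun k _ => HasDerivAt.fun_sum fun l _ =>
      (hasDerivAt_duhamel ht _).const_mul _
  have h3 := h1.add h2
  rw [← BoundedContinuousFunction.coe_add, ← hmild i n] at h3
  refine h3.congr_deriv ?_
  have e2 : a i n t = heatFam ν T (a0 i) n t + ∑ k, ∑ l, (-Complex.I * (lerayMult i k l n : ℂ)) *
      duhamel T (ν * freqSq n + 0) (conv (a l) (a k) n) t := by
    conv_lhs => rw [hmild i n]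
    simp [nsDuhamel]
  simp only [nsVelocity, BoundedContinuousFunction.coe_add, Pi.add_apply,
    BoundedContinuousFunction.coe_smul, BoundedContinuousFunction.coe_sum, Finset.sum_apply,
    smul_eq_mul]
  rw [e2]
  simp only [mul_add, Finset.mul_sum, Finset.sum_add_distrib]
  rw [← add_assoc]
  congr 2
  · push_cast; ring
  · refine Finset.sum_congr rfl fun k _ => Finset.sum_congr rfl fun l _ => ?_
    push_cast; ring

lemma smoothFam_nsVelocity {m : ℕ} (h : ∀ i, SmoothFam T m (a i)) (i : Fin 3) :
    SmoothFam T m (nsVelocity ν a i) := by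
  refine ((h i).smul (q := fun n => -((ν : ℂ) * (freqSq n : ℂ))) ?_).add
    (SmoothFam.sum _ fun k _ => SmoothFam.sum _ fun l _ => ((h l).conv (h k)).smul
      ((polyGrowth_const _).mul (polyGrowth_lerayMult i k l)))
  simpa using ((polyGrowth_const (-1)).mul ((polyGrowth_const ν).mul polyGrowth_freqSq))

/-- Bootstrap in time: the time derivative of a mild solution is a polynomial expression in the
solution, hence as regular. -/
theorem smoothFam_of_mild (hν : 0 < ν)
    (ha0 : ∀ i, ∀ k : ℕ, Summable fun n => freqWeight n ^ k * ‖a0 i n‖)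
    (hs : ∀ i, Summable fun n => ‖a i n‖)
    (hmild : ∀ i n, a i n = heatFam ν T (a0 i) n
      + nsDuhamel ν 0 T (fun l k => conv (a l) (a k)) i n) (m : ℕ) (i : Fin 3) :
    SmoothFam T m (a i) := by
  induction m generalizing i with
  | zero => exact rapidDecay_of_mild hν ha0 hs hmild i
  | succ m ih => exact ⟨rapidDecay_of_mild hν ha0 hs hmild i, nsVelocity ν a i,
      smoothFam_nsVelocity ih i, fun n t ht => hasDerivAt_of_mild hmild i n ht⟩

end mild

/-! ### Partial derivatives and integration over the torus -/

/-- The `i`-th partial derivative on `E3`. -/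
noncomputable def pd {F : Type*} [NormedAddCommGroup F] [NormedSpace ℝ F] (i : Fin 3) (f : E3 → F)
    (x : E3) : F :=
  fderiv ℝ f x (EuclideanSpace.single i 1)

lemma E3.eq_sum_single (h : E3) : h = ∑ i, h i • (EuclideanSpace.single i 1 : E3) := by
  ext j
  simp [Fin.sum_univ_three]
  fin_cases j <;> simp

section pd
variable {F : Type*} [NormedAddCommGroup F] [NormedSpace ℝ F]

lemma fderiv_apply_eq_sum (f : E3 → F) (x h : E3) :
    fderiv ℝ f x h = ∑ i, h i • pd i f x := by
  conv_lhs => rw [E3.eq_sum_single h]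
  simp [pd]

lemma HasFDerivAt.pd_eq {f : E3 → F} {f' : E3 →L[ℝ] F} {x : E3} (h : HasFDerivAt f f' x)
    (i : Fin 3) : pd i f x = f' (EuclideanSpace.single i 1) := by rw [pd, h.fderiv]

lemma fderiv_apply_coord {v : E3 → E3} {x : E3} (hv : DifferentiableAt ℝ v x) (h : E3)
    (i : Fin 3) : (fderiv ℝ v x h) i = fderiv ℝ (fun y => v y i) x h := by
  have := ((EuclideanSpace.proj (𝕜 := ℝ) i).hasFDerivAt (x := v x)).comp x hv.hasFDerivAt
  have e : fderiv ℝ (fun y => v y i) x = (EuclideanSpace.proj i).comp (fderiv ℝ v x) :=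
    this.fderiv
  rw [e]
  rfl

lemma vdiv_eq_sum_pd {v : E3 → E3} {x : E3} (hv : DifferentiableAt ℝ v x) :
    vdiv v x = ∑ i, pd i (fun y => v y i) x :=
  Finset.sum_congr rfl fun i _ => fderiv_apply_coord hv _ i

lemma gradient_apply_coord (P : E3 → ℝ) (x : E3) (i : Fin 3) : (gradient P x) i = pd i P x := by
  rw [pd, ← toDual_gradient, InnerProductSpace.toDual_apply_apply, real_inner_comm,
    EuclideanSpace.inner_single_left]
  simp

lemma contDiff_pd {f : E3 → F} {m n : WithTop ℕ∞} (hf : ContDiff ℝ n f) (hmn : m + 1 ≤ n)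
    (i : Fin 3) : ContDiff ℝ m (pd i f) :=
  (hf.fderiv_right hmn).clm_apply contDiff_const

lemma contDiff_pd_infty {f : E3 → F} (hf : ContDiff ℝ ∞ f) (i : Fin 3) :
    ContDiff ℝ ∞ (pd i f) := contDiff_pd hf (by simp) i

lemma laplacian_eq_sum_pd {f : E3 → F} (hf : ContDiff ℝ 2 f) (x : E3) :
    Laplacian.laplacian f x = ∑ l, pd l (pd l f) x := by
  rw [InnerProductSpace.laplacian_eq_iteratedFDeriv_orthonormalBasis f
    (EuclideanSpace.basisFun (Fin 3) ℝ)]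
  refine Finset.sum_congr rfl fun l _ => ?_
  have hd : DifferentiableAt ℝ (fderiv ℝ f) x :=
    (hf.fderiv_right (m := 1) (by norm_num)).differentiable one_ne_zero x
  have h1 : HasFDerivAt (pd l f) ((ContinuousLinearMap.apply ℝ F (EuclideanSpace.single l 1)).comp
      (fderiv ℝ (fderiv ℝ f) x)) x :=
    (ContinuousLinearMap.apply ℝ F (EuclideanSpace.single l 1 : E3)).hasFDerivAt.comp x
      hd.hasFDerivAt
  rw [iteratedFDeriv_two_apply, h1.pd_eq]
  simp

lemma laplacian_apply_coord {v : E3 → E3} (hv : ContDiff ℝ 2 v) (x : E3) (i : Fin 3) :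
    (Laplacian.laplacian v x) i = ∑ l, pd l (pd l fun y => v y i) x := by
  have h := ContDiffAt.laplacian_CLM_comp_left (l := (EuclideanSpace.proj i : E3 →L[ℝ] ℝ))
    (hv.contDiffAt (x := x))
  have h2 : ContDiff ℝ 2 fun y => v y i := contDiff_euclidean.1 hv i
  rw [← laplacian_eq_sum_pd h2]
  exact h.symm

lemma TorusPeriodic.pd {f : E3 → F} (hf : TorusPeriodic f) (i : Fin 3) :
    TorusPeriodic (pd i f) := by
  intro j x
  have h : (fun y => f (y + EuclideanSpace.single j (2 * π))) = f := funext fun y => hf j y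
  simp only [_root_.pd]
  conv_rhs => rw [← h, fderiv_comp_add_right]

lemma measurableSet_torusCell : MeasurableSet torusCell := by
  have : torusCell = ⋂ i : Fin 3, (fun x : E3 => x i) ⁻¹' Ioc 0 (2 * π) := by
    ext x; simp [torusCell]
  rw [this]
  refine MeasurableSet.iInter fun i => ?_
  exact (by fun_prop : Measurable fun x : E3 => x i) measurableSet_Ioc

lemma setIntegral_torusCell (g : E3 → F) :
    ∫ x in torusCell, g x
      = ∫ y in Icc (0 : Fin 3 → ℝ) (fun _ => 2 * π), g (WithLp.toLp 2 y) := by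
  have h := (PiLp.volume_preserving_toLp (Fin 3)).setIntegral_preimage_emb
    (MeasurableEquiv.toLp 2 (Fin 3 → ℝ)).measurableEmbedding g torusCell
  rw [← h]
  have e : (@WithLp.toLp 2 (Fin 3 → ℝ)) ⁻¹' torusCell
      = Set.pi univ fun i => Ioc ((0 : Fin 3 → ℝ) i) ((fun _ => 2 * π : Fin 3 → ℝ) i) := by
    ext y; simp [torusCell]
  rw [e]
  exact setIntegral_congr_set Measure.univ_pi_Ioc_ae_eq_Icc

lemma volume_torusCell : volume torusCell = ENNReal.ofReal ((2 * π) ^ 3) := by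
  have h := (PiLp.volume_preserving_toLp (Fin 3)).measure_preimage
    measurableSet_torusCell.nullMeasurableSet
  rw [← h]
  have e : (@WithLp.toLp 2 (Fin 3 → ℝ)) ⁻¹' torusCell
      = Set.pi univ fun i => Ioc ((0 : Fin 3 → ℝ) i) ((fun _ => 2 * π : Fin 3 → ℝ) i) := by
    ext y; simp [torusCell]
  rw [e, Real.volume_pi_Ioc]
  simp [ENNReal.ofReal_pow (by positivity : (0 : ℝ) ≤ 2 * π)]

lemma volume_torusCell_lt_top : volume torusCell < ⊤ := by
  rw [volume_torusCell]; exact ENNReal.ofReal_lt_top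

lemma torusCell_subset_closedBall : torusCell ⊆ Metric.closedBall 0 (6 * π) := by
  intro x hx
  rw [mem_closedBall_zero_iff, EuclideanSpace.norm_eq]
  refine Real.sqrt_le_iff.2 ⟨by positivity, ?_⟩
  have h : ∀ i, ‖x i‖ ^ 2 ≤ (2 * π) ^ 2 := fun i => by
    rw [norm_of_nonneg (hx i).1.le]
    exact pow_le_pow_left₀ (hx i).1.le (hx i).2 2
  rw [Fin.sum_univ_three]
  nlinarith [h 0, h 1, h 2, sq_nonneg π]

lemma Continuous.integrableOn_torusCell {G : Type*} [NormedAddCommGroup G] {g : E3 → G}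
    (hg : Continuous g) :
    IntegrableOn g torusCell :=
  (hg.continuousOn.integrableOn_compact (isCompact_closedBall 0 (6 * π))).mono_set
    torusCell_subset_closedBall

/-- Derivatives of periodic functions have mean zero. -/
theorem setIntegral_pd_eq_zero {f : E3 → F} (hf : ContDiff ℝ 1 f) (hp : TorusPeriodic f)
    (i : Fin 3) : ∫ x in torusCell, pd i f x = 0 := by
  by_cases hF : CompleteSpace F
  swap
  · simp [integral, hF]
  rw [setIntegral_torusCell]
  set L : (Fin 3 → ℝ) →L[ℝ] E3 := (EuclideanSpace.equiv (Fin 3) ℝ).symm.toContinuousLinearMap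
  have hL : ∀ y, L y = WithLp.toLp 2 y := fun y => rfl
  have hfc : Continuous f := hf.continuous
  have hd : ∀ y, HasFDerivAt (fun y => f (WithLp.toLp 2 y)) ((fderiv ℝ f (L y)).comp L) y :=
    fun y => ((hf.differentiable one_ne_zero (L y)).hasFDerivAt).comp y L.hasFDerivAt
  have hcont : Continuous fun y : Fin 3 → ℝ => pd i f (WithLp.toLp 2 y) :=
    (contDiff_pd (m := 0) hf (by norm_num) i).continuous.comp L.continuous
  have hsum : ∀ y, ∑ j, (if j = i then (fderiv ℝ f (L y)).comp L else 0) (Pi.single j 1)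
      = pd i f (WithLp.toLp 2 y) := fun y => by
    rw [Finset.sum_eq_single i]
    · rw [if_pos rfl]
      rfl
    · intro j _ hj
      simp [hj]
    · simp
  have key := integral_divergence_of_hasFDerivAt_off_countable' (n := 2) (E := F) 0
    (fun _ => 2 * π) (fun _ => by simp [pi_pos.le])
    (fun j y => if j = i then f (WithLp.toLp 2 y) else 0)
    (fun j y => if j = i then (fderiv ℝ f (L y)).comp L else 0) ∅ countable_empty
    (fun j => by
      by_cases h : j = i
      · simp only [h, if_true]
        exact (hfc.comp L.continuous).continuousOn
      · simp only [h, if_false]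
        exact continuousOn_const)
    (fun y _ j => by
      by_cases h : j = i
      · simp only [h, if_true]
        exact hd y
      · simp only [h, if_false]
        exact hasFDerivAt_const _ _)
    (by
      simp only [hsum]
      exact hcont.continuousOn.integrableOn_compact isCompact_Icc)
  simp only [hsum] at key
  rw [key]
  refine Finset.sum_eq_zero fun j _ => ?_
  rw [sub_eq_zero]
  congr 1
  funext y
  by_cases h : j = i
  · simp only [h, if_true]
    have e : (WithLp.toLp 2 (i.insertNth ((fun _ => 2 * π : Fin 3 → ℝ) i) y) : E3)
        = WithLp.toLp 2 (i.insertNth ((0 : Fin 3 → ℝ) i) y) + EuclideanSpace.single i (2 * π) := by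
      ext m
      refine Fin.succAboveCases i ?_ (fun m' => ?_) m
      · simp
      · simp [Fin.succAbove_ne]
    exact (congrArg f e).trans (hp i _)
  · simp [h]

end pd

/-! ### Fourier series with time-dependent coefficients -/

/-- The linear form `x ↦ n · x`. -/
noncomputable def phase (n : Freq) : E3 →L[ℝ] ℝ :=
  ∑ i, (n i : ℝ) • (EuclideanSpace.proj i : E3 →L[ℝ] ℝ)

lemma phase_apply (n : Freq) (x : E3) : phase n x = ∑ i, (n i : ℝ) * x i := by
  simp [phase]

lemma phase_single (n : Freq) (j : Fin 3) (r : ℝ) :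
    phase n (EuclideanSpace.single j r) = n j * r := by
  rw [phase_apply, Finset.sum_eq_single j]
  · simp
  · intro i _ hi; simp [hi]
  · simp

/-- The character `e^{i n · x}` of the torus. -/
noncomputable def wave (n : Freq) (x : E3) : ℂ := Complex.exp ((phase n x : ℂ) * Complex.I)

lemma norm_wave (n : Freq) (x : E3) : ‖wave n x‖ = 1 := Complex.norm_exp_ofReal_mul_I _

lemma wave_add (m n : Freq) (x : E3) : wave (m + n) x = wave m x * wave n x := by
  rw [wave, wave, wave, ← Complex.exp_add, phase_apply, phase_apply, phase_apply, ← add_mul,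
    ← Complex.ofReal_add, ← Finset.sum_add_distrib]
  congr 3
  push_cast
  exact Finset.sum_congr rfl fun i _ => by simp [add_mul]

lemma wave_zero (x : E3) : wave 0 x = 1 := by simp [wave, phase_apply]

lemma wave_neg (n : Freq) (x : E3) : wave (-n) x = (starRingEnd ℂ) (wave n x) := by
  rw [wave, wave, ← Complex.exp_conj]
  simp [phase_apply]

lemma wave_periodic (n : Freq) : TorusPeriodic (wave n) := by
  intro i x
  rw [wave, wave, map_add, phase_single, Complex.ofReal_add, add_mul, Complex.exp_add]
  have : Complex.exp (((n i * (2 * π) : ℝ) : ℂ) * Complex.I) = 1 := by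
    rw [← Complex.exp_int_mul_two_pi_mul_I (n i)]
    congr 1
    push_cast
    ring
  rw [this, mul_one]

lemma continuous_wave (n : Freq) : Continuous (wave n) := by
  unfold wave; fun_prop

lemma contDiff_wave (n : Freq) : ContDiff ℝ ∞ (wave n) := by
  have h : ContDiff ℝ ∞ fun x => (phase n x : ℂ) :=
    Complex.ofRealCLM.contDiff.comp (phase n).contDiff
  exact (h.mul contDiff_const).cexp

lemma hasFDerivAt_wave (n : Freq) (x : E3) :
    HasFDerivAt (wave n) ((phase n).smulRight (Complex.I * wave n x)) x := by
  have h : HasFDerivAt (fun x => (phase n x : ℂ) * Complex.I)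
      ((Complex.ofRealCLM.comp (phase n)).smulRight Complex.I) x :=
    (Complex.ofRealCLM.hasFDerivAt.comp x (phase n).hasFDerivAt).smul_const Complex.I
  refine h.cexp.congr_fderiv ?_
  ext v
  simp [wave]
  ring

lemma pd_wave (n : Freq) (i : Fin 3) (x : E3) :
    pd i (wave n) x = Complex.I * ((n i : ℤ) : ℂ) * wave n x := by
  rw [(hasFDerivAt_wave n x).pd_eq]
  simp [phase_single]
  ring

/-- The function on space-time with Fourier coefficients `c n`. -/
noncomputable def synth (c : Freq → TimeFn) (z : ℝ × E3) : ℂ := ∑' n, c n z.1 * wave n z.2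

/-- Coefficients of the `j`-th partial derivative. -/
noncomputable def derivFam (j : Fin 3) (c : Freq → TimeFn) (n : Freq) : TimeFn :=
  (Complex.I * ((n j : ℤ) : ℂ)) • c n

lemma RapidDecay.derivFam {c : Freq → TimeFn} (h : RapidDecay c) (j : Fin 3) :
    RapidDecay (derivFam j c) := h.smul ((polyGrowth_const _).mul (polyGrowth_coord j))

lemma SmoothFam.derivFam {T : ℝ} {m : ℕ} {c : Freq → TimeFn} (h : SmoothFam T m c) (j : Fin 3) :
    SmoothFam T m (derivFam j c) := h.smul ((polyGrowth_const _).mul (polyGrowth_coord j))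

section synth
variable {c d : Freq → TimeFn}

lemma norm_synth_term_le (c : Freq → TimeFn) (n : Freq) (z : ℝ × E3) :
    ‖c n z.1 * wave n z.2‖ ≤ ‖c n‖ := by
  rw [norm_mul, norm_wave, mul_one]
  exact (c n).norm_coe_le_norm _

lemma summable_synth (hc : Summable fun n => ‖c n‖) (z : ℝ × E3) :
    Summable fun n => c n z.1 * wave n z.2 :=
  Summable.of_norm_bounded hc fun n => norm_synth_term_le c n z

lemma norm_synth_le (hc : Summable fun n => ‖c n‖) (z : ℝ × E3) :
    ‖synth c z‖ ≤ ∑' n, ‖c n‖ :=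
  tsum_of_norm_bounded hc.hasSum fun n => norm_synth_term_le c n z

lemma continuous_synth (hc : Summable fun n => ‖c n‖) : Continuous (synth c) := by
  refine continuous_tsum (fun n => ?_) hc fun n z => norm_synth_term_le c n z
  have := continuous_wave n
  fun_prop

lemma synth_periodic (c : Freq → TimeFn) (t : ℝ) : TorusPeriodic fun x => synth c (t, x) := by
  intro i x
  simp only [synth]
  exact tsum_congr fun n => by rw [wave_periodic n i x]

lemma synth_add (hc : Summable fun n => ‖c n‖) (hd : Summable fun n => ‖d n‖) (z : ℝ × E3) :
    synth (fun n => c n + d n) z = synth c z + synth d z := by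
  simp only [synth, BoundedContinuousFunction.coe_add, Pi.add_apply, add_mul]
  exact (summable_synth hc z).tsum_add (summable_synth hd z)

lemma synth_const_smul (r : ℂ) (hc : Summable fun n => ‖c n‖) (z : ℝ × E3) :
    synth (fun n => r • c n) z = r * synth c z := by
  simp only [synth, BoundedContinuousFunction.coe_smul, smul_eq_mul, mul_assoc]
  exact (summable_synth hc z).tsum_mul_left r

lemma synth_sum {ι : Type*} (s : Finset ι) {c : ι → Freq → TimeFn}
    (hc : ∀ i ∈ s, Summable fun n => ‖c i n‖) (z : ℝ × E3) :
    synth (fun n => ∑ i ∈ s, c i n) z = ∑ i ∈ s, synth (c i) z := by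
  simp only [synth, BoundedContinuousFunction.coe_sum, Finset.sum_apply, Finset.sum_mul]
  exact Summable.tsum_finsetSum fun i hi => summable_synth (hc i hi) z

lemma synth_conv (hc : Summable fun n => ‖c n‖) (hd : Summable fun n => ‖d n‖) (z : ℝ × E3) :
    synth (conv c d) z = synth c z * synth d z := by
  have h1 := summable_norm_apply hc z.1
  have h2 := summable_norm_apply hd z.1
  have hw : ∀ b : Freq → ℂ, Summable (fun n => ‖b n‖) → Summable fun n => ‖b n * wave n z.2‖ :=
    fun b hb => by simpa [norm_wave] using hb
  simp only [synth]
  rw [← tsum_conv (hw _ h1) (hw _ h2)]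
  refine tsum_congr fun n => ?_
  rw [conv_apply_time hc hd]
  exact conv_mul_char (fun n => wave n z.2) (fun m n => wave_add m n z.2) _ _ n h1 h2

lemma synth_real (hc : reflectFam c = c) (z : ℝ × E3) : ((synth c z).re : ℂ) = synth c z := by
  rw [← Complex.conj_eq_iff_re, synth, Complex.conj_tsum, ← (Equiv.neg Freq).tsum_eq]
  refine tsum_congr fun n => ?_
  rw [map_mul, Equiv.neg_apply, wave_neg, Complex.conj_conj]
  congr 1
  exact congrArg (fun f : TimeFn => f z.1) (congrFun hc n)

/-- The space-time derivative of a Fourier series: the time derivative is given by the coefficients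
`d`, the space derivatives by `derivFam`. -/
noncomputable def synthDeriv (c d : Freq → TimeFn) (z : ℝ × E3) : ℝ × E3 →L[ℝ] ℂ :=
  (ContinuousLinearMap.fst ℝ ℝ E3).smulRight (synth d z)
    + ∑ j, ((EuclideanSpace.proj j : E3 →L[ℝ] ℝ).comp (ContinuousLinearMap.snd ℝ ℝ E3)).smulRight
        (synth (derivFam j c) z)

lemma isOpen_slab (T : ℝ) : IsOpen (Ioo 0 T ×ˢ (univ : Set E3)) := isOpen_Ioo.prod isOpen_univ

lemma hasFDerivAt_synth {T : ℝ} (hc : RapidDecay c) (hd : RapidDecay d)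
    (hcd : ∀ n, ∀ t ∈ Ioo 0 T, HasDerivAt (c n) (d n t) t) {z : ℝ × E3}
    (hz : z ∈ Ioo 0 T ×ˢ (univ : Set E3)) : HasFDerivAt (synth c) (synthDeriv c d z) z := by
  set g' : Freq → ℝ × E3 → (ℝ × E3 →L[ℝ] ℂ) := fun n z =>
    (ContinuousLinearMap.fst ℝ ℝ E3).smulRight (d n z.1 * wave n z.2)
    + ∑ j, ((EuclideanSpace.proj j : E3 →L[ℝ] ℝ).comp (ContinuousLinearMap.snd ℝ ℝ E3)).smulRight
        (derivFam j c n z.1 * wave n z.2) with hg'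
  have hterm : ∀ n, ∀ z ∈ Ioo 0 T ×ˢ (univ : Set E3),
      HasFDerivAt (fun z : ℝ × E3 => c n z.1 * wave n z.2) (g' n z) z := by
    intro n z hz
    have h1 : HasFDerivAt (fun z : ℝ × E3 => c n z.1) _ z :=
      (hcd n z.1 hz.1).hasFDerivAt.comp z hasFDerivAt_fst
    have h2 : HasFDerivAt (fun z : ℝ × E3 => wave n z.2) _ z :=
      (hasFDerivAt_wave n z.2).comp z hasFDerivAt_snd
    refine (h1.mul h2).congr_fderiv ?_
    ext v
    · simp [hg', derivFam]
      ring
    · simp only [hg', derivFam, Fin.sum_univ_three, BoundedContinuousFunction.coe_smul,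
        smul_eq_mul]
      simp [phase_apply, Fin.sum_univ_three]
      ring
  have hproj : ∀ j : Fin 3, ‖((EuclideanSpace.proj j : E3 →L[ℝ] ℝ).comp
      (ContinuousLinearMap.snd ℝ ℝ E3))‖ ≤ 1 := fun j =>
    ContinuousLinearMap.opNorm_le_bound _ zero_le_one fun v => by
      rw [one_mul]
      exact (PiLp.norm_apply_le v.2 j).trans (le_max_right _ _)
  have hbound : ∀ n, ∀ z ∈ Ioo 0 T ×ˢ (univ : Set E3),
      ‖g' n z‖ ≤ ‖d n‖ + ∑ j, ‖derivFam j c n‖ := by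
    intro n z _
    refine (norm_add_le _ _).trans (add_le_add ?_ (norm_sum_le_of_le _ fun j _ => ?_))
    · rw [ContinuousLinearMap.norm_smulRight_apply]
      exact (mul_le_of_le_one_left (norm_nonneg _) (ContinuousLinearMap.norm_fst_le ℝ ℝ E3)).trans
        (norm_synth_term_le d n z)
    · rw [ContinuousLinearMap.norm_smulRight_apply]
      exact (mul_le_of_le_one_left (norm_nonneg _) (hproj j)).trans
        (norm_synth_term_le (derivFam j c) n z)
  have hpre : IsPreconnected (Ioo 0 T ×ˢ (univ : Set E3)) :=
    isPreconnected_Ioo.prod isPreconnected_univ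
  have key := hasFDerivAt_tsum_of_isPreconnected
    (hd.summable.add (summable_sum fun j _ => (hc.derivFam j).summable)) (isOpen_slab T) hpre
    hterm hbound hz (summable_synth hc.summable z) hz
  refine key.congr_fderiv ?_
  have hs : Summable fun n => g' n z :=
    Summable.of_norm_bounded (hd.summable.add (summable_sum fun j _ => (hc.derivFam j).summable))
      fun n => hbound n z hz
  have hev : ∀ v, (∑' n, g' n z) v = ∑' n, g' n z v := fun v =>
    (ContinuousLinearMap.apply ℝ ℂ v).map_tsum hs
  refine ContinuousLinearMap.ext fun v => ?_
  rw [hev]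
  simp only [hg', synthDeriv, add_apply, sum_apply,
    ContinuousLinearMap.smulRight_apply, synth]
  have hsd := (summable_synth hd.summable z).const_smul (v.1)
  have hsj : ∀ j, Summable fun n => v.2 j • (derivFam j c n z.1 * wave n z.2) := fun j =>
    (summable_synth (hc.derivFam j).summable z).const_smul (v.2 j)
  refine (hsd.tsum_add (summable_sum fun j _ => hsj j)).trans ?_
  rw [Summable.tsum_finsetSum fun j _ => hsj j, (summable_synth hd.summable z).tsum_const_smul]
  congr 1
  exact Finset.sum_congr rfl fun j _ =>
    (summable_synth (hc.derivFam j).summable z).tsum_const_smul (v.2 j)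

lemma contDiffOn_synth_nat {T : ℝ} : ∀ {m : ℕ} {c : Freq → TimeFn}, SmoothFam T m c →
    ContDiffOn ℝ m (synth c) (Ioo 0 T ×ˢ (univ : Set E3)) := by
  intro m
  induction m with
  | zero => exact fun hc => contDiffOn_zero.2 (continuous_synth hc.rapidDecay.summable).continuousOn
  | succ m ih =>
    intro c hc
    obtain ⟨hc0, d, hd, hcd⟩ := id hc
    have h := contDiffOn_succ_iff_hasFDerivWithinAt_of_uniqueDiffOn (𝕜 := ℝ) (f := synth c)
      (n := m) (isOpen_slab T).uniqueDiffOn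
    refine h.2 ⟨by simp, synthDeriv c d, ?_, fun z hz =>
      (hasFDerivAt_synth hc0 hd.rapidDecay hcd hz).hasFDerivWithinAt⟩
    refine (contDiffOn_const.smulRight (ih hd)).add (ContDiffOn.sum fun j _ =>
      contDiffOn_const.smulRight (ih (hc.of_succ.derivFam j)))

lemma contDiffOn_synth {T : ℝ} (hc : ∀ m, SmoothFam T m c) :
    ContDiffOn ℝ ∞ (synth c) (Ioo 0 T ×ˢ (univ : Set E3)) :=
  contDiffOn_infty.2 fun m => contDiffOn_synth_nat (hc m)

end synth

/-! ### From mild solutions to smooth solutions -/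

/-- The velocity field with Fourier coefficients `a`. -/
noncomputable def velocity (a : Fin 3 → Freq → TimeFn) (t : ℝ) (x : E3) : E3 :=
  WithLp.toLp 2 fun i => (synth (a i) (t, x)).re

/-- Fourier coefficients of the pressure. -/
noncomputable def pressureFam (a : Fin 3 → Freq → TimeFn) (n : Freq) : TimeFn :=
  ∑ k, ∑ l, ((-((n k : ℝ) * n l / freqSq n) : ℝ) : ℂ) • conv (a l) (a k) n

lemma smoothFam_pressureFam {T : ℝ} {m : ℕ} {a : Fin 3 → Freq → TimeFn}
    (h : ∀ i, SmoothFam T m (a i)) : SmoothFam T m (pressureFam a) :=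
  SmoothFam.sum _ fun k _ => SmoothFam.sum _ fun l _ => ((h l).conv (h k)).smul
    ⟨1, 0, fun n => by
      rw [Complex.norm_real, norm_neg, pow_zero, mul_one]
      exact abs_div_freqSq_le_one n k l⟩

lemma sum_conv_derivFam {a : Fin 3 → Freq → TimeFn} (hr : ∀ i, RapidDecay (a i))
    (hdiv : ∀ n, ∑ l, derivFam l (a l) n = 0) (i : Fin 3) (n : Freq) :
    ∑ l, conv (a l) (derivFam l (a i)) n
      = ∑ l, (Complex.I * ((n l : ℤ) : ℂ)) • conv (a l) (a i) n := by
  have hq : ∀ l : Fin 3, ∀ m n : Freq, Complex.I * (((m + n) l : ℤ) : ℂ)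
      = Complex.I * ((m l : ℤ) : ℂ) + Complex.I * ((n l : ℤ) : ℂ) := fun l m n => by
    simp [mul_add]
  have h1 : ∀ l, (Complex.I * ((n l : ℤ) : ℂ)) • conv (a l) (a i) n
      = conv (derivFam l (a l)) (a i) n + conv (a l) (derivFam l (a i)) n := fun l =>
    smul_conv_eq_add (hq l) n (hr l).summable (hr i).summable ((hr l).derivFam l).summable
      ((hr i).derivFam l).summable
  have h0 : ∑ l, conv (derivFam l (a l)) (a i) n = 0 := by
    have hs := fun l => ((hr l).derivFam l).summable
    have e : (derivFam 0 (a 0) + derivFam 1 (a 1)) + derivFam 2 (a 2) = 0 := by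
      funext m
      simpa [Fin.sum_univ_three] using hdiv m
    have hs01 : Summable fun n => ‖(derivFam 0 (a 0) + derivFam 1 (a 1)) n‖ :=
      (((hr 0).derivFam 0).add ((hr 1).derivFam 1)).summable
    have h2 := congrFun (conv_add_left hs01 (hs 2) (hr i).summable) n
    rw [e, conv_add_left (hs 0) (hs 1) (hr i).summable] at h2
    rw [Fin.sum_univ_three]
    simp only [Pi.add_apply] at h2
    rw [← h2]
    simp [conv]
  rw [Finset.sum_congr rfl fun l _ => h1 l, Finset.sum_add_distrib, h0, zero_add]

/-- The Navier-Stokes equations in Fourier coefficients. -/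
lemma nsVelocity_balance {a : Fin 3 → Freq → TimeFn} (hr : ∀ i, RapidDecay (a i))
    (hdiv : ∀ n, ∑ l, derivFam l (a l) n = 0) (ν : ℝ) (i : Fin 3) (n : Freq) :
    nsVelocity ν a i n + ∑ l, conv (a l) (derivFam l (a i)) n + derivFam i (pressureFam a) n
      = (ν : ℂ) • ∑ l, derivFam l (derivFam l (a i)) n := by
  rw [sum_conv_derivFam hr hdiv]
  have h1 : ∑ l, (Complex.I * ((n l : ℤ) : ℂ)) • conv (a l) (a i) n
      = ∑ k, ∑ l, (if i = k then Complex.I * ((n l : ℤ) : ℂ) else 0) • conv (a l) (a k) n := by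
    symm
    rw [Finset.sum_eq_single i]
    · simp
    · intro k _ hk
      simp [Ne.symm hk]
    · simp
  have h2 : derivFam i (pressureFam a) n = ∑ k, ∑ l, ((Complex.I * ((n i : ℤ) : ℂ)) *
      ((-((n k : ℝ) * n l / freqSq n) : ℝ) : ℂ)) • conv (a l) (a k) n := by
    simp only [derivFam, pressureFam, Finset.smul_sum, smul_smul]
  have h3 : (ν : ℂ) • ∑ l, derivFam l (derivFam l (a i)) n
      = (-((ν : ℂ) * (freqSq n : ℂ))) • a i n := by
    simp only [derivFam, smul_smul, ← Finset.sum_smul]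
    congr 1
    rw [freqSq, Fin.sum_univ_three, Fin.sum_univ_three]
    push_cast
    linear_combination (ν : ℂ) * ((n 0 : ℂ) ^ 2 + (n 1 : ℂ) ^ 2 + (n 2 : ℂ) ^ 2) * Complex.I_sq
  rw [h1, h2, h3, nsVelocity, add_assoc, add_assoc, ← Finset.sum_add_distrib,
    ← Finset.sum_add_distrib]
  rw [Finset.sum_eq_zero, add_zero]
  intro k _
  rw [← Finset.sum_add_distrib, ← Finset.sum_add_distrib]
  refine Finset.sum_eq_zero fun l _ => ?_
  rw [← add_smul, ← add_smul]
  convert zero_smul ℂ _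
  simp only [lerayMult]
  split_ifs <;> push_cast <;> ring

section smoothness
variable {Th : ℝ}

lemma hasFDerivAt_re_synth_space {c : Freq → TimeFn} (hc : SmoothFam Th 1 c) {t : ℝ}
    (ht : t ∈ Ioo 0 Th) (x : E3) :
    HasFDerivAt (fun y => (synth c (t, y)).re)
      (∑ j, (synth (derivFam j c) (t, x)).re • (EuclideanSpace.proj j : E3 →L[ℝ] ℝ)) x := by
  obtain ⟨hc0, d, hd, hcd⟩ := hc
  have h1 := hasFDerivAt_synth hc0 hd.rapidDecay hcd (z := (t, x)) ⟨ht, mem_univ _⟩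
  have h2 := h1.comp x (hasFDerivAt_prodMk_right t x)
  refine (Complex.reCLM.hasFDerivAt.comp x h2).congr_fderiv ?_
  ext v
  simp [synthDeriv, Fin.sum_univ_three]
  ring

lemma pd_re_synth {c : Freq → TimeFn} (hc : SmoothFam Th 1 c) {t : ℝ}
    (ht : t ∈ Ioo 0 Th) (j : Fin 3) :
    pd j (fun y => (synth c (t, y)).re) = fun y => (synth (derivFam j c) (t, y)).re := by
  funext x
  rw [(hasFDerivAt_re_synth_space hc ht x).pd_eq]
  simp only [Fin.sum_univ_three]
  fin_cases j <;> simp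

lemma hasDerivAt_re_synth_time {c d : Freq → TimeFn} (hc : RapidDecay c) (hd : RapidDecay d)
    (hcd : ∀ n, ∀ t ∈ Ioo 0 Th, HasDerivAt (c n) (d n t) t) {t : ℝ}
    (ht : t ∈ Ioo 0 Th) (x : E3) :
    HasDerivAt (fun s => (synth c (s, x)).re) (synth d (t, x)).re t := by
  have h1 := hasFDerivAt_synth hc hd hcd (z := (t, x)) ⟨ht, mem_univ _⟩
  have h2 := h1.comp t (hasFDerivAt_prodMk_left (𝕜 := ℝ) t x)
  refine (Complex.reCLM.hasFDerivAt.comp t h2).hasDerivAt.congr_deriv ?_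
  simp [synthDeriv]

lemma contDiffOn_re_synth {c : Freq → TimeFn} (hc : ∀ m, SmoothFam Th m c) :
    ContDiffOn ℝ ∞ (fun z : ℝ × E3 => (synth c z).re) (Ioo 0 Th ×ˢ univ) :=
  Complex.reCLM.contDiff.comp_contDiffOn (contDiffOn_synth hc)

lemma contDiff_re_synth_space {c : Freq → TimeFn} (hc : ∀ m, SmoothFam Th m c) {t : ℝ}
    (ht : t ∈ Ioo 0 Th) : ContDiff ℝ ∞ fun y : E3 => (synth c (t, y)).re :=
  contDiffOn_univ.1 <| (contDiffOn_re_synth hc).comp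
    (contDiff_prodMk_right t).contDiffOn fun _ _ => ⟨ht, mem_univ _⟩

/-- A rapidly decaying real solution of the Navier-Stokes equations in Fourier coefficients on
`(0, Th)` defines a smooth solution on `(0, T]` for `T < Th`. -/
theorem isSmoothNSSolution_velocity {ν T : ℝ} (hTh : T < Th)
    {a : Fin 3 → Freq → TimeFn} (hsm : ∀ m i, SmoothFam Th m (a i))
    (hder : ∀ i n, ∀ t ∈ Ioo 0 Th, HasDerivAt (a i n) (nsVelocity ν a i n t) t)
    (hreal : ∀ i, reflectFam (a i) = a i) (hdiv : ∀ n, ∑ l, derivFam l (a l) n = 0) :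
    IsSmoothNSSolution ν T (velocity a 0) (velocity a) := by
  have hsub : Ioc 0 T ⊆ Ioo 0 Th := fun t ht => ⟨ht.1, ht.2.trans_lt hTh⟩
  have hr : ∀ i, RapidDecay (a i) := fun i => (hsm 0 i).rapidDecay
  have hspace : ∀ t ∈ Ioo 0 Th, ContDiff ℝ ∞ (velocity a t) := fun t ht =>
    contDiff_euclidean.2 fun i => contDiff_re_synth_space (fun m => hsm m i) ht
  have hpsm : ∀ m, SmoothFam Th m (pressureFam a) := fun m => smoothFam_pressureFam (hsm m)
  refine ⟨?_, ?_, ?_, ⟨fun t x => (synth (pressureFam a) (t, x)).re, ?_, ?_, ?_⟩, ?_⟩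
  · exact contDiffOn_euclidean.2 fun i =>
      (contDiffOn_re_synth fun m => hsm m i).mono (prod_mono hsub subset_rfl)
  · intro t _ i x
    ext j
    exact congrArg Complex.re (synth_periodic (a j) t i x)
  · intro t ht x
    rw [vdiv_eq_sum_pd ((hspace t (hsub ht)).differentiable (by simp) x)]
    have : ∀ i, pd i (fun y => velocity a t y i) x = (synth (derivFam i (a i)) (t, x)).re :=
      fun i => congrFun (pd_re_synth (hsm 1 i) (hsub ht) i) x
    simp only [this]
    rw [← Complex.re_sum, ← synth_sum _ fun i _ => ((hr i).derivFam i).summable]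
    simp [hdiv, synth]
  · exact (contDiffOn_re_synth hpsm).mono (prod_mono hsub subset_rfl)
  · intro t _ i x
    exact congrArg Complex.re (synth_periodic (pressureFam a) t i x)
  · intro t ht x
    have ht' := hsub ht
    have hu : HasDerivAt (fun s => velocity a s x)
        (WithLp.toLp 2 fun i => (synth (nsVelocity ν a i) (t, x)).re) t := by
      have : HasDerivAt (fun s => fun i => (synth (a i) (s, x)).re)
          (fun i => (synth (nsVelocity ν a i) (t, x)).re) t :=
        hasDerivAt_pi.2 fun i => hasDerivAt_re_synth_time (hr i)
          (smoothFam_nsVelocity (hsm 0) i).rapidDecay (hder i) ht' x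
      exact ((EuclideanSpace.equiv (Fin 3) ℝ).symm.toContinuousLinearMap.hasFDerivAt.comp_hasDerivAt
        t this)
    have huniq : UniqueDiffWithinAt ℝ (Ioc 0 T) t := uniqueDiffOn_Ioc 0 T t ht
    rw [hu.hasDerivWithinAt.derivWithin huniq]
    ext i
    have hd := (hspace t ht').differentiable (by simp) x
    have hp1 : ∀ l, pd l (fun y => velocity a t y i)
        = fun y => (synth (derivFam l (a i)) (t, y)).re := fun l => pd_re_synth (hsm 1 i) ht' l
    have hp2 : ∀ l, pd l (fun y => (synth (derivFam l (a i)) (t, y)).re)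
        = fun y => (synth (derivFam l (derivFam l (a i))) (t, y)).re := fun l =>
      pd_re_synth ((hsm 1 i).derivFam l) ht' l
    have hp3 : pd i (fun y => (synth (pressureFam a) (t, y)).re)
        = fun y => (synth (derivFam i (pressureFam a)) (t, y)).re := pd_re_synth (hpsm 1) ht' i
    simp only [PiLp.add_apply, PiLp.smul_apply, smul_eq_mul]
    rw [gradient_apply_coord, fderiv_apply_coord hd, fderiv_apply_eq_sum,
      laplacian_apply_coord (by exact_mod_cast contDiff_infty.1 (hspace t ht') 2), hp3]
    simp only [hp1, hp2, smul_eq_mul]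
    have hbal : (fun n => nsVelocity ν a i n + ∑ l, conv (a l) (derivFam l (a i)) n
        + derivFam i (pressureFam a) n)
        = fun n => (ν : ℂ) • ∑ l, derivFam l (derivFam l (a i)) n :=
      funext fun n => nsVelocity_balance hr hdiv ν i n
    have hs1 : RapidDecay (nsVelocity ν a i) := (smoothFam_nsVelocity (hsm 0) i).rapidDecay
    have hs2 : ∀ l ∈ Finset.univ, RapidDecay (conv (a l) (derivFam l (a i))) := fun l _ =>
      (hr l).conv ((hr i).derivFam l)
    have hs2' : RapidDecay fun n => ∑ l, conv (a l) (derivFam l (a i)) n :=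
      SmoothFam.sum (T := Th) (m := 0) _ hs2
    have hs3 : RapidDecay (derivFam i (pressureFam a)) := (hpsm 0).rapidDecay.derivFam i
    have hs4 : ∀ l ∈ Finset.univ, RapidDecay (derivFam l (derivFam l (a i))) := fun l _ =>
      ((hr i).derivFam l).derivFam l
    have hs4' : RapidDecay fun n => ∑ l, derivFam l (derivFam l (a i)) n :=
      SmoothFam.sum (T := Th) (m := 0) _ hs4
    have key := congrArg (fun c => synth c (t, x)) hbal
    rw [synth_add (hs1.add hs2').summable hs3.summable, synth_add hs1.summable hs2'.summable,
      synth_sum _ fun l hl => (hs2 l hl).summable, synth_const_smul _ hs4'.summable,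
      synth_sum _ fun l hl => (hs4 l hl).summable] at key
    have key2 := congrArg Complex.re key
    rw [Complex.add_re, Complex.add_re, Complex.re_sum, Complex.re_ofReal_mul,
      Complex.re_sum] at key2
    rw [← key2]
    congr 2
    refine Finset.sum_congr rfl fun l _ => ?_
    rw [synth_conv (hr l).summable ((hr i).derivFam l).summable, ← synth_real (hreal l),
      Complex.re_ofReal_mul]
    rfl
  · have hcont : ∀ i, Continuous (synth (a i)) := fun i => continuous_synth (hr i).summable
    have hvel : Continuous fun z : ℝ × E3 => velocity a z.1 z.2 :=
      (PiLp.continuous_toLp 2 _).comp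
        (continuous_pi fun i => Complex.continuous_re.comp (hcont i))
    have hb : ∃ C, ∀ t x, ‖velocity a t x‖ ≤ C := by
      refine ⟨∑ i, ∑' n, ‖a i n‖, fun t x => ?_⟩
      rw [E3.eq_sum_single (velocity a t x)]
      refine norm_sum_le_of_le _ fun i _ => ?_
      rw [norm_smul, PiLp.norm_single, norm_one, mul_one]
      exact (Complex.abs_re_le_norm _).trans (norm_synth_le (hr i).summable _)
    obtain ⟨C, hC⟩ := hb
    have hlim := tendsto_integral_filter_of_dominated_convergence
      (μ := volume.restrict torusCell) (l := 𝓝[>] (0 : ℝ))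
      (F := fun t x => ‖velocity a t x - velocity a 0 x‖ ^ 2) (f := fun _ => (0 : ℝ))
      (fun _ => (C + C) ^ 2)
      (Eventually.of_forall fun t => by
        have h1 : Continuous fun x => velocity a t x := hvel.comp (by fun_prop : Continuous
          fun x : E3 => ((t, x) : ℝ × E3))
        have h2 : Continuous fun x => velocity a 0 x := hvel.comp (by fun_prop : Continuous
          fun x : E3 => ((0, x) : ℝ × E3))
        exact ((h1.sub h2).norm.pow 2).aestronglyMeasurable)
      (Eventually.of_forall fun t => Eventually.of_forall fun x => by
        rw [norm_pow, norm_norm]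
        exact pow_le_pow_left₀ (norm_nonneg _)
          ((norm_sub_le _ _).trans (add_le_add (hC t x) (hC 0 x))) 2)
      (by
        have : Fact (volume torusCell < ⊤) := ⟨volume_torusCell_lt_top⟩
        exact integrable_const _)
      (Eventually.of_forall fun x => by
        have h1 : Continuous fun t => ‖velocity a t x - velocity a 0 x‖ ^ 2 :=
          ((hvel.comp (by fun_prop : Continuous fun t : ℝ => ((t, x) : ℝ × E3))).sub
            continuous_const).norm.pow 2
        have h2 := h1.tendsto 0
        simp only [sub_self, norm_zero, ne_eq, OfNat.ofNat_ne_zero, not_false_eq_true,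
          zero_pow] at h2
        exact h2.mono_left nhdsWithin_le_nhds)
    simpa using hlim

end smoothness

/-! ### Uniqueness by the energy method -/

section pdcalc
variable {f g : E3 → ℝ} {x : E3}

lemma pd_mul (hf : DifferentiableAt ℝ f x) (hg : DifferentiableAt ℝ g x) (i : Fin 3) :
    pd i (fun y => f y * g y) x = f x * pd i g x + pd i f x * g x := by
  have h : HasFDerivAt (fun y => f y * g y) _ x := hf.hasFDerivAt.mul hg.hasFDerivAt
  rw [h.pd_eq]
  simp [pd, mul_comm]

lemma pd_sub (hf : DifferentiableAt ℝ f x) (hg : DifferentiableAt ℝ g x) (i : Fin 3) :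
    pd i (fun y => f y - g y) x = pd i f x - pd i g x := by
  have h : HasFDerivAt (fun y => f y - g y) _ x := hf.hasFDerivAt.sub hg.hasFDerivAt
  rw [h.pd_eq]
  simp [pd]

lemma pd_const_mul (r : ℝ) (hf : DifferentiableAt ℝ f x) (i : Fin 3) :
    pd i (fun y => r * f y) x = r * pd i f x := by
  rw [(hf.hasFDerivAt.const_mul r).pd_eq]
  simp [pd]

lemma pd_sum {f : Fin 3 → E3 → ℝ} (hf : ∀ j, DifferentiableAt ℝ (f j) x) (i : Fin 3) :
    pd i (fun y => ∑ j, f j y) x = ∑ j, pd i (f j) x := by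
  rw [(HasFDerivAt.fun_sum fun j _ => (hf j).hasFDerivAt).pd_eq]
  simp [pd]

end pdcalc

/-- The differential inequality behind uniqueness, at a fixed time: the energy production of the
difference `w = v - u` of two solutions is controlled by the energy of `w` and a bound `G` of the
gradient of `u`. -/
lemma energy_production_le {ν G : ℝ} (hν : 0 ≤ ν) {v u : Fin 3 → E3 → ℝ} {q : E3 → ℝ}
    (hv : ∀ i, ContDiff ℝ ∞ (v i)) (hu : ∀ i, ContDiff ℝ ∞ (u i)) (hq : ContDiff ℝ ∞ q)
    (hvp : ∀ i, TorusPeriodic (v i)) (hup : ∀ i, TorusPeriodic (u i)) (hqp : TorusPeriodic q)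
    (hvd : ∀ x, ∑ i, pd i (v i) x = 0) (hud : ∀ x, ∑ i, pd i (u i) x = 0)
    (hG : ∀ x i l, |pd l (u i) x| ≤ G) {Q' : E3 → ℝ} (hQ' : Continuous Q')
    (hQ : ∀ x, Q' x = ∑ i, 2 * (v i x - u i x) *
      ((ν * ∑ l, pd l (pd l (v i)) x - ν * ∑ l, pd l (pd l (u i)) x) - pd i q x
        - (∑ l, v l x * pd l (v i) x - ∑ l, u l x * pd l (u i) x))) :
    ∫ x in torusCell, Q' x ≤ 6 * G * ∫ x in torusCell, ∑ i, (v i x - u i x) ^ 2 := by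
  set w : Fin 3 → E3 → ℝ := fun i x => v i x - u i x with hw
  have hws : ∀ i, ContDiff ℝ ∞ (w i) := fun i => (hv i).sub (hu i)
  have hwp : ∀ i, TorusPeriodic (w i) := fun i j x => by simp only [hw, hvp i j x, hup i j x]
  have hdiff : ∀ {f : E3 → ℝ}, ContDiff ℝ ∞ f → ∀ x, DifferentiableAt ℝ f x := fun hf x =>
    hf.differentiable (by simp) x
  set N : E3 → ℝ := fun y => ∑ i, w i y * w i y with hN
  have hNs : ContDiff ℝ ∞ N := ContDiff.sum fun i _ => (hws i).mul (hws i)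
  set A : Fin 3 → E3 → ℝ := fun l y => ∑ i, w i y * pd l (w i) y with hA
  have hAs : ∀ l, ContDiff ℝ ∞ (A l) := fun l =>
    ContDiff.sum fun i _ => (hws i).mul (contDiff_pd_infty (hws i) l)
  -- the energy flux: viscous transport, pressure work and convection of the energy density `N`
  set H : Fin 3 → E3 → ℝ := fun l y => 2 * ν * A l y - 2 * (q y * w l y) - v l y * N y with hH
  have hHs : ∀ l, ContDiff ℝ ∞ (H l) := fun l =>
    ((contDiff_const.mul (hAs l)).sub (contDiff_const.mul (hq.mul (hws l)))).sub
      ((hv l).mul hNs)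
  have hHp : ∀ l, TorusPeriodic (H l) := fun l j x => by
    have h1 : ∀ i, pd l (w i) (x + EuclideanSpace.single j (2 * π)) = pd l (w i) x := fun i =>
      (hwp i).pd l j x
    simp only [hH, hA, hN, hqp j x, hvp l j x, h1, fun i => hwp i j x]
  have hNpd : ∀ l x, pd l N x = ∑ i, (w i x * pd l (w i) x + pd l (w i) x * w i x) := fun l x => by
    simp only [hN]
    rw [pd_sum fun i => (hdiff (hws i) x).fun_mul (hdiff (hws i) x)]
    exact Finset.sum_congr rfl fun i _ => pd_mul (hdiff (hws i) x) (hdiff (hws i) x) l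
  have hApd : ∀ l x, pd l (A l) x
      = ∑ i, (w i x * pd l (pd l (w i)) x + pd l (w i) x * pd l (w i) x) := fun l x => by
    have hd : ∀ i, DifferentiableAt ℝ (pd l (w i)) x := fun i =>
      hdiff (contDiff_pd_infty (hws i) l) x
    simp only [hA]
    rw [pd_sum fun i => (hdiff (hws i) x).fun_mul (hd i)]
    exact Finset.sum_congr rfl fun i _ => pd_mul (hdiff (hws i) x) (hd i) l
  have hHpd : ∀ l x, pd l (H l) x = 2 * ν * pd l (A l) x
      - 2 * (q x * pd l (w l) x + pd l q x * w l x) - (v l x * pd l N x + pd l (v l) x * N x) := by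
    intro l x
    have h1 := hdiff (contDiff_const.mul (hAs l) : ContDiff ℝ ∞ fun y => 2 * ν * A l y) x
    have h2' := hdiff (hq.mul (hws l)) x
    have h2 := hdiff (contDiff_const.mul (hq.mul (hws l)) :
      ContDiff ℝ ∞ fun y => 2 * (q y * w l y)) x
    have h3 := hdiff ((hv l).mul hNs) x
    simp only [hH]
    rw [pd_sub (h1.fun_sub h2) h3, pd_sub h1 h2, pd_const_mul _ (hdiff (hAs l) x),
      pd_const_mul _ h2', pd_mul (hdiff hq x) (hdiff (hws l) x),
      pd_mul (hdiff (hv l) x) (hdiff hNs x)]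
  have hwpd : ∀ l i x, pd l (w i) x = pd l (v i) x - pd l (u i) x := fun l i x =>
    pd_sub (hdiff (hv i) x) (hdiff (hu i) x) l
  have hwpd2 : ∀ l i x, pd l (pd l (w i)) x = pd l (pd l (v i)) x - pd l (pd l (u i)) x := by
    intro l i x
    have : pd l (w i) = fun y => pd l (v i) y - pd l (u i) y := funext fun y => hwpd l i y
    rw [this]
    exact pd_sub (hdiff (contDiff_pd_infty (hv i) l) x) (hdiff (contDiff_pd_infty (hu i) l) x) l
  have hpt : ∀ x, Q' x ≤ (∑ l, pd l (H l) x) + 6 * G * ∑ i, w i x ^ 2 := by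
    intro x
    have hdw : ∑ i, pd i (w i) x = 0 := by
      simp only [hwpd, Finset.sum_sub_distrib, hvd, hud, sub_zero]
    -- energy balance: divergence of the flux, dissipation, and stretching by the gradient of `u`
    have hid : Q' x = (∑ l, pd l (H l) x) - 2 * ν * (∑ l, ∑ i, pd l (w i) x ^ 2)
        - 2 * ∑ i, ∑ l, w i x * w l x * pd l (u i) x := by
      have e1 := hvd x
      have e2 := hdw
      have hwx : ∀ i, w i x = v i x - u i x := fun i => rfl
      simp only [hQ, hHpd, hApd, hNpd, Fin.sum_univ_three] at e1 e2 ⊢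
      simp only [hN, Fin.sum_univ_three]
      simp only [hwpd2, hwpd, hwx] at e2 ⊢
      linear_combination (2 * q x) * e2
        + ((v 0 x - u 0 x) * (v 0 x - u 0 x) + (v 1 x - u 1 x) * (v 1 x - u 1 x)
          + (v 2 x - u 2 x) * (v 2 x - u 2 x)) * e1
    have hG0 : 0 ≤ G := (abs_nonneg _).trans (hG x 0 0)
    have hterm : ∀ i l, -(w i x * w l x * pd l (u i) x) ≤ G * (|w i x| * |w l x|) := by
      intro i l
      calc -(w i x * w l x * pd l (u i) x) ≤ |w i x * w l x * pd l (u i) x| := neg_le_abs _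
        _ = |pd l (u i) x| * (|w i x| * |w l x|) := by rw [abs_mul, abs_mul]; ring
        _ ≤ _ := by gcongr; exact hG x i l
    have hsum : -(∑ i, ∑ l, w i x * w l x * pd l (u i) x) ≤ 3 * G * ∑ i, w i x ^ 2 := by
      simp only [← Finset.sum_neg_distrib]
      refine (Finset.sum_le_sum fun i _ => Finset.sum_le_sum fun l _ => hterm i l).trans ?_
      simp only [← Finset.mul_sum, ← Finset.sum_mul]
      rw [mul_comm 3 G, mul_assoc]
      refine mul_le_mul_of_nonneg_left ?_ hG0
      simp only [Fin.sum_univ_three]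
      rw [← sq_abs (w 0 x), ← sq_abs (w 1 x), ← sq_abs (w 2 x)]
      nlinarith [sq_nonneg (|w 0 x| - |w 1 x|), sq_nonneg (|w 0 x| - |w 2 x|),
        sq_nonneg (|w 1 x| - |w 2 x|)]
    have hpos : 0 ≤ 2 * ν * (∑ l, ∑ i, pd l (w i) x ^ 2) :=
      mul_nonneg (by positivity) (Finset.sum_nonneg fun l _ => Finset.sum_nonneg fun i _ =>
        sq_nonneg _)
    rw [hid]
    linarith
  have hHint : ∀ l ∈ Finset.univ, IntegrableOn (fun x => pd l (H l) x) torusCell := fun l _ =>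
    (contDiff_pd_infty (hHs l) l).continuous.integrableOn_torusCell
  have hwint : IntegrableOn (fun x => 6 * G * ∑ i, w i x ^ 2) torusCell :=
    Continuous.integrableOn_torusCell (continuous_const.mul (continuous_finsetSum _ fun i _ =>
      (hws i).continuous.pow 2))
  refine (setIntegral_mono hQ'.integrableOn_torusCell
    ((integrable_finsetSum _ hHint).add hwint) hpt).trans (le_of_eq ?_)
  have e : ∫ x in torusCell, ((∑ l, pd l (H l) x) + 6 * G * ∑ i, w i x ^ 2)
      = (∑ l, ∫ x in torusCell, pd l (H l) x) + ∫ x in torusCell, 6 * G * ∑ i, w i x ^ 2 := by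
    rw [integral_add (integrable_finsetSum _ hHint) hwint, integral_finsetSum _ hHint]
  refine e.trans ?_
  rw [Finset.sum_eq_zero fun l _ => setIntegral_pd_eq_zero ((hHs l).of_le (by simp)) (hHp l) l,
    zero_add, integral_const_mul]

/-- Differentiation under the integral over the torus. -/
lemma hasDerivAt_setIntegral_torusCell {T t : ℝ} (ht : t ∈ Ioo 0 T) {Q Q' : ℝ → E3 → ℝ}
    (hQ : ∀ s ∈ Ioo 0 T, Continuous (Q s))
    (hQ' : ContinuousOn (fun z : ℝ × E3 => Q' z.1 z.2) (Ioo 0 T ×ˢ univ))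
    (hd : ∀ s ∈ Ioo 0 T, ∀ x, HasDerivAt (fun s => Q s x) (Q' s x) s) :
    HasDerivAt (fun s => ∫ x in torusCell, Q s x) (∫ x in torusCell, Q' t x) t := by
  obtain ⟨ε, hε, hsub⟩ := Metric.nhds_basis_closedBall.mem_iff.1 (Ioo_mem_nhds ht.1 ht.2)
  have hcomp : IsCompact (Metric.closedBall t ε ×ˢ Metric.closedBall (0 : E3) (6 * π)) :=
    (isCompact_closedBall _ _).prod (isCompact_closedBall _ _)
  obtain ⟨C, hC⟩ := hcomp.exists_bound_of_continuousOn (hQ'.mono (prod_mono hsub (subset_univ _)))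
  have hcont' : Continuous (Q' t) := by
    have : ContinuousOn (fun x : E3 => Q' t x) univ := hQ'.comp
      (by fun_prop : Continuous fun x : E3 => ((t, x) : ℝ × E3)).continuousOn
      fun x _ => ⟨ht, mem_univ _⟩
    exact continuousOn_univ.1 this
  have hfin : Fact (volume torusCell < ⊤) := ⟨volume_torusCell_lt_top⟩
  refine (hasDerivAt_integral_of_dominated_loc_of_deriv_le (bound := fun _ => C)
    (Metric.closedBall_mem_nhds t hε) ?_ (hQ t ht).integrableOn_torusCell
    hcont'.aestronglyMeasurable ?_ (integrable_const C) ?_).2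
  · filter_upwards [Ioo_mem_nhds ht.1 ht.2] with s hs
    exact (hQ s hs).aestronglyMeasurable
  · refine (ae_restrict_iff' measurableSet_torusCell).2 (Eventually.of_forall fun x hx s hs => ?_)
    exact hC (s, x) ⟨hs, torusCell_subset_closedBall hx⟩
  · exact Eventually.of_forall fun x s hs => hd s (hsub hs) x

/-- Every point has a representative in the fundamental cell, common to all periodic functions. -/
lemma TorusPeriodic.exists_mem_torusCell (x : E3) :
    ∃ y ∈ torusCell, ∀ {F : Type} (f : E3 → F), TorusPeriodic f → f y = f x := by
  have hp : (0 : ℝ) < 2 * π := by positivity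
  refine ⟨WithLp.toLp 2 fun i => toIocMod hp 0 (x i), fun i => ?_, fun f hf => ?_⟩
  · simpa using toIocMod_mem_Ioc hp 0 (x i)
  · have hper : ∀ (i : Fin 3) (k : ℤ) (z : E3),
        f (z + EuclideanSpace.single i (k * (2 * π))) = f z := by
      intro i k z
      have h : Function.Periodic (fun r : ℝ => f (z + EuclideanSpace.single i r)) (2 * π) := by
        intro r
        have e : z + EuclideanSpace.single i (r + 2 * π)
            = z + EuclideanSpace.single i r + EuclideanSpace.single i (2 * π) := by
          rw [add_assoc]
          congr 1
          ext j
          by_cases hj : j = i <;> simp [hj]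
        simp only [e]
        exact hf i _
      have hz : (EuclideanSpace.single i (0 : ℝ) : E3) = 0 := by ext j; simp
      have := h.int_mul k 0
      simpa only [zero_add, hz, add_zero] using this
    have e : x = WithLp.toLp 2 (fun i => toIocMod hp 0 (x i))
        + EuclideanSpace.single 0 (toIocDiv hp 0 (x 0) * (2 * π))
        + EuclideanSpace.single 1 (toIocDiv hp 0 (x 1) * (2 * π))
        + EuclideanSpace.single 2 (toIocDiv hp 0 (x 2) * (2 * π)) := by
      ext j
      fin_cases j <;> simp
    conv_rhs => rw [e]
    rw [hper, hper, hper]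

lemma torusCell_subset_closure_interior : torusCell ⊆ closure (interior torusCell) := by
  have hconv : Convex ℝ torusCell := by
    have : torusCell = ⋂ i : Fin 3, (EuclideanSpace.proj i : E3 →L[ℝ] ℝ) ⁻¹' Ioc 0 (2 * π) := by
      ext x; simp [torusCell]
    rw [this]
    exact convex_iInter fun i => (convex_Ioc _ _).linear_preimage
      (EuclideanSpace.proj i : E3 →L[ℝ] ℝ).toLinearMap
  have hne : (interior torusCell).Nonempty := by
    refine ⟨WithLp.toLp 2 fun _ => π, mem_interior.2 ⟨{x | ∀ i, x i ∈ Ioo 0 (2 * π)},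
      fun x hx i => Ioo_subset_Ioc_self (hx i), ?_, fun i => ?_⟩⟩
    · have : {x : E3 | ∀ i, x i ∈ Ioo 0 (2 * π)}
          = ⋂ i : Fin 3, (fun x : E3 => x i) ⁻¹' Ioo 0 (2 * π) := by
        ext x; simp
      rw [this]
      exact isOpen_iInter_of_finite fun i => isOpen_Ioo.preimage (by fun_prop)
    · have := pi_pos
      simp only [mem_Ioo]
      constructor <;> linarith
  rw [hconv.closure_interior_eq_closure_of_nonempty_interior hne]
  exact subset_closure

lemma eq_zero_of_setIntegral_eq_zero {Q : E3 → ℝ} (hQ : Continuous Q) (hQ0 : ∀ x, 0 ≤ Q x)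
    (hp : TorusPeriodic Q) (h : ∫ x in torusCell, Q x = 0) (x : E3) : Q x = 0 := by
  have h1 := (setIntegral_eq_zero_iff_of_nonneg_ae (Eventually.of_forall hQ0)
    hQ.integrableOn_torusCell).1 h
  have h2 := Measure.eqOn_of_ae_eq h1 hQ.continuousOn continuousOn_const
    torusCell_subset_closure_interior
  obtain ⟨y, hy, hyx⟩ := TorusPeriodic.exists_mem_torusCell x
  rw [← hyx Q hp]
  exact h2 hy

namespace IsSmoothNSSolution
variable {ν T : ℝ} {uin : E3 → E3} {u v : ℝ → E3 → E3}

lemma contDiffOn_slab (hu : IsSmoothNSSolution ν T uin u) (i : Fin 3) :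
    ContDiffOn ℝ ∞ (fun z : ℝ × E3 => u z.1 z.2 i) (Ioo 0 T ×ˢ univ) :=
  (contDiffOn_euclidean.1 hu.smooth i).mono (prod_mono Ioo_subset_Ioc_self subset_rfl)

lemma contDiff_space (hu : IsSmoothNSSolution ν T uin u) {t : ℝ} (ht : t ∈ Ioc 0 T) :
    ContDiff ℝ ∞ (u t) :=
  contDiffOn_univ.1 <| hu.smooth.comp (contDiff_prodMk_right t).contDiffOn
    fun _ _ => ⟨ht, mem_univ _⟩

/-- The momentum equation in coordinates, at times in the interior of `(0, T]`. -/
lemma momentum_coord (hu : IsSmoothNSSolution ν T uin u) : ∃ P : ℝ → E3 → ℝ,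
    (∀ t ∈ Ioo 0 T, ContDiff ℝ ∞ (P t)) ∧ (∀ t ∈ Ioo 0 T, TorusPeriodic (P t)) ∧
    ∀ t ∈ Ioo 0 T, ∀ x i, HasDerivAt (fun s => u s x i)
      (ν * ∑ l, pd l (pd l fun y => u t y i) x - pd i (P t) x
        - ∑ l, u t x l * pd l (fun y => u t y i) x) t := by
  obtain ⟨P, hP, hPp, hmom⟩ := hu.momentum
  refine ⟨P, fun t ht => contDiffOn_univ.1 <| hP.comp (contDiff_prodMk_right t).contDiffOn
    fun _ _ => ⟨Ioo_subset_Ioc_self ht, mem_univ _⟩,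
    fun t ht => hPp t (Ioo_subset_Ioc_self ht), fun t ht x i => ?_⟩
  have ht' := Ioo_subset_Ioc_self ht
  have hs := hu.contDiff_space ht'
  have hd : DifferentiableAt ℝ (fun s => u s x) t := by
    have h1 : ContDiffOn ℝ ∞ (fun s => u s x) (Ioc 0 T) := hu.smooth.comp
      (contDiff_prodMk_left x).contDiffOn fun s hs => ⟨hs, mem_univ _⟩
    exact (h1.differentiableOn (by simp) t ht').differentiableAt (Ioc_mem_nhds ht.1 ht.2)
  have h2 := congrArg (fun w : E3 => w i) (hmom t ht' x)
  simp only [PiLp.add_apply, PiLp.smul_apply, smul_eq_mul] at h2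
  rw [gradient_apply_coord, fderiv_apply_coord (hs.differentiable (by simp) x),
    fderiv_apply_eq_sum, laplacian_apply_coord (by exact_mod_cast contDiff_infty.1 hs 2),
    derivWithin_of_mem_nhds (Ioc_mem_nhds ht.1 ht.2)] at h2
  have h3 : HasDerivAt (fun s => u s x i) (deriv (fun s => u s x) t i) t :=
    (EuclideanSpace.proj (𝕜 := ℝ) i).hasFDerivAt.comp_hasDerivAt t hd.hasDerivAt
  refine h3.congr_deriv ?_
  simp only [smul_eq_mul] at h2
  linarith

/-- Weak-strong uniqueness: a smooth solution with bounded gradient is the only smooth solution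
attaining the same initial data in `L²`. -/
theorem eq_of_bounded_gradient (hν : 0 ≤ ν) (huin : Continuous uin)
    (hu : IsSmoothNSSolution ν T uin u) (hv : IsSmoothNSSolution ν T uin v) {G : ℝ}
    (hG : ∀ t ∈ Ioc 0 T, ∀ x i l, |pd l (fun y => u t y i) x| ≤ G) :
    ∀ t ∈ Ioc 0 T, v t = u t := by
  rcases le_or_gt T 0 with hT | hT
  · exact fun t ht => absurd (ht.1.trans_le ht.2) (not_lt.2 hT)
  set Q : ℝ × E3 → ℝ := fun z => ∑ i, (v z.1 z.2 i - u z.1 z.2 i) ^ 2 with hQdef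
  have hQs : ContDiffOn ℝ ∞ Q (Ioo 0 T ×ˢ univ) := ContDiffOn.sum fun i _ =>
    ((hv.contDiffOn_slab i).sub (hu.contDiffOn_slab i)).pow 2
  set Q' : ℝ → E3 → ℝ := fun s x => fderiv ℝ Q (s, x) (1, 0) with hQ'def
  have hder : ∀ s ∈ Ioo 0 T, ∀ x, HasDerivAt (fun s => Q (s, x)) (Q' s x) s := by
    intro s hs x
    have h1 : DifferentiableAt ℝ Q (s, x) :=
      (hQs.differentiableOn (by simp)).differentiableAt
        ((isOpen_slab T).mem_nhds ⟨hs, mem_univ _⟩)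
    exact (h1.hasFDerivAt.comp s (hasFDerivAt_prodMk_left (𝕜 := ℝ) s x)).hasDerivAt
  have hQ'c : ContinuousOn (fun z : ℝ × E3 => Q' z.1 z.2) (Ioo 0 T ×ˢ univ) :=
    ((contDiffOn_infty_iff_fderiv_of_isOpen (isOpen_slab T)).1 hQs).2.continuousOn.clm_apply
      continuousOn_const
  have hslice : ∀ {f : ℝ × E3 → ℝ}, ContinuousOn f (Ioo 0 T ×ˢ univ) → ∀ s ∈ Ioo 0 T,
      Continuous fun x => f (s, x) := fun hf s hs => continuousOn_univ.1 <|
    hf.comp (by fun_prop : Continuous fun x : E3 => ((s, x) : ℝ × E3)).continuousOn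
      fun x _ => ⟨hs, mem_univ _⟩
  set φ : ℝ → ℝ := fun s => ∫ x in torusCell, Q (s, x) with hφdef
  have hφd : ∀ s ∈ Ioo 0 T, HasDerivAt φ (∫ x in torusCell, Q' s x) s := fun s hs =>
    hasDerivAt_setIntegral_torusCell hs (Q := fun s x => Q (s, x)) (hslice hQs.continuousOn)
      hQ'c hder
  obtain ⟨P, hPs, hPp, hPm⟩ := hu.momentum_coord
  obtain ⟨R, hRs, hRp, hRm⟩ := hv.momentum_coord
  have hprod : ∀ s ∈ Ioo 0 T, ∫ x in torusCell, Q' s x ≤ 6 * G * φ s := by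
    intro s hs
    have hs' := Ioo_subset_Ioc_self hs
    have hqd : ∀ i x, pd i (fun y => R s y - P s y) x = pd i (R s) x - pd i (P s) x := fun i x =>
      pd_sub ((hRs s hs).differentiable (by simp) x) ((hPs s hs).differentiable (by simp) x) i
    have hdv : ∀ {w : ℝ → E3 → E3}, IsSmoothNSSolution ν T uin w →
        ∀ x, ∑ i, pd i (fun y => w s y i) x = 0 := fun hw x => by
      rw [← vdiv_eq_sum_pd ((hw.contDiff_space hs').differentiable (by simp) x)]
      exact hw.div_free s hs' x
    refine energy_production_le hν (v := fun i y => v s y i) (u := fun i y => u s y i)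
      (q := fun y => R s y - P s y)
      (fun i => contDiff_euclidean.1 (hv.contDiff_space hs') i)
      (fun i => contDiff_euclidean.1 (hu.contDiff_space hs') i) ((hRs s hs).sub (hPs s hs))
      (fun i j x => congrArg (fun w : E3 => w i) (hv.periodic s hs' j x))
      (fun i j x => congrArg (fun w : E3 => w i) (hu.periodic s hs' j x))
      (fun j x => by simp only [hRp s hs j x, hPp s hs j x]) (hdv hv) (hdv hu)
      (fun x i l => hG s hs' x i l) (hslice hQ'c s hs) (fun x => ?_)
    have h1 : HasDerivAt (fun s => Q (s, x)) _ s :=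
      HasDerivAt.fun_sum fun i _ => ((hRm s hs x i).sub (hPm s hs x i)).pow 2
    rw [(hder s hs x).unique h1]
    refine Finset.sum_congr rfl fun i _ => ?_
    rw [hqd]
    simp only [Nat.cast_ofNat, Pi.sub_apply, Nat.add_one_sub_one, pow_one]
    ring
  have hφ0 : ∀ s, 0 ≤ φ s := fun s => integral_nonneg fun x =>
    Finset.sum_nonneg fun i _ => sq_nonneg _
  have hQnorm : ∀ s x, Q (s, x) = ‖v s x - u s x‖ ^ 2 := fun s x => by
    rw [EuclideanSpace.real_norm_sq_eq]
    simp [hQdef]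
  -- the energy tends to zero at the initial time
  have hlim : Tendsto φ (𝓝[>] 0) (𝓝 0) := by
    have h2 := (hv.initial.add hu.initial).const_mul 2
    rw [add_zero, mul_zero] at h2
    refine squeeze_zero' (Eventually.of_forall hφ0) ?_ h2
    filter_upwards [Ioc_mem_nhdsGT hT] with s hs
    have hi : ∀ {w : ℝ → E3 → E3}, IsSmoothNSSolution ν T uin w →
        IntegrableOn (fun x => ‖w s x - uin x‖ ^ 2) torusCell := fun hw =>
      Continuous.integrableOn_torusCell
        ((((hw.contDiff_space hs).continuous.sub huin).norm).pow 2)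
    have hi0 : IntegrableOn (fun x => Q (s, x)) torusCell := by
      simp only [hQnorm]
      exact Continuous.integrableOn_torusCell
        ((((hv.contDiff_space hs).continuous.sub (hu.contDiff_space hs).continuous).norm).pow 2)
    rw [← integral_add (hi hv) (hi hu), ← integral_const_mul]
    refine setIntegral_mono hi0 (((hi hv).add (hi hu)).const_mul 2) fun x => ?_
    simp only [hQnorm]
    have h3 : ‖v s x - u s x‖ ≤ ‖v s x - uin x‖ + ‖u s x - uin x‖ := by
      have := norm_sub_le (v s x - uin x) (u s x - uin x)
      simpa using this
    nlinarith [norm_nonneg (v s x - u s x), norm_nonneg (v s x - uin x),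
      norm_nonneg (u s x - uin x), sq_nonneg (‖v s x - uin x‖ - ‖u s x - uin x‖)]
  -- Grönwall on `(0, T)`: `ψ` is nonincreasing and tends to zero at the initial time
  set ψ : ℝ → ℝ := fun s => φ s * rexp (-(6 * G) * s) with hψdef
  have hψd : ∀ s ∈ Ioo 0 T, HasDerivAt ψ ((∫ x in torusCell, Q' s x) * rexp (-(6 * G) * s)
      + φ s * (rexp (-(6 * G) * s) * (-(6 * G) * 1))) s := fun s hs =>
    (hφd s hs).mul (((hasDerivAt_id s).const_mul _).exp)
  have hanti : AntitoneOn ψ (Ioo 0 T) := by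
    refine antitoneOn_of_deriv_nonpos (convex_Ioo 0 T)
      (fun s hs => (hψd s hs).continuousAt.continuousWithinAt) ?_ ?_
    · rw [interior_Ioo]
      exact fun s hs => (hψd s hs).differentiableAt.differentiableWithinAt
    · rw [interior_Ioo]
      intro s hs
      rw [(hψd s hs).deriv]
      have := mul_le_mul_of_nonneg_right (hprod s hs) (exp_pos (-(6 * G) * s)).le
      linarith
  have hψlim : Tendsto ψ (𝓝[>] 0) (𝓝 0) := by
    have h1 : Tendsto (fun s : ℝ => rexp (-(6 * G) * s)) (𝓝[>] 0) (𝓝 (rexp (-(6 * G) * 0))) :=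
      ((by fun_prop : Continuous fun s : ℝ => rexp (-(6 * G) * s)).tendsto 0).mono_left
        nhdsWithin_le_nhds
    have h2 := hlim.mul h1
    rwa [zero_mul] at h2
  have hzero : ∀ t ∈ Ioo 0 T, ∀ x, v t x = u t x := by
    intro t ht
    have hψt : ψ t ≤ 0 := by
      refine ge_of_tendsto hψlim ?_
      filter_upwards [Ioo_mem_nhdsGT ht.1] with s hs
      exact hanti ⟨hs.1, hs.2.trans ht.2⟩ ht hs.2.le
    have hφt : φ t = 0 :=
      le_antisymm (by
        by_contra h
        exact absurd hψt (not_le.2 (mul_pos (not_le.1 h) (exp_pos _)))) (hφ0 t)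
    intro x
    have ht' := Ioo_subset_Ioc_self ht
    have := eq_zero_of_setIntegral_eq_zero (hslice hQs.continuousOn t ht)
      (fun x => Finset.sum_nonneg fun i _ => sq_nonneg _)
      (fun j x => by simp only [hQdef, hv.periodic t ht' j x, hu.periodic t ht' j x]) hφt x
    rw [hQnorm] at this
    exact sub_eq_zero.1 (norm_eq_zero.1 (pow_eq_zero_iff two_ne_zero |>.1 this))
  intro t ht
  -- the final time is reached by continuity
  rcases ht.2.eq_or_lt with rfl | hlt
  · funext x
    have hc : ∀ {w : ℝ → E3 → E3}, IsSmoothNSSolution ν t uin w →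
        Tendsto (fun s => w s x) (𝓝[Ioo 0 t] t) (𝓝 (w t x)) := fun hw => by
      have h1 : ContinuousOn (fun s => _) (Ioc 0 t) := hw.smooth.continuousOn.comp
        (by fun_prop : Continuous fun s : ℝ => ((s, x) : ℝ × E3)).continuousOn
        fun s hs => ⟨hs, mem_univ _⟩
      exact (h1 t ht).mono Ioo_subset_Ioc_self
    have hne : (𝓝[Ioo 0 t] t).NeBot := by
      rw [← mem_closure_iff_nhdsWithin_neBot, closure_Ioo ht.1.ne]
      exact ⟨ht.1.le, le_rfl⟩
    refine tendsto_nhds_unique_of_eventuallyEq (hc hv) (hc hu) ?_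
    filter_upwards [self_mem_nhdsWithin] with s hs
    exact hzero s hs x
  · exact funext (hzero t ⟨ht.1, hlt⟩)

end IsSmoothNSSolution

/-! ### The heat semigroup on Fourier series -/

/-- The Gaussian kernel of `e^{sΔ}` on `ℝ³`. -/
noncomputable def heatKernel (s : ℝ) (y : E3) : ℝ :=
  (4 * π * s) ^ (-(3 / 2) : ℝ) * rexp (-‖y‖ ^ 2 / (4 * s))

lemma heatKernel_nonneg {s : ℝ} (hs : 0 < s) (y : E3) : 0 ≤ heatKernel s y := by
  unfold heatKernel; positivity

/-- The integer vector `n` as a point of `ℝ³`. -/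
noncomputable def freqVec (n : Freq) : E3 := WithLp.toLp 2 fun i => (n i : ℝ)

lemma inner_freqVec (n : Freq) (x : E3) : inner ℝ (freqVec n) x = phase n x := by
  rw [phase_apply, PiLp.inner_apply]
  exact Finset.sum_congr rfl fun i _ => by simp [freqVec, mul_comm]

lemma norm_freqVec_sq (n : Freq) : ‖freqVec n‖ ^ 2 = freqSq n := by
  rw [EuclideanSpace.norm_sq_eq]
  simp [freqVec, freqSq]

lemma wave_add_right (n : Freq) (x y : E3) : wave n (x + y) = wave n x * wave n y := by
  rw [wave, wave, wave, ← Complex.exp_add, map_add, Complex.ofReal_add, add_mul]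

lemma re_wave (n : Freq) (x : E3) : (wave n x).re = Real.cos (phase n x) :=
  Complex.exp_ofReal_mul_I_re _


lemma heatKernel_mul_wave {s : ℝ} (n : Freq) (y : E3) :
    (heatKernel s y : ℂ) * wave n (-y) = ((4 * π * s) ^ (-(3 / 2) : ℝ) : ℝ) *
      Complex.exp (-((1 / (4 * s) : ℝ) : ℂ) * (‖y‖ : ℂ) ^ 2
        + (-Complex.I) * ((inner ℝ (freqVec n) y : ℝ) : ℂ)) := by
  rw [heatKernel, wave, inner_freqVec, map_neg, Complex.ofReal_mul, mul_assoc, Complex.ofReal_exp,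
    ← Complex.exp_add]
  congr 2
  push_cast
  ring

lemma integrable_heatKernel_mul_wave {s : ℝ} (hs : 0 < s) (n : Freq) :
    Integrable fun y : E3 => (heatKernel s y : ℂ) * wave n (-y) := by
  simp only [heatKernel_mul_wave]
  exact (GaussianFourier.integrable_cexp_neg_mul_sq_norm_add
    (b := ((1 / (4 * s) : ℝ) : ℂ)) (by rw [Complex.ofReal_re]; positivity) _ _).const_mul _

lemma integrable_heatKernel {s : ℝ} (hs : 0 < s) : Integrable (heatKernel s) := by
  have h := (integrable_heatKernel_mul_wave hs 0).re
  simpa [wave_zero] using h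

lemma integral_heatKernel_mul_wave {s : ℝ} (hs : 0 < s) (n : Freq) :
    ∫ y : E3, (heatKernel s y : ℂ) * wave n (-y) = (rexp (-(s * freqSq n)) : ℝ) := by
  simp only [heatKernel_mul_wave]
  rw [integral_const_mul, GaussianFourier.integral_cexp_neg_mul_sq_norm_add
    (b := ((1 / (4 * s) : ℝ) : ℂ)) (by rw [Complex.ofReal_re]; positivity)]
  have h1 : (π / ((1 / (4 * s) : ℝ) : ℂ)) ^ (Module.finrank ℝ E3 / 2 : ℂ)
      = (((4 * π * s) ^ (3 / 2 : ℝ) : ℝ) : ℂ) := by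
    rw [Complex.ofReal_cpow (by positivity)]
    congr 1
    · push_cast; field_simp
    · simp
  rw [h1, ← mul_assoc, ← Complex.ofReal_mul, ← Real.rpow_add (by positivity)]
  rw [neg_add_cancel, Real.rpow_zero, Complex.ofReal_one, one_mul, ← Complex.ofReal_pow,
    norm_freqVec_sq, Complex.ofReal_exp]
  congr 1
  have : (s : ℂ) ≠ 0 := by exact_mod_cast hs.ne'
  rw [neg_sq, Complex.I_sq]
  push_cast
  field_simp

lemma integral_heatKernel {s : ℝ} (hs : 0 < s) : ∫ y : E3, heatKernel s y = 1 := by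
  have h := integral_heatKernel_mul_wave hs 0
  simp only [wave_zero, mul_one] at h
  rw [integral_complex_ofReal] at h
  have h2 : (0 : ℝ) = freqSq 0 := by simp [freqSq]
  rw [← h2, mul_zero, neg_zero, Real.exp_zero] at h
  exact_mod_cast h

section
variable {F G : Type*} [NormedAddCommGroup F] [NormedSpace ℝ F] [NormedAddCommGroup G]
  [NormedSpace ℝ G]

lemma integrable_heatKernel_smul {s : ℝ} (hs : 0 < s) {v : E3 → F} (hv : Continuous v) {C : ℝ}
    (hC : ∀ x, ‖v x‖ ≤ C) (x : E3) : Integrable fun y => heatKernel s y • v (x - y) :=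
  (integrable_heatKernel hs).smul_bdd C
    (hv.comp (by fun_prop)).aestronglyMeasurable (Eventually.of_forall fun y => hC _)

lemma heatFlow_comp_clm {s : ℝ} (hs : 0 < s) [CompleteSpace F] [CompleteSpace G] (L : F →L[ℝ] G) {v : E3 → F}
    (hv : Continuous v) {C : ℝ}
    (hC : ∀ x, ‖v x‖ ≤ C) (x : E3) : heatFlow s (fun x => L (v x)) x = L (heatFlow s v x) := by
  have h := L.integral_comp_comm (integrable_heatKernel_smul hs hv hC x)
  simp only [map_smul] at h
  exact h

lemma heatFlow_sum {s : ℝ} (hs : 0 < s) {ι : Type*} (t : Finset ι) {v : ι → E3 → F} (hv : ∀ i ∈ t, Continuous (v i))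
    {C : ℝ} (hC : ∀ i ∈ t, ∀ x, ‖v i x‖ ≤ C) (x : E3) :
    heatFlow s (fun x => ∑ i ∈ t, v i x) x = ∑ i ∈ t, heatFlow s (v i) x := by
  rw [heatFlow]
  simp only [Finset.smul_sum]
  exact integral_finsetSum _ fun i hi => integrable_heatKernel_smul hs (hv i hi) (hC i hi) x

lemma heatFlow_wave {s : ℝ} (hs : 0 < s) (n : Freq) (x : E3) :
    heatFlow s (wave n) x = (rexp (-(s * freqSq n)) : ℝ) * wave n x := by
  rw [← integral_heatKernel_mul_wave hs n, ← integral_mul_const]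
  refine integral_congr_ae (Eventually.of_forall fun y => ?_)
  change heatKernel s y • wave n (x - y) = _
  rw [sub_eq_add_neg, wave_add_right, Complex.real_smul]
  ring

lemma heatFlow_cos_smul {s : ℝ} (hs : 0 < s) [CompleteSpace F] (n : Freq) (v : F) (x : E3) :
    heatFlow s (fun x => Real.cos (phase n x) • v) x
      = (rexp (-(s * freqSq n)) * Real.cos (phase n x)) • v := by
  have h := heatFlow_comp_clm hs (Complex.reCLM.smulRight v) (continuous_wave n)
    (fun x => (norm_wave n x).le) x
  rw [heatFlow_wave hs] at h
  simpa [re_wave, -Complex.ofReal_exp] using h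

/-- The heat semigroup acts on Fourier series by damping the coefficients. -/
lemma heatFlow_tsum_wave {s : ℝ} (hs : 0 < s) {c : Freq → ℂ} (hc : Summable fun n => ‖c n‖) (x : E3) :
    heatFlow s (fun x => ∑' n, c n * wave n x) x
      = ∑' n, (rexp (-(s * freqSq n)) * c n) * wave n x := by
  have h1 : ∀ n, Integrable fun y => heatKernel s y • (c n * wave n (x - y)) := fun n =>
    integrable_heatKernel_smul hs (v := fun x => c n * wave n x) (C := ‖c n‖)
      (continuous_const.mul (continuous_wave n))
      (fun x => by rw [norm_mul, norm_wave, mul_one]) x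
  have hn : ∀ n y, ‖heatKernel s y • (c n * wave n (x - y))‖ = ‖c n‖ * heatKernel s y :=
    fun n y => by
      rw [norm_smul, norm_mul, norm_wave, mul_one, norm_of_nonneg (heatKernel_nonneg hs y),
        mul_comm]
  have h2 := hasSum_integral_of_summable_integral_norm h1 (by
    simp only [hn, integral_const_mul, integral_heatKernel hs, mul_one]
    exact hc)
  have h3 : heatFlow s (fun x => ∑' n, c n * wave n x) x
      = ∫ y, ∑' n, heatKernel s y • (c n * wave n (x - y)) := by
    refine integral_congr_ae (Eventually.of_forall fun y => ?_)
    have : Summable fun n => c n * wave n (x - y) :=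
      Summable.of_norm (by simpa [norm_wave] using hc)
    exact (this.tsum_const_smul _).symm
  rw [h3, ← h2.tsum_eq]
  refine tsum_congr fun n => ?_
  have h4 : (∫ y, heatKernel s y • (c n * wave n (x - y))) = c n * heatFlow s (wave n) x := by
    rw [heatFlow, ← integral_const_mul]
    refine integral_congr_ae (Eventually.of_forall fun y => ?_)
    simp only [heatKernel, Complex.real_smul]
    ring
  rw [h4, heatFlow_wave hs]
  ring


end

/-! ### Fourier coefficients and the Besov norm -/

lemma setIntegral_wave (n : Freq) :
    ∫ x in torusCell, wave n x = if n = 0 then ((2 * π) ^ 3 : ℂ) else 0 := by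
  split_ifs with h
  · subst h
    simp only [wave_zero, integral_const, Measure.real, Measure.restrict_apply_univ,
      volume_torusCell]
    rw [ENNReal.toReal_ofReal (by positivity)]
    simp
  · obtain ⟨i, hi⟩ := Function.ne_iff.1 h
    have h1 := setIntegral_pd_eq_zero ((contDiff_wave n).of_le (by exact_mod_cast le_top))
      (wave_periodic n) i
    simp only [pd_wave] at h1
    rw [integral_const_mul] at h1
    refine (mul_eq_zero.1 h1).resolve_left (mul_ne_zero Complex.I_ne_zero ?_)
    exact_mod_cast hi

/-- Fourier coefficients are recovered by integration over the cell. -/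
lemma setIntegral_tsum_wave_mul {c : Freq → ℂ} (hc : Summable fun n => ‖c n‖) (k : Freq) :
    ∫ x in torusCell, (∑' n, c n * wave n x) * wave (-k) x = (2 * π) ^ 3 * c k := by
  have : Fact (volume torusCell < ⊤) := ⟨volume_torusCell_lt_top⟩
  have h1 : ∀ n, Integrable (fun x => c n * wave (n - k) x) (volume.restrict torusCell) :=
    fun n => (continuous_const.mul (continuous_wave _)).integrableOn_torusCell
  have h2 := hasSum_integral_of_summable_integral_norm h1 (by
    simp only [norm_mul, norm_wave, mul_one, integral_const, smul_eq_mul]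
    exact hc.mul_left _)
  have h3 : ∀ x, (∑' n, c n * wave n x) * wave (-k) x = ∑' n, c n * wave (n - k) x := fun x => by
    rw [← tsum_mul_right]
    exact tsum_congr fun n => by rw [sub_eq_add_neg, wave_add, mul_assoc]
  simp only [h3]
  rw [← h2.tsum_eq]
  simp only [integral_const_mul, setIntegral_wave, sub_eq_zero]
  rw [tsum_eq_single k fun n hn => by rw [if_neg hn, mul_zero], if_pos rfl, mul_comm]

/-- Each Fourier coefficient is controlled by the Besov norm. -/
theorem ofReal_norm_coeff_le_besovNorm {c : Freq → ℂ} (hc : Summable fun n => ‖c n‖)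
    {g : E3 → ℝ} (hg : ∀ x, (g x : ℂ) = ∑' n, c n * wave n x) (k : Freq) :
    ENNReal.ofReal (rexp (-freqSq k) * ‖c k‖) ≤ besovNorm g := by
  have hcw : ∀ x, Summable fun n => c n * wave n x := fun x =>
    Summable.of_norm (by simpa [norm_wave] using hc)
  have hgb : ∀ x, ‖g x‖ ≤ ∑' n, ‖c n‖ := fun x => by
    rw [← Complex.norm_real, hg]
    exact tsum_of_norm_bounded hc.hasSum fun n => by rw [norm_mul, norm_wave, mul_one]
  have hgc : Continuous g := by
    have h : Continuous fun x => ∑' n, c n * wave n x :=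
      continuous_tsum (fun n => continuous_const.mul (continuous_wave n)) hc
        fun n x => by rw [norm_mul, norm_wave, mul_one]
    have h2 : g = fun x => (∑' n, c n * wave n x).re := by
      funext x; rw [← hg]; simp
    rw [h2]
    exact Complex.continuous_re.comp h
  -- only the value `s = 1` of the supremum is used
  refine le_trans ?_ (le_iSup₂_of_le (1 : ℝ) one_pos le_rfl)
  rw [Real.sqrt_one, ENNReal.ofReal_one, one_mul]
  by_cases htop : eLpNorm (heatFlow 1 g) ⊤ volume = ⊤
  · rw [htop]; exact le_top
  refine ENNReal.ofReal_le_of_le_toReal ?_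
  set M := (eLpNorm (heatFlow 1 g) ⊤ volume).toReal with hM
  have hbound : ∀ᵐ x ∂volume.restrict torusCell, ‖heatFlow 1 g x‖ ≤ M := by
    refine ae_restrict_of_ae ?_
    filter_upwards [ae_le_eLpNormEssSup (f := heatFlow 1 g) (μ := volume)] with x hx
    rw [hM, ← toReal_enorm, eLpNorm_exponent_top]
    rw [eLpNorm_exponent_top] at htop
    exact ENNReal.toReal_mono htop hx
  have hflow : ∀ x, ((heatFlow 1 g x : ℝ) : ℂ)
      = ∑' n, (rexp (-(1 * freqSq n)) * c n) * wave n x := fun x => by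
    rw [← heatFlow_tsum_wave one_pos hc, ← Complex.ofRealCLM_apply,
      ← heatFlow_comp_clm one_pos Complex.ofRealCLM hgc hgb]
    simp only [Complex.ofRealCLM_apply, hg]
  have hc1 : Summable fun n => ‖(rexp (-(1 * freqSq n)) : ℂ) * c n‖ :=
    Summable.of_nonneg_of_le (fun n => norm_nonneg _) (fun n => by
      rw [norm_mul, Complex.norm_real, norm_of_nonneg (Real.exp_pos _).le]
      refine mul_le_of_le_one_left (norm_nonneg _) (Real.exp_le_one_iff.2 ?_)
      have := freqSq_nonneg n
      linarith) hc
  have hint := setIntegral_tsum_wave_mul hc1 k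
  have hle := norm_setIntegral_le_of_norm_le_const_ae (μ := volume) (s := torusCell) (C := M)
    (f := fun x => (∑' n, (rexp (-(1 * freqSq n)) * c n) * wave n x) * wave (-k) x)
    volume_torusCell_lt_top (by
      filter_upwards [hbound] with x hx
      rw [← hflow, norm_mul, norm_wave, mul_one, Complex.norm_real]
      exact hx)
  rw [hint, Measure.real, volume_torusCell, ENNReal.toReal_ofReal (by positivity), norm_mul,
    norm_mul, Complex.norm_real, norm_of_nonneg (Real.exp_pos _).le, one_mul, mul_comm M] at hle
  have h8 : ‖((2 * π) ^ 3 : ℂ)‖ = (2 * π) ^ 3 := by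
    rw [norm_pow, norm_mul, Complex.norm_real, norm_of_nonneg pi_pos.le]
    simp
  rw [h8] at hle
  exact le_of_mul_le_mul_left hle (by positivity)

/-- A uniform bound for the caloric extension of a superposition of plane waves bounds its Besov
norm. -/
theorem besovNorm_sum_cos_le {F ι : Type*} [NormedAddCommGroup F] [NormedSpace ℝ F]
    [CompleteSpace F] (t : Finset ι) (n : ι → Freq) (v : ι → F) {M : ℝ}
    (hM : ∀ s : ℝ, 0 < s → √s * ∑ j ∈ t, rexp (-(s * freqSq (n j))) * ‖v j‖ ≤ M) :
    besovNorm (fun x => ∑ j ∈ t, Real.cos (phase (n j) x) • v j) ≤ ENNReal.ofReal M := by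
  refine iSup₂_le fun s hs => ?_
  have hflow : ∀ x, ‖heatFlow s (fun x => ∑ j ∈ t, Real.cos (phase (n j) x) • v j) x‖
      ≤ ∑ j ∈ t, rexp (-(s * freqSq (n j))) * ‖v j‖ := fun x => by
    rw [heatFlow_sum hs t (C := ∑ j ∈ t, ‖v j‖) (fun j _ => by fun_prop) (fun j hj x => by
      rw [norm_smul]
      exact (mul_le_of_le_one_left (norm_nonneg _) (Real.abs_cos_le_one _)).trans
        (Finset.single_le_sum (f := fun j => ‖v j‖) (fun _ _ => norm_nonneg _) hj))]
    refine norm_sum_le_of_le _ fun j _ => ?_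
    rw [heatFlow_cos_smul hs, norm_smul, norm_mul, norm_of_nonneg (Real.exp_pos _).le]
    exact mul_le_mul_of_nonneg_right (mul_le_of_le_one_right (Real.exp_pos _).le
      (Real.abs_cos_le_one _)) (norm_nonneg _)
  have h1 : eLpNorm (heatFlow s fun x => ∑ j ∈ t, Real.cos (phase (n j) x) • v j) ⊤ volume
      ≤ ENNReal.ofReal (∑ j ∈ t, rexp (-(s * freqSq (n j))) * ‖v j‖) := by
    rw [eLpNorm_exponent_top]
    exact eLpNormEssSup_le_of_ae_bound (Eventually.of_forall hflow)
  refine (mul_le_mul_right h1 _).trans ?_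
  rw [← ENNReal.ofReal_mul (Real.sqrt_nonneg s)]
  exact ENNReal.ofReal_le_ofReal (hM s hs)

/-- The inclusion of the horizontal plane into `ℝ³`. -/
noncomputable def horizIncl : EuclideanSpace ℝ (Fin 2) →ₗᵢ[ℝ] E3 where
  toFun w := !₂[w 0, w 1, 0]
  map_add' w z := by ext i; fin_cases i <;> simp
  map_smul' r w := by ext i; fin_cases i <;> simp
  norm_map' w := by simp [EuclideanSpace.norm_eq, Fin.sum_univ_three, Fin.sum_univ_two]

/-- A vector field with vanishing third component has the norm of its horizontal part. -/
lemma besovNorm_horiz {v : E3 → E3} (hv : ∀ x, v x 2 = 0) :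
    besovNorm (fun x => horiz (v x)) = besovNorm v := by
  have h1 : ∀ x, horizIncl (horiz (v x)) = v x := fun x => by
    ext i; fin_cases i <;> simp [horizIncl, horiz, hv]
  have h2 : ∀ s x, heatFlow s v x = horizIncl (heatFlow s (fun x => horiz (v x)) x) := fun s x => by
    have := horizIncl.integral_comp_comm (μ := volume) fun y : E3 =>
      ((4 * π * s) ^ (-(3 / 2) : ℝ) * Real.exp (-‖y‖ ^ 2 / (4 * s))) • horiz (v (x - y))
    simp only [map_smul, h1] at this
    exact this
  refine iSup_congr fun s => iSup_congr fun _ => ?_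
  congr 1
  refine eLpNorm_congr_norm_ae (Eventually.of_forall fun x => ?_)
  rw [h2, horizIncl.norm_map]

/-! ### Finite superpositions of plane waves -/

/-- The frequency `n` or `-n`. -/
def signedFreq (σ : Bool) (n : Freq) : Freq := if σ then n else -n

section planeWaves
variable {ι : Type*} (t : Finset ι) (n : ι → Freq) (v : ι → E3)

/-- The vector field `∑ⱼ cos(nⱼ · x) vⱼ`. -/
noncomputable def planeWaves (x : E3) : E3 := ∑ j ∈ t, Real.cos (phase (n j) x) • v j

/-- The Fourier coefficients of the `l`-th component of `planeWaves`. -/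
noncomputable def planeWaveCoeff (l : Fin 3) (m : Freq) : ℂ :=
  ∑ p ∈ t ×ˢ (Finset.univ : Finset Bool),
    if m = signedFreq p.2 (n p.1) then ((v p.1 l / 2 : ℝ) : ℂ) else 0

lemma planeWaves_apply (x : E3) (i : Fin 3) :
    planeWaves t n v x i = ∑ j ∈ t, Real.cos (phase (n j) x) * v j i := by
  simp [planeWaves]

lemma cos_phase_periodic (m : Freq) : TorusPeriodic fun x => Real.cos (phase m x) := fun i x => by
  simp only [← re_wave, wave_periodic m i x]

lemma setIntegral_cos_phase {m : Freq} (hm : m ≠ 0) :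
    ∫ x in torusCell, Real.cos (phase m x) = 0 := by
  have h1 : IntegrableOn (wave m) torusCell := (continuous_wave m).integrableOn_torusCell
  have h2 := Complex.reCLM.integral_comp_comm h1
  rw [setIntegral_wave, if_neg hm] at h2
  simpa [re_wave] using h2

lemma contDiff_planeWaves : ContDiff ℝ ∞ (planeWaves t n v) :=
  ContDiff.sum fun j _ => (Real.contDiff_cos.comp (phase (n j)).contDiff).smul contDiff_const

lemma isAdmissibleDatum_planeWaves (h0 : ∀ j ∈ t, n j ≠ 0)
    (hdiv : ∀ j ∈ t, ∑ i, (n j i : ℝ) * v j i = 0) (h2 : ∀ j ∈ t, v j 2 = 0) :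
    IsAdmissibleDatum (planeWaves t n v) := by
  refine ⟨fun i x => ?_, contDiff_planeWaves t n v, ?_, fun x => ?_, fun x => ?_⟩
  · exact Finset.sum_congr rfl fun j _ => by
      simp only [(cos_phase_periodic (n j) i x : Real.cos (phase (n j) (x + _)) = _)]
  · simp only [planeWaves]
    rw [integral_finsetSum _ fun j _ => (by fun_prop :
      Continuous fun x => Real.cos (phase (n j) x) • v j).integrableOn_torusCell]
    refine Finset.sum_eq_zero fun j hj => ?_
    rw [integral_smul_const, setIntegral_cos_phase (h0 j hj), zero_smul]
  · have hd : ∀ j ∈ t, HasFDerivAt (fun x => Real.cos (phase (n j) x) • v j)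
        ((-Real.sin (phase (n j) x) • phase (n j)).smulRight (v j)) x := fun j _ =>
      ((Real.hasDerivAt_cos _).comp_hasFDerivAt x (phase (n j)).hasFDerivAt).smul_const (v j)
    have h := HasFDerivAt.fun_sum hd
    rw [vdiv]
    have e : fderiv ℝ (planeWaves t n v) x = _ := h.fderiv
    rw [e]
    simp only [sum_apply, ContinuousLinearMap.smulRight_apply, smul_apply, phase_single,
      WithLp.ofLp_sum, Finset.sum_apply, PiLp.smul_apply, smul_eq_mul, mul_one]
    rw [Finset.sum_comm]
    refine Finset.sum_eq_zero fun j hj => ?_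
    have := hdiv j hj
    simp only [mul_assoc, ← Finset.mul_sum, this, mul_zero]
  · rw [planeWaves_apply]
    exact Finset.sum_eq_zero fun j hj => by rw [h2 j hj, mul_zero]

lemma norm_planeWaveCoeff_le (l : Fin 3) (m : Freq) :
    ‖planeWaveCoeff t n v l m‖ ≤ ∑ p ∈ t ×ˢ (Finset.univ : Finset Bool),
      if m = signedFreq p.2 (n p.1) then |v p.1 l| / 2 else 0 := by
  refine norm_sum_le_of_le _ fun p _ => ?_
  split_ifs
  · rw [Complex.norm_real, Real.norm_eq_abs, abs_div, abs_two]
  · simp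

lemma finite_support_planeWaveCoeff (l : Fin 3) :
    (Function.support (planeWaveCoeff t n v l)).Finite := by
  refine ((t ×ˢ (Finset.univ : Finset Bool)).image fun p => signedFreq p.2 (n p.1)).finite_toSet.subset
    fun m hm => ?_
  obtain ⟨p, hp, hpm⟩ := Finset.exists_ne_zero_of_sum_ne_zero hm
  rw [Finset.mem_coe, Finset.mem_image]
  refine ⟨p, hp, ?_⟩
  by_contra h
  exact hpm (if_neg fun h' => h h'.symm)

lemma summable_mul_norm_planeWaveCoeff (w : Freq → ℝ) (l : Fin 3) :
    Summable fun m => w m * ‖planeWaveCoeff t n v l m‖ :=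
  summable_of_hasFiniteSupport <| (finite_support_planeWaveCoeff t n v l).subset fun m hm => by
    rw [Function.mem_support] at hm ⊢
    exact fun h => hm (by rw [h, norm_zero, mul_zero])

lemma summable_norm_planeWaveCoeff (l : Fin 3) :
    Summable fun m => ‖planeWaveCoeff t n v l m‖ := by
  simpa using summable_mul_norm_planeWaveCoeff t n v (fun _ => 1) l

lemma tsum_norm_planeWaveCoeff_le (l : Fin 3) :
    ∑' m, ‖planeWaveCoeff t n v l m‖ ≤ ∑ j ∈ t, |v j l| := by
  have h1 : ∀ p ∈ t ×ˢ (Finset.univ : Finset Bool), HasSum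
      (fun m => if m = signedFreq p.2 (n p.1) then |v p.1 l| / 2 else 0) (|v p.1 l| / 2) :=
    fun p _ => by convert hasSum_ite_eq (signedFreq p.2 (n p.1)) (|v p.1 l| / 2)
  have h2 := hasSum_sum h1
  refine (Summable.tsum_le_tsum (norm_planeWaveCoeff_le t n v l)
    (summable_norm_planeWaveCoeff t n v l) h2.summable).trans (le_of_eq ?_)
  rw [h2.tsum_eq, Finset.sum_product]
  refine Finset.sum_congr rfl fun j _ => ?_
  rw [Fintype.sum_bool]
  ring

/-- Summation of a series weighted by the coefficients of a superposition of plane waves. -/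
lemma tsum_planeWaveCoeff_mul (l : Fin 3) (w : Freq → ℂ) :
    ∑' m, planeWaveCoeff t n v l m * w m
      = ∑ p ∈ t ×ˢ (Finset.univ : Finset Bool),
          ((v p.1 l / 2 : ℝ) : ℂ) * w (signedFreq p.2 (n p.1)) := by
  have h1 : ∀ p ∈ t ×ˢ (Finset.univ : Finset Bool), HasSum
      (fun m => (if m = signedFreq p.2 (n p.1) then ((v p.1 l / 2 : ℝ) : ℂ) else 0) * w m)
      (((v p.1 l / 2 : ℝ) : ℂ) * w (signedFreq p.2 (n p.1))) := fun p _ => by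
    convert hasSum_single (signedFreq p.2 (n p.1)) _ using 1
    · simp
    · intro m hm
      rw [if_neg hm, zero_mul]
  rw [← (hasSum_sum h1).tsum_eq]
  simp only [planeWaveCoeff, Finset.sum_mul]

lemma tsum_planeWaveCoeff_wave (l : Fin 3) (x : E3) :
    ∑' m, planeWaveCoeff t n v l m * wave m x = ((planeWaves t n v x l : ℝ) : ℂ) := by
  rw [tsum_planeWaveCoeff_mul, Finset.sum_product, planeWaves_apply, Complex.ofReal_sum]
  refine Finset.sum_congr rfl fun j _ => ?_
  rw [Fintype.sum_bool]
  simp only [signedFreq, if_true, Bool.false_eq_true, if_false, wave_neg]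
  rw [← mul_add, Complex.add_conj, re_wave]
  push_cast
  ring

lemma star_planeWaveCoeff_neg (l : Fin 3) (m : Freq) :
    star (planeWaveCoeff t n v l (-m)) = planeWaveCoeff t n v l m := by
  rw [planeWaveCoeff, planeWaveCoeff, star_sum, Finset.sum_product, Finset.sum_product]
  refine Finset.sum_congr rfl fun j _ => ?_
  rw [Fintype.sum_bool, Fintype.sum_bool, add_comm]
  simp only [signedFreq, if_true, Bool.false_eq_true, if_false, apply_ite star, star_zero,
    RCLike.star_def, Complex.conj_ofReal, neg_eq_iff_eq_neg, neg_neg]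

lemma sum_mul_planeWaveCoeff (hdiv : ∀ j ∈ t, ∑ i, (n j i : ℝ) * v j i = 0) (m : Freq) :
    ∑ l, ((m l : ℤ) : ℂ) * planeWaveCoeff t n v l m = 0 := by
  simp only [planeWaveCoeff, Finset.mul_sum]
  rw [Finset.sum_comm]
  refine Finset.sum_eq_zero fun p hp => ?_
  by_cases h : m = signedFreq p.2 (n p.1)
  · have h2 : ∑ l, (m l : ℝ) * v p.1 l = 0 := by
      have h3 := hdiv p.1 (Finset.mem_product.1 hp).1
      rw [h, signedFreq]
      split_ifs
      · exact h3
      · simp only [Pi.neg_apply, Int.cast_neg, neg_mul, Finset.sum_neg_distrib, h3, neg_zero]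
    simp only [if_pos h]
    have h4 := congrArg (fun r : ℝ => (r : ℂ) / 2) h2
    simp only [Complex.ofReal_sum, Finset.sum_div, Complex.ofReal_zero, zero_div] at h4
    rw [← h4]
    refine Finset.sum_congr rfl fun l _ => ?_
    push_cast
    ring
  · simp only [if_neg h, mul_zero, Finset.sum_const_zero]

lemma planeWaveCoeff_eq_zero {l : Fin 3} {m : Freq}
    (h : ∀ j ∈ t, m ≠ n j ∧ m ≠ -n j) : planeWaveCoeff t n v l m = 0 := by
  refine Finset.sum_eq_zero fun p hp => if_neg ?_
  have := h p.1 (Finset.mem_product.1 hp).1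
  rw [signedFreq]
  split_ifs
  · exact this.1
  · exact this.2

/-- The interactions of two superpositions of decaying plane waves. -/
lemma conv_planeWaveCoeff (l k : Fin 3) (w : Freq → ℂ) (κ : Freq) :
    conv (fun m => planeWaveCoeff t n v l m * w m) (fun m => planeWaveCoeff t n v k m * w m) κ
      = ∑ p ∈ t ×ˢ (Finset.univ : Finset Bool), ∑ q ∈ t ×ˢ (Finset.univ : Finset Bool),
        if signedFreq p.2 (n p.1) + signedFreq q.2 (n q.1) = κ then
          ((v p.1 l / 2 * (v q.1 k / 2) : ℝ) : ℂ) * (w (signedFreq p.2 (n p.1))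
            * w (signedFreq q.2 (n q.1))) else 0 := by
  simp only [conv, mul_assoc]
  rw [tsum_planeWaveCoeff_mul t n v l
    (fun m => w m * (planeWaveCoeff t n v k (κ - m) * w (κ - m)))]
  refine Finset.sum_congr rfl fun p _ => ?_
  rw [planeWaveCoeff, Finset.sum_mul, Finset.mul_sum, Finset.mul_sum]
  refine Finset.sum_congr rfl fun q _ => ?_
  by_cases h : signedFreq p.2 (n p.1) + signedFreq q.2 (n q.1) = κ
  · have h' : κ - signedFreq p.2 (n p.1) = signedFreq q.2 (n q.1) := by rw [← h]; abel
    rw [if_pos h, h', if_pos rfl]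
    push_cast
    ring
  · have h' : ¬ κ - signedFreq p.2 (n p.1) = signedFreq q.2 (n q.1) := fun e => h (by
      rw [← e]; abel)
    rw [if_neg h, if_neg h']
    simp

end planeWaves

/-! ### Solutions with plane wave data -/

lemma duhamel_apply_zero {T : ℝ} (hT : 0 ≤ T) (γ : ℝ) (c : TimeFn) : duhamel T γ c 0 = 0 := by
  rw [duhamel_apply, timeClamp_of_mem ⟨le_rfl, hT⟩, intervalIntegral.integral_same, mul_zero]

lemma nsDuhamel_apply_zero {T : ℝ} (hT : 0 ≤ T) (ν μ : ℝ) (c : Fin 3 → Fin 3 → Freq → TimeFn)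
    (i : Fin 3) (n : Freq) : nsDuhamel ν μ T c i n 0 = 0 := by
  simp [nsDuhamel, duhamel_apply_zero hT]

lemma heatFam_apply_zero {T : ℝ} (hT : 0 ≤ T) (ν : ℝ) (a : Freq → ℂ) (n : Freq) :
    heatFam ν T a n 0 = a n := by
  simp [heatFam, expWeight_apply, timeClamp_of_mem (⟨le_rfl, hT⟩ : (0 : ℝ) ∈ Icc 0 T)]

/-- The quadratic Duhamel term is divergence-free. -/
lemma sum_derivFam_nsDuhamel (ν μ T : ℝ) (c : Fin 3 → Fin 3 → Freq → TimeFn) (n : Freq) :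
    ∑ i, (Complex.I * ((n i : ℤ) : ℂ)) • nsDuhamel ν μ T c i n = 0 := by
  simp only [nsDuhamel, Finset.smul_sum, smul_smul]
  rw [Finset.sum_comm]
  refine Finset.sum_eq_zero fun k _ => ?_
  rw [Finset.sum_comm]
  refine Finset.sum_eq_zero fun l _ => ?_
  rw [← Finset.sum_smul]
  have h := congrArg (fun r : ℝ => (r : ℂ)) (sum_mul_lerayMult k l n)
  simp only [Complex.ofReal_sum, Complex.ofReal_zero] at h
  have h2 : ∑ i, Complex.I * ((n i : ℤ) : ℂ) * (-Complex.I * (lerayMult i k l n : ℂ))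
      = ∑ i, (((n i : ℝ) * lerayMult i k l n : ℝ) : ℂ) := by
    refine Finset.sum_congr rfl fun i _ => ?_
    push_cast
    linear_combination (-(n i : ℂ) * (lerayMult i k l n : ℂ)) * Complex.I_sq
  rw [h2, h, zero_smul]

lemma norm_conv_add_sub_le {a b c d : Freq → TimeFn} (ha : Summable fun n => ‖a n‖)
    (hb : Summable fun n => ‖b n‖) (hc : Summable fun n => ‖c n‖) (hd : Summable fun n => ‖d n‖)
    {C ρ : ℝ} (haC : ∑' n, ‖a n‖ ≤ C) (hcC : ∑' n, ‖c n‖ ≤ C) (hbρ : ∑' n, ‖b n‖ ≤ ρ)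
    (hdρ : ∑' n, ‖d n‖ ≤ ρ) (n : Freq) :
    ‖conv (a + b) (c + d) n - conv a c n‖ ≤ 2 * C * ρ + ρ ^ 2 := by
  have hcd : Summable fun n => ‖(c + d) n‖ :=
    Summable.of_nonneg_of_le (fun _ => norm_nonneg _) (fun n => norm_add_le _ _) (hc.add hd)
  have e : conv (a + b) (c + d) n - conv a c n = conv a d n + conv b c n + conv b d n := by
    rw [conv_add_left ha hb hcd, conv_add_right hc hd ha, conv_add_right hc hd hb]
    simp only [Pi.add_apply]
    abel
  have h0 : ∀ f : Freq → TimeFn, 0 ≤ ∑' n, ‖f n‖ := fun f => tsum_nonneg fun _ => norm_nonneg _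
  rw [e]
  have h1 := (norm_conv_le_mul ha hd n).trans (mul_le_mul haC hdρ (h0 d) ((h0 a).trans haC))
  have h2 := (norm_conv_le_mul hb hc n).trans (mul_le_mul hbρ hcC (h0 c) ((h0 b).trans hbρ))
  have h3 := (norm_conv_le_mul hb hd n).trans (mul_le_mul hbρ hdρ (h0 d) ((h0 b).trans hbρ))
  refine norm_add₃_le.trans ?_
  linarith

section planeWaves
variable {ι : Type*} {t : Finset ι} {n : ι → Freq} {v : ι → E3}

/-- The first two components of all frequencies present being bounded by `1`, and the third
component of the field being zero, the Duhamel term loses no derivative. -/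
lemma tsum_norm_nsDuhamel_planeWaves_le {ν μ T C : ℝ} (hν : 0 ≤ ν) (hμ : 0 ≤ μ) (hT : 0 ≤ T)
    (h2 : ∀ j ∈ t, v j 2 = 0) (hn : ∀ j ∈ t, ∀ l, l ≠ 2 → |n j l| ≤ 1)
    (U : Fin 3 → Freq → TimeFn) (hU : ∀ l, U l = heatFam ν T (planeWaveCoeff t n v l))
    (hUs : ∀ l, Summable fun m => ‖U l m‖) (hUC : ∀ l, ∑' m, ‖U l m‖ ≤ C) (i : Fin 3) :
    ∑' m, ‖nsDuhamel ν μ T (fun l k m => expWeight T (-μ) * conv (U l) (U k) m) i m‖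
      ≤ 36 * T * C ^ 2 := by
  -- for `l ≠ 2` the frequencies of `U` have `|m l| ≤ 1`, those of the convolutions `|m l| ≤ 2`
  have hsupp : ∀ l, l ≠ 2 → ∀ k m, U k m ≠ 0 → |m l| ≤ 1 := by
    intro l hl k m hm
    by_contra hml
    refine hm ?_
    rw [hU, heatFam, planeWaveCoeff_eq_zero t n v fun j hj => ⟨?_, ?_⟩, zero_smul]
    · rintro rfl
      exact hml (hn j hj l hl)
    · rintro rfl
      exact hml (by simpa using hn j hj l hl)
  have hU2 : U 2 = 0 := by
    funext m
    rw [hU, heatFam]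
    have : planeWaveCoeff t n v 2 m = 0 := Finset.sum_eq_zero fun p hp => by
      rw [h2 p.1 (Finset.mem_product.1 hp).1]
      simp
    rw [this, zero_smul]
    rfl
  have hC0 : 0 ≤ C := (tsum_nonneg fun _ => norm_nonneg _).trans (hUC 0)
  have hconv : ∀ k l m, |(m l : ℝ)| * ‖conv (U l) (U k) m‖ ≤ 2 * ‖conv (U l) (U k) m‖ := by
    intro k l m
    by_cases hl : l = 2
    · rw [hl, hU2]
      simp [conv]
    · by_cases hml : |m l| ≤ 2
      · exact mul_le_mul_of_nonneg_right (by exact_mod_cast hml) (norm_nonneg _)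
      · have : conv (U l) (U k) m = 0 := by
          rw [conv]
          convert tsum_zero with j
          by_contra h
          have h1 := hsupp l hl l j (left_ne_zero_of_mul h)
          have h3 := hsupp l hl k (m - j) (right_ne_zero_of_mul h)
          rw [Pi.sub_apply] at h3
          rw [abs_le] at h1 h3
          exact hml (abs_le.2 ⟨by linarith, by linarith⟩)
        rw [this, norm_zero, mul_zero, mul_zero]
  have hterm : ∀ m, ‖nsDuhamel ν μ T (fun l k m => expWeight T (-μ) * conv (U l) (U k) m) i m‖
      ≤ ∑ k, ∑ l, 4 * T * ‖conv (U l) (U k) m‖ := by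
    intro m
    refine (norm_nsDuhamel_le_mul hν hμ hT _ i m).trans ?_
    refine Finset.sum_le_sum fun k _ => Finset.sum_le_sum fun l _ => ?_
    have h1 : ‖expWeight T (-μ) * conv (U l) (U k) m‖ ≤ ‖conv (U l) (U k) m‖ :=
      (norm_mul_le _ _).trans (mul_le_of_le_one_left (norm_nonneg _)
        (expWeight_norm_le_one (by linarith)))
    calc 2 * |(m l : ℝ)| * (T * ‖expWeight T (-μ) * conv (U l) (U k) m‖)
        ≤ 2 * |(m l : ℝ)| * (T * ‖conv (U l) (U k) m‖) := by gcongr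
      _ = 2 * T * (|(m l : ℝ)| * ‖conv (U l) (U k) m‖) := by ring
      _ ≤ 2 * T * (2 * ‖conv (U l) (U k) m‖) :=
        mul_le_mul_of_nonneg_left (hconv k l m) (by positivity)
      _ = _ := by ring
  have hs : ∀ k ∈ Finset.univ, ∀ l ∈ Finset.univ,
      Summable fun m => 4 * T * ‖conv (U l) (U k) m‖ := fun k _ l _ =>
    (summable_norm_conv (hUs l) (hUs k)).mul_left _
  have hs' : Summable fun m => ∑ k, ∑ l, 4 * T * ‖conv (U l) (U k) m‖ :=
    summable_sum fun k hk => summable_sum (hs k hk)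
  refine (Summable.tsum_le_tsum hterm (Summable.of_nonneg_of_le (fun _ => norm_nonneg _) hterm hs')
    hs').trans ?_
  rw [Summable.tsum_finsetSum fun k hk => summable_sum (hs k hk)]
  have h9 : ∀ k ∈ (Finset.univ : Finset (Fin 3)),
      ∑' m, ∑ l, 4 * T * ‖conv (U l) (U k) m‖ ≤ 12 * T * C ^ 2 := by
    intro k hk
    rw [Summable.tsum_finsetSum (hs k hk)]
    have h3 : ∀ l ∈ (Finset.univ : Finset (Fin 3)),
        ∑' m, 4 * T * ‖conv (U l) (U k) m‖ ≤ 4 * T * C ^ 2 := by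
      intro l _
      rw [tsum_mul_left]
      refine mul_le_mul_of_nonneg_left ((tsum_norm_conv_le (hUs l) (hUs k)).trans ?_)
        (by positivity)
      rw [sq]
      exact mul_le_mul (hUC l) (hUC k) (tsum_nonneg fun _ => norm_nonneg _) hC0
    refine (Finset.sum_le_sum h3).trans (le_of_eq ?_)
    simp
    ring
  refine (Finset.sum_le_sum h9).trans (le_of_eq ?_)
  simp
  ring

/-- Small superpositions of plane waves with `|n₁|, |n₂| ≤ 1` evolve, on the time interval
`(0, Th)`, into smooth solutions whose low modes are given by the heat flow and its
self-interaction, up to a small error. -/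
theorem exists_solution_planeWaves {ν μ Th C : ℝ} (hν : 0 < ν) (hμ : 0 < μ) (hTh : 0 ≤ Th)
    (hdiv : ∀ j ∈ t, ∑ i, (n j i : ℝ) * v j i = 0)
    (h2 : ∀ j ∈ t, v j 2 = 0) (hn : ∀ j ∈ t, ∀ l, l ≠ 2 → |n j l| ≤ 1)
    (hC : ∀ l, ∑ j ∈ t, |v j l| ≤ C) (hsmall : 18 * (1 / √(ν * μ)) * C ≤ 1 / 2)
    (hsmall' : 9 * (1 / √(ν * μ)) * rexp (μ * Th) * (144 * Th * C ^ 2) ≤ 1 / 8)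
    (U : Fin 3 → Freq → TimeFn) (hU : ∀ l, U l = heatFam ν Th (planeWaveCoeff t n v l)) :
    ∃ a : Fin 3 → Freq → TimeFn, (∀ m i, SmoothFam Th m (a i)) ∧
      (∀ i m, ∀ s ∈ Ioo 0 Th, HasDerivAt (a i m) (nsVelocity ν a i m s) s) ∧
      (∀ i, reflectFam (a i) = a i) ∧ (∀ m, ∑ l, derivFam l (a l) m = 0) ∧
      velocity a 0 = planeWaves t n v ∧
      ∀ i m, (∀ l, |m l| ≤ 2) →
        ‖a i m - (U i m + nsDuhamel ν 0 Th (fun l k => conv (U l) (U k)) i m)‖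
          ≤ 36 * Th * (2 * C * (rexp (μ * Th) * (144 * Th * C ^ 2))
            + (rexp (μ * Th) * (144 * Th * C ^ 2)) ^ 2) := by
  have hUle : ∀ l m, ‖U l m‖ ≤ ‖planeWaveCoeff t n v l m‖ := fun l m => by
    rw [hU]
    exact norm_heatFam_le hν.le _ _ _
  have hcs := fun l => summable_norm_planeWaveCoeff t n v l
  have hUs : ∀ l, Summable fun m => ‖U l m‖ := fun l =>
    Summable.of_nonneg_of_le (fun _ => norm_nonneg _) (hUle l) (hcs l)
  have hUC : ∀ l, ∑' m, ‖U l m‖ ≤ C := fun l =>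
    ((hUs l).tsum_le_tsum (hUle l) (hcs l)).trans
      ((tsum_norm_planeWaveCoeff_le t n v l).trans (hC l))
  have hUr : ∀ l m, star (U l (-m)) = U l m := fun l m => by
    rw [hU, heatFam, heatFam, star_smul, star_expWeight, freqSq_neg, star_planeWaveCoeff_neg]
  obtain ⟨W, hWs, hWR, hWr, hW⟩ := exists_mild_correction hν hμ hTh U hUs hUC hUr hsmall
    (R := 144 * Th * C ^ 2) (by positivity) (fun i => by
      refine (tsum_norm_nsDuhamel_planeWaves_le hν.le hμ.le hTh h2 hn U hU hUs hUC i).trans ?_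
      linarith) hsmall'
  have hmild : ∀ i m, (U i + W i) m = heatFam ν Th (planeWaveCoeff t n v i) m
      + nsDuhamel ν 0 Th (fun l k => conv (U l + W l) (U k + W k)) i m := fun i m => by
    rw [Pi.add_apply, hW, hU i]
  have has : ∀ i, Summable fun m => ‖(U i + W i) m‖ := fun i =>
    Summable.of_nonneg_of_le (fun _ => norm_nonneg _) (fun m => norm_add_le _ _)
      ((hUs i).add (hWs i))
  refine ⟨fun i => U i + W i, ?_, ?_, ?_, ?_, ?_, ?_⟩
  · exact smoothFam_of_mild hν (fun i k => summable_mul_norm_planeWaveCoeff t n v _ i) has hmild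
  · exact fun i m s hs => hasDerivAt_of_mild (a := fun i => U i + W i) hmild i m hs
  · intro i
    funext m
    change star (U i (-m) + W i (-m)) = U i m + W i m
    rw [star_add, hUr, hWr]
  · intro m
    have h1 := sum_derivFam_nsDuhamel ν 0 Th (fun l k => conv (U l + W l) (U k + W k)) m
    have h3 : ∑ l, (Complex.I * ((m l : ℤ) : ℂ)) • heatFam ν Th (planeWaveCoeff t n v l) m = 0 := by
      simp only [heatFam, smul_smul, ← Finset.sum_smul, mul_assoc, ← Finset.mul_sum]
      rw [sum_mul_planeWaveCoeff t n v hdiv, mul_zero, zero_smul]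
    simp only [derivFam, hmild, smul_add, Finset.sum_add_distrib]
    rw [h1, h3, add_zero]
  · funext x
    ext i
    simp only [velocity, synth, hmild, BoundedContinuousFunction.coe_add, Pi.add_apply,
      nsDuhamel_apply_zero hTh, heatFam_apply_zero hTh, add_zero]
    rw [tsum_planeWaveCoeff_wave, Complex.ofReal_re]
  · intro i m hm
    have e : (U i + W i) m - (U i m + nsDuhamel ν 0 Th (fun l k => conv (U l) (U k)) i m)
        = nsDuhamel ν 0 Th (fun l k m => conv (U l + W l) (U k + W k) m
          - conv (U l) (U k) m) i m := by
      rw [nsDuhamel_sub, Pi.add_apply, hW i m]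
      abel
    rw [e]
    refine (norm_nsDuhamel_le_mul hν.le le_rfl hTh _ i m).trans ?_
    have h3 : ∀ k ∈ (Finset.univ : Finset (Fin 3)), ∀ l ∈ (Finset.univ : Finset (Fin 3)),
        2 * |(m l : ℝ)| * (Th * ‖conv (U l + W l) (U k + W k) m - conv (U l) (U k) m‖)
          ≤ 2 * 2 * (Th * (2 * C * (rexp (μ * Th) * (144 * Th * C ^ 2))
            + (rexp (μ * Th) * (144 * Th * C ^ 2)) ^ 2)) := by
      intro k _ l _
      have h4 := norm_conv_add_sub_le (hUs l) (hWs l) (hUs k) (hWs k) (hUC l) (hUC k) (hWR l)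
        (hWR k) m
      have h5 : |(m l : ℝ)| ≤ 2 := by exact_mod_cast hm l
      gcongr
    refine (Finset.sum_le_sum fun k hk => Finset.sum_le_sum (h3 k hk)).trans (le_of_eq ?_)
    simp
    ring

end planeWaves

/-! ### Velocity fields with summable coefficients -/

section velocity
variable {a : Fin 3 → Freq → TimeFn}

lemma continuous_velocity (ha : ∀ i, Summable fun n => ‖a i n‖) :
    Continuous fun z : ℝ × E3 => velocity a z.1 z.2 :=
  (PiLp.continuous_toLp 2 _).comp
    (continuous_pi fun i => Complex.continuous_re.comp (continuous_synth (ha i)))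

lemma exists_abs_pd_velocity_le {Th T : ℝ} (hTh : T < Th) (hsm : ∀ m i, SmoothFam Th m (a i)) :
    ∃ G : ℝ, ∀ t ∈ Ioc 0 T, ∀ x i l, |pd l (fun y => velocity a t y i) x| ≤ G := by
  refine ⟨∑ i, ∑ l, ∑' n, ‖derivFam l (a i) n‖, fun t ht x i l => ?_⟩
  have h1 : pd l (fun y => velocity a t y i) x = (synth (derivFam l (a i)) (t, x)).re :=
    congrFun (pd_re_synth (hsm 1 i) ⟨ht.1, ht.2.trans_lt hTh⟩ l) x
  have h2 := norm_synth_le ((hsm 0 i).rapidDecay.derivFam l).summable (t, x)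
  have h0 : ∀ i l, 0 ≤ ∑' n, ‖derivFam l (a i) n‖ := fun i l => tsum_nonneg fun _ => norm_nonneg _
  rw [h1]
  refine ((Complex.abs_re_le_norm _).trans h2).trans ?_
  refine (Finset.single_le_sum (f := fun l => ∑' n, ‖derivFam l (a i) n‖)
    (fun l _ => h0 i l) (Finset.mem_univ l)).trans ?_
  exact Finset.single_le_sum (f := fun i => ∑ l, ∑' n, ‖derivFam l (a i) n‖)
    (fun i _ => Finset.sum_nonneg fun l _ => h0 i l) (Finset.mem_univ i)

/-- A single mode of the component of a velocity field in the direction `e` bounds its Besov norm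
from below. -/
lemma ofReal_norm_mode_le_besovNorm (ha : ∀ i, Summable fun n => ‖a i n‖)
    (hreal : ∀ i, reflectFam (a i) = a i) (t : ℝ) (e : E3) (m : Freq) :
    ENNReal.ofReal (rexp (-freqSq m) * ‖∑ i, (e i : ℂ) * a i m t‖)
      ≤ besovNorm fun x => inner ℝ (velocity a t x) e := by
  have hs : ∀ i, Summable fun n => ‖a i n t‖ := fun i => summable_norm_apply (ha i) t
  refine ofReal_norm_coeff_le_besovNorm (c := fun m => ∑ i, (e i : ℂ) * a i m t) ?_ (fun x => ?_) m
  · refine Summable.of_nonneg_of_le (fun _ => norm_nonneg _)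
      (fun n => norm_sum_le _ _) (summable_sum fun i _ => ?_)
    simp only [norm_mul]
    exact (hs i).mul_left _
  · have h1 : ∀ i, Summable fun n => (e i : ℂ) * (a i n t * wave n x) := fun i =>
      (summable_synth (ha i) (t, x)).mul_left _
    have h2 : ∀ i, (((velocity a t x) i : ℝ) : ℂ) = ∑' n, a i n t * wave n x := fun i =>
      synth_real (hreal i) (t, x)
    rw [PiLp.inner_apply]
    simp only [Finset.sum_mul, mul_assoc]
    rw [Summable.tsum_finsetSum fun i _ => h1 i, Complex.ofReal_sum]
    refine Finset.sum_congr rfl fun i _ => ?_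
    rw [tsum_mul_left, ← h2]
    simp

end velocity

/-! ### Elementary estimates for lacunary and harmonic sums -/

/-- The Gaussian profile is dominated by the increments of the bounded function `y / (1 + y)` under
dilation by `8`. -/
lemma mul_exp_neg_sq_le {y : ℝ} (hy : 0 ≤ y) :
    y * rexp (-y ^ 2) ≤ 2 * (8 * y / (1 + 8 * y) - y / (1 + y)) := by
  have h1 : rexp (-y ^ 2) ≤ 1 / (1 + y ^ 2) := by
    rw [Real.exp_neg, ← one_div]
    exact one_div_le_one_div_of_le (by positivity) (by linarith [Real.add_one_le_exp (y ^ 2)])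
  have h2 : 8 * y / (1 + 8 * y) - y / (1 + y) = 7 * y / ((1 + 8 * y) * (1 + y)) := by
    field_simp; ring
  rw [h2]
  refine (mul_le_mul_of_nonneg_left h1 hy).trans ?_
  rw [mul_one_div, ← mul_div_assoc, div_le_div_iff₀ (by positivity) (by positivity)]
  nlinarith [mul_nonneg hy (sq_nonneg (y - 1)), pow_nonneg hy 3]

/-- Gaussian sums along a lacunary sequence are bounded: they telescope against a bounded
increasing function. -/
lemma sum_lacunary_le {y : ℝ} (hy : 0 ≤ y) (M : ℕ) :
    ∑ j ∈ Finset.Icc 1 M, (8 ^ j * y) * rexp (-(8 ^ j * y) ^ 2) ≤ 2 := by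
  set g : ℕ → ℝ := fun j => 8 ^ j * y / (1 + 8 ^ j * y) with hg
  have h1 : ∀ j ∈ Finset.Icc 1 M, (8 ^ j * y) * rexp (-(8 ^ j * y) ^ 2) ≤ 2 * (g (j + 1) - g j) := by
    intro j _
    have := mul_exp_neg_sq_le (y := 8 ^ j * y) (by positivity)
    simpa only [hg, pow_succ', mul_assoc] using this
  refine (Finset.sum_le_sum h1).trans ?_
  rw [← Finset.mul_sum]
  have h2 : ∑ j ∈ Finset.Icc 1 M, (g (j + 1) - g j) = g (M + 1) - g 1 := by
    rw [← Finset.Ico_add_one_right_eq_Icc, Finset.sum_Ico_sub _ (by omega)]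
  rw [h2]
  have h3 : g (M + 1) ≤ 1 := div_le_one_of_le₀ (by linarith) (by positivity)
  have h4 : 0 ≤ g 1 := by positivity
  linarith

/-- Harmonic blocks between `M` and `n M` are as large as the first one, up to `1`. -/
lemma sum_inv_le_sum_Ioc {M n : ℕ} (hM : 1 ≤ M) (hn : 1 ≤ n) :
    ∑ j ∈ Finset.Icc 1 n, 1 / (j : ℝ) - 1 ≤ ∑ j ∈ Finset.Ioc M (n * M), 1 / (j : ℝ) := by
  induction n, hn using Nat.le_induction with
  | base => simp
  | succ n hn ih =>
    have h1 : Finset.Ioc M ((n + 1) * M)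
        = (Finset.Ioc M (n * M)) ∪ (Finset.Ioc (n * M) ((n + 1) * M)) :=
      (Finset.Ioc_union_Ioc_eq_Ioc (Nat.le_mul_of_pos_left M hn)
        (Nat.mul_le_mul_right M n.le_succ)).symm
    have h2 : Disjoint (Finset.Ioc M (n * M)) (Finset.Ioc (n * M) ((n + 1) * M)) :=
      Finset.Ioc_disjoint_Ioc_of_le le_rfl
    rw [h1, Finset.sum_union h2, Finset.sum_Icc_succ_top (by omega)]
    have h3 : 1 / ((n + 1 : ℕ) : ℝ) ≤ ∑ j ∈ Finset.Ioc (n * M) ((n + 1) * M), 1 / (j : ℝ) := by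
      have h4 : ∀ j ∈ Finset.Ioc (n * M) ((n + 1) * M), 1 / (((n + 1) * M : ℕ) : ℝ) ≤ 1 / (j : ℝ) := by
        intro j hj
        rw [Finset.mem_Ioc] at hj
        have : 0 < j := by omega
        exact one_div_le_one_div_of_le (by exact_mod_cast this) (by exact_mod_cast hj.2)
      refine le_trans (le_of_eq ?_) (Finset.sum_le_sum h4)
      have hM' : (M : ℝ) ≠ 0 := by positivity
      rw [Finset.sum_const, Nat.card_Ioc, ← Nat.sub_mul, Nat.add_sub_cancel_left, one_mul,
        nsmul_eq_mul]
      push_cast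
      field_simp
    linarith

/-! ### The three groups of plane waves -/

/-- The group of waves, `0`, `1` or `2`, to which the index `j` belongs. -/
def waveGroup (r j : ℕ) : Fin 3 := if j ≤ r then 0 else if j ≤ r ^ 2 then 1 else 2

/-- The bounded parts of the wave vectors `𝐤` (`true`) and `𝐤'` (`false`) of each group. -/
def baseFreq (g : Fin 3) (b : Bool) : Freq :=
  if b then ![![1, 1, 0], ![0, 1, 0], ![1, -1, 0]] g else ![![0, -1, 1], ![-1, 1, 0], ![1, 0, 0]] g

/-- The amplitude vectors `v` (`true`) and `v'` (`false`) of each group. -/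
def baseAmp (g : Fin 3) (b : Bool) : Freq :=
  if b then ![![1, -1, 0], ![1, 0, 0], ![1, 1, 0]] g else ![![1, 0, 0], ![1, 1, 0], ![0, 1, 0]] g

/-- The frequency `𝐤 - 𝐤'` generated by the waves of each group. -/
def lowFreq (g : Fin 3) : Freq := baseFreq g true - baseFreq g false

/-- The wave vectors of the datum when `T = N⁻²`. -/
def datumFreq (r N : ℕ) (p : ℕ × Bool) : Freq :=
  baseFreq (waveGroup r p.1) p.2 + ![0, 0, (8 ^ p.1 * N : ℤ)]

/-- The scalar amplitudes of the datum when `T = N⁻²`. -/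
noncomputable def datumSize (r N j : ℕ) : ℝ := 8 ^ j * N / (√(j : ℝ) * Gam2 r)

/-- The amplitude vectors of the datum when `T = N⁻²`. -/
noncomputable def datumAmp (r N : ℕ) (p : ℕ × Bool) : E3 :=
  WithLp.toLp 2 fun i => datumSize r N p.1 * baseAmp (waveGroup r p.1) p.2 i

/-- The indices of the plane waves of the datum. -/
def datumIndex (r : ℕ) : Finset (ℕ × Bool) := Finset.Icc 1 (r ^ 3) ×ˢ Finset.univ

lemma baseAmp_two (g : Fin 3) (b : Bool) : baseAmp g b 2 = 0 := by
  revert g b; decide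

lemma sum_baseFreq_mul_baseAmp (g : Fin 3) (b : Bool) :
    ∑ i, baseFreq g b i * baseAmp g b i = 0 := by
  revert g b; decide

lemma abs_baseFreq_le (g : Fin 3) (b : Bool) {l : Fin 3} (hl : l ≠ 2) : |baseFreq g b l| ≤ 1 := by
  revert g b l; decide

lemma baseFreq_two (g : Fin 3) (b : Bool) : baseFreq g b 2 = 0 ∨ baseFreq g b 2 = 1 := by
  revert g b; decide

lemma lowFreq_two (g : Fin 3) : lowFreq g 2 = 0 ∨ lowFreq g 2 = -1 := by
  revert g; decide

lemma abs_lowFreq_le (g l : Fin 3) : |lowFreq g l| ≤ 2 := by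
  revert g l; decide

lemma lowFreq_ne_zero (g : Fin 3) : lowFreq g ≠ 0 := by revert g; decide

lemma lowFreq_injective {g g' : Fin 3} (h : lowFreq g = lowFreq g') : g = g' := by
  revert g g'; decide

lemma lowFreq_ne_neg (g g' : Fin 3) : lowFreq g ≠ -lowFreq g' := by
  revert g g'; decide

lemma datumFreq_apply_two (r N : ℕ) (p : ℕ × Bool) :
    datumFreq r N p 2 = baseFreq (waveGroup r p.1) p.2 2 + 8 ^ p.1 * N := by
  simp [datumFreq]

lemma datumFreq_apply_of_ne (r N : ℕ) (p : ℕ × Bool) {l : Fin 3} (hl : l ≠ 2) :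
    datumFreq r N p l = baseFreq (waveGroup r p.1) p.2 l := by
  fin_cases l <;> simp_all [datumFreq]

lemma one_le_of_mem_datumIndex {r : ℕ} {p : ℕ × Bool} (hp : p ∈ datumIndex r) : 1 ≤ p.1 :=
  (Finset.mem_Icc.1 (Finset.mem_product.1 hp).1).1

lemma eight_le_pow_mul {j N : ℕ} (hj : 1 ≤ j) (hN : 1 ≤ N) : (8 : ℤ) ≤ 8 ^ j * N := by
  have h1 : 8 ^ 1 ≤ 8 ^ j := Nat.pow_le_pow_right (by norm_num) hj
  have h2 : 8 * 1 ≤ 8 ^ j * N := Nat.mul_le_mul (by simpa using h1) hN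
  exact_mod_cast h2

lemma eight_mul_pow_le {i j N : ℕ} (hij : i < j) : (8 : ℤ) * (8 ^ i * N) ≤ 8 ^ j * N := by
  have h1 : 8 ^ (i + 1) ≤ 8 ^ j := Nat.pow_le_pow_right (by norm_num) hij
  have h2 : 8 ^ (i + 1) * N ≤ 8 ^ j * N := Nat.mul_le_mul_right N h1
  rw [pow_succ, mul_comm _ 8, mul_assoc] at h2
  exact_mod_cast h2

section datum
variable {r N : ℕ}

lemma datumFreq_ne_zero (hN : 1 ≤ N) {p : ℕ × Bool} (hp : 1 ≤ p.1) :
    datumFreq r N p ≠ 0 := by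
  intro h
  have h2 := congrFun h 2
  have h3 := eight_le_pow_mul hp hN
  rw [datumFreq_apply_two, Pi.zero_apply] at h2
  rcases baseFreq_two (waveGroup r p.1) p.2 with h4 | h4 <;> omega

lemma sum_datumFreq_mul_datumAmp (p : ℕ × Bool) :
    ∑ i, (datumFreq r N p i : ℝ) * datumAmp r N p i = 0 := by
  have h := sum_baseFreq_mul_baseAmp (waveGroup r p.1) p.2
  have h2 := baseAmp_two (waveGroup r p.1) p.2
  have h' : ∑ i, (baseFreq (waveGroup r p.1) p.2 i : ℝ) * baseAmp (waveGroup r p.1) p.2 i = 0 := by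
    exact_mod_cast h
  rw [Fin.sum_univ_three] at h' ⊢
  rw [datumFreq_apply_of_ne r N p (by decide : (0 : Fin 3) ≠ 2),
    datumFreq_apply_of_ne r N p (by decide : (1 : Fin 3) ≠ 2)]
  simp only [datumAmp, h2, Int.cast_zero, mul_zero, add_zero] at h' ⊢
  linear_combination datumSize r N p.1 * h'

lemma datumAmp_two (p : ℕ × Bool) : datumAmp r N p 2 = 0 := by
  simp [datumAmp, baseAmp_two]

lemma abs_datumFreq_le (p : ℕ × Bool) {l : Fin 3} (hl : l ≠ 2) : |datumFreq r N p l| ≤ 1 := by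
  rw [datumFreq_apply_of_ne r N p hl]
  exact abs_baseFreq_le _ _ hl

/-- Two waves of the datum interact into a frequency `lowFreq g` only if they are the two waves
with the same index in the group `g`, with opposite signs. -/
lemma signedFreq_add_eq_lowFreq_iff (hN : 1 ≤ N) {p q : ℕ × Bool} (hp : 1 ≤ p.1) (hq : 1 ≤ q.1)
    (σ τ : Bool) (g : Fin 3) :
    signedFreq σ (datumFreq r N p) + signedFreq τ (datumFreq r N q) = lowFreq g ↔
      (q, τ) = ((p.1, !p.2), !p.2) ∧ σ = p.2 ∧ waveGroup r p.1 = g := by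
  obtain ⟨i, b⟩ := p
  obtain ⟨j, c⟩ := q
  have hself : ∀ b : Bool, signedFreq b (datumFreq r N (i, b))
      + signedFreq (!b) (datumFreq r N (i, !b)) = lowFreq (waveGroup r i) := by
    intro b
    cases b <;> simp only [signedFreq, datumFreq, lowFreq, Bool.not_true, Bool.not_false, if_true,
      Bool.false_eq_true, if_false] <;> abel
  constructor
  · intro h
    have h2 := congrFun h 2
    have hi := eight_le_pow_mul hp hN
    have hj := eight_le_pow_mul hq hN
    have e1 := datumFreq_apply_two r N (i, b)
    have e2 := datumFreq_apply_two r N (j, c)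
    have b1 := baseFreq_two (waveGroup r i) b
    have b2 := baseFreq_two (waveGroup r j) c
    have b3 := lowFreq_two g
    dsimp only at hi hj e1 e2
    -- third components: the frequencies are lacunary, so the indices agree
    have hij : i = j := by
      rw [Pi.add_apply] at h2
      rcases lt_trichotomy i j with hlt | rfl | hlt
      · exfalso
        have h8 := eight_mul_pow_le (N := N) hlt
        cases σ <;> cases τ <;> simp only [signedFreq, if_true, Bool.false_eq_true, if_false,
          Pi.neg_apply] at h2 <;> omega
      · rfl
      · exfalso
        have h8 := eight_mul_pow_le (N := N) hlt
        cases σ <;> cases τ <;> simp only [signedFreq, if_true, Bool.false_eq_true, if_false,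
          Pi.neg_apply] at h2 <;> omega
    subst hij
    -- waves with equal signs add up to a high frequency
    have hτ : τ = !σ := by
      rw [Pi.add_apply] at h2
      cases σ <;> cases τ <;> simp only [signedFreq, if_true, Bool.false_eq_true, if_false,
          Pi.neg_apply] at h2 <;> first | rfl | omega
    subst hτ
    -- a wave and its own reflection add up to zero
    have hc : c = !b := by
      by_contra hcb
      have hcb' : c = b := by revert hcb; cases b <;> cases c <;> simp
      subst hcb'
      refine lowFreq_ne_zero g ?_
      rw [← h]
      cases σ <;> simp [signedFreq]
    subst hc
    -- the opposite signs produce the reflected frequency `-lowFreq`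
    have hσ : σ = b := by
      by_contra hσb
      have hσb' : σ = !b := by revert hσb; cases b <;> cases σ <;> simp
      subst hσb'
      refine lowFreq_ne_neg g (waveGroup r i) ?_
      rw [← h, ← hself b]
      cases b <;> simp only [signedFreq, Bool.not_true, Bool.not_false, if_true,
        Bool.false_eq_true, if_false] <;> abel
    subst hσ
    rw [hself] at h
    exact ⟨rfl, rfl, lowFreq_injective h⟩
  · rintro ⟨h1, h2, h3⟩
    dsimp only at h1 h2 h3
    obtain ⟨⟨rfl, rfl⟩, rfl⟩ := Prod.mk.injEq _ _ _ _ ▸ Prod.mk.injEq _ _ _ _ ▸ h1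
    rw [h2, hself, h3]

/-- The low frequencies are absent from the datum. -/
lemma planeWaveCoeff_lowFreq (hN : 1 ≤ N) (g l : Fin 3) :
    planeWaveCoeff (datumIndex r) (datumFreq r N) (datumAmp r N) l (lowFreq g) = 0 := by
  have key : ∀ p ∈ datumIndex r, ∀ m : ℤ, lowFreq g 2 = m → m ≠ datumFreq r N p 2
      ∧ m ≠ -datumFreq r N p 2 := by
    intro p hp m hm
    have h3 := eight_le_pow_mul (one_le_of_mem_datumIndex hp) hN
    rw [datumFreq_apply_two]
    have h4 := baseFreq_two (waveGroup r p.1) p.2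
    have h5 := lowFreq_two g
    omega
  refine planeWaveCoeff_eq_zero _ _ _ fun p hp => ⟨fun h => ?_, fun h => ?_⟩
  · exact (key p hp _ rfl).1 (congrFun h 2)
  · exact (key p hp _ rfl).2 (congrFun h 2)

/-- The interaction of the waves of the datum at the low frequencies. -/
lemma conv_datum_lowFreq (hN : 1 ≤ N) (g l k : Fin 3) (w : Freq → ℂ) :
    conv (fun m => planeWaveCoeff (datumIndex r) (datumFreq r N) (datumAmp r N) l m * w m)
      (fun m => planeWaveCoeff (datumIndex r) (datumFreq r N) (datumAmp r N) k m * w m) (lowFreq g)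
      = ∑ j ∈ (Finset.Icc 1 (r ^ 3)).filter fun j => waveGroup r j = g,
        ((datumSize r N j ^ 2 / 4 * (baseAmp g true l * baseAmp g false k
          + baseAmp g false l * baseAmp g true k) : ℝ) : ℂ)
          * (w (datumFreq r N (j, true)) * w (-datumFreq r N (j, false))) := by
  rw [conv_planeWaveCoeff]
  have h1 : ∀ p ∈ datumIndex r ×ˢ (Finset.univ : Finset Bool),
      (∑ q ∈ datumIndex r ×ˢ (Finset.univ : Finset Bool),
        if signedFreq p.2 (datumFreq r N p.1) + signedFreq q.2 (datumFreq r N q.1) = lowFreq g then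
          ((datumAmp r N p.1 l / 2 * (datumAmp r N q.1 k / 2) : ℝ) : ℂ)
            * (w (signedFreq p.2 (datumFreq r N p.1)) * w (signedFreq q.2 (datumFreq r N q.1)))
        else 0)
      = if p.2 = p.1.2 ∧ waveGroup r p.1.1 = g then
          ((datumAmp r N p.1 l / 2 * (datumAmp r N (p.1.1, !p.1.2) k / 2) : ℝ) : ℂ)
            * (w (signedFreq p.1.2 (datumFreq r N p.1))
              * w (signedFreq (!p.1.2) (datumFreq r N (p.1.1, !p.1.2)))) else 0 := by
    intro p hp
    have hp1 := (Finset.mem_product.1 hp).1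
    have hmem : (((p.1.1, !p.1.2), !p.1.2) : (ℕ × Bool) × Bool)
        ∈ datumIndex r ×ˢ (Finset.univ : Finset Bool) := by
      simp only [datumIndex, Finset.mem_product, Finset.mem_univ, and_true] at hp1 ⊢
      exact hp1
    rw [Finset.sum_eq_single ((p.1.1, !p.1.2), !p.1.2)]
    · have := signedFreq_add_eq_lowFreq_iff hN (one_le_of_mem_datumIndex hp1)
        (one_le_of_mem_datumIndex (Finset.mem_product.1 hmem).1) (r := r) p.2 (!p.1.2) g
      simp only [true_and] at this
      simp only [this]
      split_ifs with hc
      · rw [hc.1]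
      · rfl
    · intro q hq hne
      refine if_neg fun hcon => hne ?_
      exact ((signedFreq_add_eq_lowFreq_iff hN (one_le_of_mem_datumIndex hp1)
        (one_le_of_mem_datumIndex (Finset.mem_product.1 hq).1) p.2 q.2 g).1 hcon).1
    · exact fun h => absurd hmem h
  rw [Finset.sum_congr rfl h1, Finset.sum_product, datumIndex, Finset.sum_product,
    Finset.sum_filter]
  refine Finset.sum_congr rfl fun j _ => ?_
  simp only [Fintype.sum_bool]
  by_cases hg : waveGroup r j = g
  · simp only [hg, and_true, if_true, Bool.false_eq_true, Bool.true_eq_false, if_false, signedFreq,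
      Bool.not_true, Bool.not_false, datumAmp, datumFreq]
    push_cast
    ring
  · simp [hg]

end datum

/-! ### Growth of the low modes -/

lemma duhamel_sum_smul (T γ : ℝ) {ι : Type*} (s : Finset ι) (z : ι → ℂ) (c : ι → TimeFn) (t : ℝ) :
    duhamel T γ (∑ j ∈ s, z j • c j) t = ∑ j ∈ s, z j * duhamel T γ (c j) t := by
  simp only [duhamel_apply, BoundedContinuousFunction.coe_sum, Finset.sum_apply,
    BoundedContinuousFunction.coe_smul, smul_eq_mul, Finset.mul_sum]
  rw [intervalIntegral.integral_finsetSum, Finset.mul_sum]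
  · refine Finset.sum_congr rfl fun j _ => ?_
    simp only [mul_left_comm _ (z j)]
    rw [intervalIntegral.integral_const_mul, mul_left_comm]
  · intro j _
    exact (Continuous.intervalIntegrable (by fun_prop) _ _)

/-- The Duhamel integral of a decaying exponential is at least of the size of its time scale. -/
lemma exists_duhamel_expWeight_eq {Th T γ β h : ℝ} (hγ : 0 ≤ γ) (hβ : 0 ≤ β) (hh : 0 ≤ h)
    (hhT : h ≤ T) (hT : T ≤ Th) :
    ∃ d : ℝ, duhamel Th γ (expWeight Th (-β)) T = d ∧ h * rexp (-(γ * T + β * h)) ≤ d := by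
  have hT0 : 0 ≤ T := hh.trans hhT
  have hcl : ∀ s ∈ Icc 0 T, timeClamp Th s = s := fun s hs =>
    timeClamp_of_mem ⟨hs.1, hs.2.trans hT⟩
  refine ⟨rexp (-(γ * T)) * ∫ s in (0 : ℝ)..T, rexp (γ * s) * rexp (-β * s), ?_, ?_⟩
  · rw [duhamel_apply, hcl T ⟨hT0, le_rfl⟩, Complex.ofReal_mul, ← intervalIntegral.integral_ofReal]
    congr 1
    refine intervalIntegral.integral_congr fun s hs => ?_
    rw [uIcc_of_le hT0] at hs
    simp only [expWeight_apply, hcl s hs, Complex.ofReal_mul]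
  · have hint : ∀ a b, IntervalIntegrable (fun s => rexp (γ * s) * rexp (-β * s)) volume a b :=
      fun a b => Continuous.intervalIntegrable (by fun_prop) _ _
    have h1 : ∫ _ in (0 : ℝ)..h, rexp (-(β * h))
        ≤ ∫ s in (0 : ℝ)..h, rexp (γ * s) * rexp (-β * s) := by
      refine intervalIntegral.integral_mono_on hh (by simp) (hint _ _) fun s hs => ?_
      rw [← Real.exp_add]
      refine Real.exp_le_exp.2 ?_
      nlinarith [mul_nonneg hγ hs.1, mul_le_mul_of_nonneg_left hs.2 hβ]
    have h2 : 0 ≤ ∫ s in h..T, rexp (γ * s) * rexp (-β * s) :=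
      intervalIntegral.integral_nonneg hhT fun s _ => by positivity
    rw [intervalIntegral.integral_const, sub_zero, smul_eq_mul] at h1
    rw [neg_add, Real.exp_add, mul_left_comm]
    refine mul_le_mul_of_nonneg_left ?_ (Real.exp_pos _).le
    rw [← intervalIntegral.integral_add_adjacent_intervals (hint 0 h) (hint h T)]
    linarith

/-- The direction, up to a factor `-i`, of the low mode generated by each group. -/
noncomputable def lowDir (g i : Fin 3) : ℝ :=
  ![![1 / 3, -(1 / 3), -(1 / 3)], ![0, 1, 0], ![-1, 0, 0]] g i

/-- The symmetrised Leray symbol applied to the pair of amplitude vectors of a group. -/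
lemma sum_lerayMult_baseAmp (g i : Fin 3) :
    ∑ k, ∑ l, lerayMult i k l (lowFreq g) * (baseAmp g true l * baseAmp g false k
      + baseAmp g false l * baseAmp g true k) = lowDir g i := by
  fin_cases g <;> fin_cases i <;>
    simp [lerayMult, freqSq, lowFreq, baseFreq, baseAmp, lowDir, Fin.sum_univ_three] <;> norm_num

/-- The low directions span the space, quantitatively. -/
lemma exists_abs_sum_mul_lowDir {e : E3} (he : ‖e‖ = 1) :
    ∃ g, 1 / 10 ≤ |∑ i, e i * lowDir g i| := by
  by_contra! h
  have h0 := h 0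
  have h1 := h 1
  have h2 := h 2
  simp only [lowDir, Fin.sum_univ_three, Matrix.cons_val_zero, Matrix.cons_val_one,
    Matrix.cons_val] at h0 h1 h2
  rw [abs_lt] at h0 h1 h2
  have h3 : e 0 ^ 2 + e 1 ^ 2 + e 2 ^ 2 = 1 := by
    have := EuclideanSpace.norm_sq_eq e
    rw [he, Fin.sum_univ_three] at this
    simpa using this.symm
  have ha : |e 0| ≤ 1 / 10 := abs_le.2 ⟨by linarith, by linarith⟩
  have hb : |e 1| ≤ 1 / 10 := abs_le.2 ⟨by linarith, by linarith⟩
  have hc : |e 2| ≤ 1 / 2 := by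
    rw [abs_le] at ha hb
    exact abs_le.2 ⟨by linarith, by linarith⟩
  have s0 := sq_le_sq' (abs_le.1 ha).1 (abs_le.1 ha).2
  have s1 := sq_le_sq' (abs_le.1 hb).1 (abs_le.1 hb).2
  have s2 := sq_le_sq' (abs_le.1 hc).1 (abs_le.1 hc).2
  norm_num at s0 s1 s2
  linarith

section
variable {r N : ℕ}

lemma freqSq_lowFreq_le (g : Fin 3) : freqSq (lowFreq g) ≤ 6 := by
  fin_cases g <;> simp [freqSq, lowFreq, baseFreq, Fin.sum_univ_three]
  norm_num

lemma freqSq_datumFreq_add_le (hN : 1 ≤ N) {j : ℕ} (hj : 1 ≤ j) (b c : Bool) :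
    freqSq (datumFreq r N (j, b)) + freqSq (datumFreq r N (j, c)) ≤ 6 * (8 ^ j * N : ℝ) ^ 2 := by
  have hK : (8 : ℝ) ≤ 8 ^ j * N := by exact_mod_cast eight_le_pow_mul hj hN
  have key : ∀ b, freqSq (datumFreq r N (j, b)) ≤ 3 * (8 ^ j * N : ℝ) ^ 2 := by
    intro b
    generalize hg : waveGroup r j = g
    fin_cases g <;> cases b <;>
      simp [freqSq, datumFreq, hg, baseFreq, Fin.sum_univ_three] <;> nlinarith
  linarith [key b, key c]

lemma sq_le_freqSq_datumFreq (p : ℕ × Bool) :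
    (8 ^ p.1 * N : ℝ) ^ 2 ≤ freqSq (datumFreq r N p) := by
  refine le_trans ?_ (sq_le_freqSq _ 2)
  rw [datumFreq_apply_two]
  push_cast
  rcases baseFreq_two (waveGroup r p.1) p.2 with h | h <;> rw [h] <;>
    refine pow_le_pow_left₀ (by positivity) ?_ 2 <;> simp

/-- At the time `T = N⁻²`, the low modes created by the self-interaction of the heat flow of the
datum are as large as the harmonic sum over the group. -/
lemma exists_nsDuhamel_datum_lowFreq {ν T Th : ℝ} (hν : 0 ≤ ν) (hN : 1 ≤ N)
    (hT : T = ((N : ℝ) ^ 2)⁻¹) (hTh : T ≤ Th) (hΓ : 0 < Gam2 r)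
    (U : Fin 3 → Freq → TimeFn) (hU : ∀ l, U l = heatFam ν Th
      (planeWaveCoeff (datumIndex r) (datumFreq r N) (datumAmp r N) l)) (g : Fin 3) :
    ∃ S : ℝ, (rexp (-(12 * ν)) / (4 * Gam2 r ^ 2) *
        ∑ j ∈ (Finset.Icc 1 (r ^ 3)).filter fun j => waveGroup r j = g, 1 / (j : ℝ)) ≤ S ∧
      ∀ i, nsDuhamel ν 0 Th (fun l k => conv (U l) (U k)) i (lowFreq g) T
        = -Complex.I * (lowDir g i * S : ℝ) := by
  have hN0 : (0 : ℝ) < N := by exact_mod_cast hN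
  have hN1 : (1 : ℝ) ≤ N := by exact_mod_cast hN
  have hT0 : 0 < T := by rw [hT]; positivity
  have hT1 : T ≤ 1 := by rw [hT]; exact inv_le_one_of_one_le₀ (one_le_pow₀ hN1)
  have hTh0 : 0 ≤ Th := hT0.le.trans hTh
  have hUs : ∀ l, Summable fun m => ‖U l m‖ := fun l =>
    Summable.of_nonneg_of_le (fun _ => norm_nonneg _)
      (fun m => by rw [hU]; exact norm_heatFam_le hν _ _ _)
      (summable_norm_planeWaveCoeff _ _ _ l)
  set β : ℕ → ℝ := fun j =>
    ν * (freqSq (datumFreq r N (j, true)) + freqSq (datumFreq r N (j, false))) with hβ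
  set J := (Finset.Icc 1 (r ^ 3)).filter fun j => waveGroup r j = g with hJ
  have hconv : ∀ l k, conv (U l) (U k) (lowFreq g) = ∑ j ∈ J,
      ((datumSize r N j ^ 2 / 4 * (baseAmp g true l * baseAmp g false k
          + baseAmp g false l * baseAmp g true k) : ℝ) : ℂ) • expWeight Th (-β j) := by
    intro l k
    ext s
    rw [conv_apply_time (hUs l) (hUs k)]
    have h1 : ∀ l, (fun m => U l m s) = fun m =>
        planeWaveCoeff (datumIndex r) (datumFreq r N) (datumAmp r N) l m
          * expWeight Th (-(ν * freqSq m)) s := fun l => by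
      funext m
      rw [hU]
      rfl
    rw [h1, h1, conv_datum_lowFreq hN g l k (fun m => expWeight Th (-(ν * freqSq m)) s)]
    simp only [BoundedContinuousFunction.coe_sum, Finset.sum_apply,
      BoundedContinuousFunction.coe_smul, smul_eq_mul]
    refine Finset.sum_congr rfl fun j _ => ?_
    congr 1
    rw [expWeight_apply, expWeight_apply, expWeight_apply, ← Complex.ofReal_mul, ← Real.exp_add,
      freqSq_neg, hβ]
    congr 2
    ring
  have hd : ∀ j ∈ J, ∃ d : ℝ,
      duhamel Th (ν * freqSq (lowFreq g) + 0) (expWeight Th (-β j)) T = d ∧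
        ((8 ^ j * N : ℝ) ^ 2)⁻¹ * rexp (-(12 * ν)) ≤ d := by
    intro j hj
    have hj1 : 1 ≤ j := (Finset.mem_Icc.1 (Finset.mem_filter.1 hj).1).1
    have hγ0 : 0 ≤ ν * freqSq (lowFreq g) + 0 := by
      have := freqSq_nonneg (lowFreq g)
      positivity
    have hβ0 : 0 ≤ β j := mul_nonneg hν (add_nonneg (freqSq_nonneg _) (freqSq_nonneg _))
    have hKN : (N : ℝ) ^ 2 ≤ (8 ^ j * N : ℝ) ^ 2 :=
      pow_le_pow_left₀ hN0.le (le_mul_of_one_le_left hN0.le (one_le_pow₀ (by norm_num))) 2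
    have hK0 : (0 : ℝ) < (8 ^ j * N : ℝ) ^ 2 := by positivity
    -- the time scale of the interaction is `k_j⁻² ≤ T`, and both waves together decay at most
    -- like `e^{-6 ν k_j² t}`
    obtain ⟨d, hd1, hd2⟩ := exists_duhamel_expWeight_eq (Th := Th) (T := T)
      (h := ((8 ^ j * N : ℝ) ^ 2)⁻¹) hγ0 hβ0 (by positivity)
      (by rw [hT]; exact inv_anti₀ (by positivity) hKN) hTh
    refine ⟨d, hd1, le_trans ?_ hd2⟩
    refine mul_le_mul_of_nonneg_left (Real.exp_le_exp.2 (neg_le_neg ?_)) (by positivity)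
    have h1 : (ν * freqSq (lowFreq g) + 0) * T ≤ ν * 6 * 1 :=
      mul_le_mul (by rw [add_zero]; exact mul_le_mul_of_nonneg_left (freqSq_lowFreq_le g) hν) hT1
        hT0.le (by positivity)
    have h2 : β j * ((8 ^ j * N : ℝ) ^ 2)⁻¹ ≤ ν * 6 := by
      rw [← div_eq_mul_inv, div_le_iff₀ hK0, mul_assoc]
      exact mul_le_mul_of_nonneg_left (freqSq_datumFreq_add_le hN hj1 _ _) hν
    linarith
  choose! d hd1 hd2 using hd
  refine ⟨∑ j ∈ J, datumSize r N j ^ 2 / 4 * d j, ?_, fun i => ?_⟩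
  · rw [Finset.mul_sum]
    refine Finset.sum_le_sum fun j hj => ?_
    have hj1 : 1 ≤ j := (Finset.mem_Icc.1 (Finset.mem_filter.1 hj).1).1
    have hj0 : (0 : ℝ) < j := by exact_mod_cast hj1
    refine le_trans (le_of_eq ?_) (mul_le_mul_of_nonneg_left (hd2 j hj) (by positivity))
    rw [datumSize, div_pow, mul_pow (√(j : ℝ)), Real.sq_sqrt hj0.le]
    field_simp
  · have e1 : ∀ l k, duhamel Th (ν * freqSq (lowFreq g) + 0) (conv (U l) (U k) (lowFreq g)) T
        = (((baseAmp g true l * baseAmp g false k + baseAmp g false l * baseAmp g true k)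
          * ∑ j ∈ J, datumSize r N j ^ 2 / 4 * d j : ℝ) : ℂ) := by
      intro l k
      rw [hconv, duhamel_sum_smul, Finset.mul_sum, Complex.ofReal_sum]
      refine Finset.sum_congr rfl fun j hj => ?_
      rw [hd1 j hj, ← Complex.ofReal_mul]
      congr 1
      ring
    simp only [nsDuhamel, BoundedContinuousFunction.coe_sum, Finset.sum_apply,
      BoundedContinuousFunction.coe_smul, smul_eq_mul, e1]
    rw [← sum_lerayMult_baseAmp g i]
    simp only [Finset.sum_mul, Complex.ofReal_sum, Finset.mul_sum (a := -Complex.I)]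
    refine Finset.sum_congr rfl fun k _ => Finset.sum_congr rfl fun l _ => ?_
    rw [mul_assoc, ← Complex.ofReal_mul, mul_assoc]

end

/-! ### The datum and its shear part -/

section
variable {r N : ℕ}

lemma freq_inv_sq (j : ℕ) : freq ((N : ℝ) ^ 2)⁻¹ j = 8 ^ j * N := by
  have h : (((N : ℝ) ^ 2)⁻¹) ^ (-(1 / 2) : ℝ) = N := by
    rw [Real.inv_rpow (by positivity), Real.rpow_neg (by positivity), inv_inv,
      ← Real.sqrt_eq_rpow, Real.sqrt_sq (Nat.cast_nonneg N)]
  rw [freq, h, pow_mul]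
  norm_num

lemma waveK_eq (j : ℕ) : waveK r ((N : ℝ) ^ 2)⁻¹ j = freqVec (datumFreq r N (j, true)) := by
  unfold waveK freqVec datumFreq waveGroup
  rw [freq_inv_sq]
  split_ifs <;> ext i <;> fin_cases i <;> simp [baseFreq]

lemma waveK'_eq (j : ℕ) : waveK' r ((N : ℝ) ^ 2)⁻¹ j = freqVec (datumFreq r N (j, false)) := by
  unfold waveK' freqVec datumFreq waveGroup
  rw [freq_inv_sq]
  split_ifs <;> ext i <;> fin_cases i <;> simp [baseFreq, add_comm]

lemma ampV_eq (j : ℕ) :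
    ampV r j = WithLp.toLp 2 fun i => (baseAmp (waveGroup r j) true i : ℝ) := by
  unfold ampV waveGroup
  split_ifs <;> ext i <;> fin_cases i <;> simp [baseAmp]

lemma ampV'_eq (j : ℕ) :
    ampV' r j = WithLp.toLp 2 fun i => (baseAmp (waveGroup r j) false i : ℝ) := by
  unfold ampV' waveGroup
  split_ifs <;> ext i <;> fin_cases i <;> simp [baseAmp]

lemma planeWaves_datum :
    planeWaves (datumIndex r) (datumFreq r N) (datumAmp r N) = planeWaveDatum r ((N : ℝ) ^ 2)⁻¹ := by
  funext x
  rw [planeWaves, planeWaveDatum, datumIndex, Finset.sum_product, Finset.smul_sum]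
  refine Finset.sum_congr rfl fun j _ => ?_
  rw [Fintype.sum_bool, freq_inv_sq, waveK_eq, waveK'_eq, inner_freqVec, inner_freqVec, ampV_eq,
    ampV'_eq]
  ext i
  simp only [datumAmp, datumSize, PiLp.add_apply, PiLp.smul_apply, smul_eq_mul]
  ring

/-- The indices of the waves `v_j cos(𝐤_j · x)`, `j ≤ r`. -/
def shearIndex (r : ℕ) : Finset (ℕ × Bool) := (datumIndex r).filter fun p => p.1 ≤ r ∧ p.2 = true

lemma shearIndex_eq (r : ℕ) : shearIndex r = Finset.Icc 1 r ×ˢ {true} := by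
  ext ⟨j, b⟩
  have : r ≤ r ^ 3 := Nat.le_self_pow (by norm_num) r
  simp only [shearIndex, datumIndex, Finset.mem_filter, Finset.mem_product, Finset.mem_Icc,
    Finset.mem_univ, and_true, Finset.mem_singleton]
  constructor
  · rintro ⟨⟨h1, h2⟩, h3, h4⟩; exact ⟨⟨h1, h3⟩, h4⟩
  · rintro ⟨⟨h1, h3⟩, h4⟩; exact ⟨⟨h1, h3.trans this⟩, h3, h4⟩

lemma isAdmissibleDatum_of_subset_datumIndex (hN : 1 ≤ N) {t : Finset (ℕ × Bool)}
    (ht : t ⊆ datumIndex r) : IsAdmissibleDatum (planeWaves t (datumFreq r N) (datumAmp r N)) :=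
  isAdmissibleDatum_planeWaves _ _ _
    (fun _ hp => datumFreq_ne_zero hN (one_le_of_mem_datumIndex (ht hp)))
    (fun _ _ => sum_datumFreq_mul_datumAmp _) (fun _ _ => datumAmp_two _)

/-- The waves `v_j cos(𝐤_j · x)`, `j ≤ r`, only depend on `x₁ + x₂` and `x₃` and are directed along
`(1, -1, 0)`. -/
lemma isShearDatum_planeWaves (r N : ℕ) :
    IsShearDatum (planeWaves (shearIndex r) (datumFreq r N) (datumAmp r N)) := by
  refine ⟨1, fun a b => ∑ j ∈ Finset.Icc 1 r, Real.cos (a + (8 ^ j * N : ℕ) * b) * datumSize r N j,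
    fun _ => 0, ?_, fun a b => ⟨?_, ?_⟩, contDiff_const, fun _ => rfl, fun x => ?_⟩
  · fun_prop
  · exact Finset.sum_congr rfl fun j _ => by
      rw [add_right_comm, Real.cos_add_two_pi]
  · exact Finset.sum_congr rfl fun j _ => by
      rw [mul_add, ← add_assoc, Real.cos_add_nat_mul_two_pi]
  · rw [planeWaves, shearIndex_eq r, Finset.sum_product]
    simp only [Finset.sum_singleton]
    have key : ∀ j ∈ Finset.Icc 1 r, Real.cos (phase (datumFreq r N (j, true)) x)
        • datumAmp r N (j, true) = !₂[Real.cos ((((1 : ℤ) : ℝ) * x 0 + x 1) + (8 ^ j * N : ℕ) * x 2)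
          * datumSize r N j, -(Real.cos ((((1 : ℤ) : ℝ) * x 0 + x 1) + (8 ^ j * N : ℕ) * x 2)
          * datumSize r N j), 0] := by
      intro j hj
      have hg : waveGroup r j = 0 := if_pos (Finset.mem_Icc.1 hj).2
      have hp : phase (datumFreq r N (j, true)) x
          = (((1 : ℤ) : ℝ) * x 0 + x 1) + (8 ^ j * N : ℕ) * x 2 := by
        rw [phase_apply, Fin.sum_univ_three]
        simp [datumFreq, hg, baseFreq]
      rw [hp]
      ext i
      fin_cases i <;> simp [datumAmp, hg, baseAmp]
    rw [Finset.sum_congr rfl key]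
    ext i
    fin_cases i <;> simp [Finset.sum_neg_distrib]

lemma datum_sub_shear (x : E3) :
    planeWaves (datumIndex r) (datumFreq r N) (datumAmp r N) x
      - planeWaves (shearIndex r) (datumFreq r N) (datumAmp r N) x
      = planeWaves ((datumIndex r).filter fun p => ¬ (p.1 ≤ r ∧ p.2 = true)) (datumFreq r N)
          (datumAmp r N) x := by
  rw [planeWaves, planeWaves, planeWaves, shearIndex, sub_eq_iff_eq_add',
    Finset.sum_filter_add_sum_filter_not]

lemma abs_baseAmp_le (g : Fin 3) (b : Bool) (l : Fin 3) : |baseAmp g b l| ≤ 1 := by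
  revert g b l; decide

lemma one_le_sum_inv (hr : 1 ≤ r) : 1 ≤ ∑ j ∈ Finset.Icc 1 r, 1 / (j : ℝ) := by
  have := Finset.single_le_sum (f := fun j : ℕ => 1 / (j : ℝ)) (s := Finset.Icc 1 r)
    (fun j _ => by positivity) (Finset.mem_Icc.2 ⟨le_rfl, hr⟩)
  simpa using this

lemma Gam2_pow_three (r : ℕ) : Gam2 r ^ 3 = ∑ j ∈ Finset.Icc 1 r, 1 / (j : ℝ) := by
  rw [Gam2, ← Real.rpow_natCast, ← Real.rpow_mul (Finset.sum_nonneg fun j _ => by positivity)]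
  norm_num

lemma one_le_Gam2 (hr : 1 ≤ r) : 1 ≤ Gam2 r := Real.one_le_rpow (one_le_sum_inv hr) (by norm_num)

lemma tendsto_Gam2 : Tendsto Gam2 atTop atTop := by
  refine (tendsto_rpow_atTop (by norm_num : (0 : ℝ) < 1 / 3)).comp ?_
  convert Real.tendsto_sum_range_one_div_nat_succ_atTop using 2 with r
  induction r with
  | zero => simp
  | succ r ih => rw [Finset.sum_Icc_succ_top (by omega), Finset.sum_range_succ, ih]; push_cast; rfl

lemma datumSize_le (hr : 1 ≤ r) {j : ℕ} (hj : 1 ≤ j) :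
    datumSize r N j ≤ 8 ^ j * N / Gam2 r := by
  have hΓ := one_le_Gam2 hr
  rw [datumSize]
  refine div_le_div_of_nonneg_left (by positivity) (by positivity) ?_
  exact le_mul_of_one_le_left (by positivity) (Real.one_le_sqrt.2 (by exact_mod_cast hj))

lemma datumSize_nonneg (hr : 1 ≤ r) (j : ℕ) : 0 ≤ datumSize r N j := by
  have hΓ := one_le_Gam2 hr
  unfold datumSize
  positivity

lemma abs_datumAmp_le (hr : 1 ≤ r) (p : ℕ × Bool) (l : Fin 3) :
    |datumAmp r N p l| ≤ datumSize r N p.1 := by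
  have h1 : |(baseAmp (waveGroup r p.1) p.2 l : ℝ)| ≤ 1 := by
    exact_mod_cast abs_baseAmp_le (waveGroup r p.1) p.2 l
  rw [datumAmp, abs_mul, abs_of_nonneg (datumSize_nonneg hr _)]
  exact mul_le_of_le_one_right (datumSize_nonneg hr _) h1

lemma norm_datumAmp_le (hr : 1 ≤ r) (p : ℕ × Bool) :
    ‖datumAmp r N p‖ ≤ 2 * datumSize r N p.1 := by
  have h0 := datumSize_nonneg (N := N) hr p.1
  rw [EuclideanSpace.norm_eq]
  refine Real.sqrt_le_iff.2 ⟨by positivity, ?_⟩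
  have h : ∀ i, ‖datumAmp r N p i‖ ^ 2 ≤ datumSize r N p.1 ^ 2 := fun i =>
    pow_le_pow_left₀ (norm_nonneg _) (abs_datumAmp_le hr p i) 2
  rw [Fin.sum_univ_three]
  nlinarith [h 0, h 1, h 2]

lemma sum_abs_datumAmp_le (hr : 1 ≤ r) (l : Fin 3) :
    ∑ p ∈ datumIndex r, |datumAmp r N p l| ≤ 2 * r ^ 3 * 8 ^ r ^ 3 * N := by
  have hΓ := one_le_Gam2 hr
  have h1 : ∀ p ∈ datumIndex r, |datumAmp r N p l| ≤ 8 ^ r ^ 3 * N := by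
    intro p hp
    have hp1 := Finset.mem_Icc.1 (Finset.mem_product.1 hp).1
    refine (abs_datumAmp_le hr p l).trans ((datumSize_le hr hp1.1).trans ?_)
    refine (div_le_self (by positivity) hΓ).trans ?_
    exact mul_le_mul_of_nonneg_right (pow_le_pow_right₀ (by norm_num) hp1.2) (by positivity)
  refine (Finset.sum_le_sum h1).trans (le_of_eq ?_)
  rw [Finset.sum_const, datumIndex, Finset.card_product, Nat.card_Icc]
  simp
  ring

/-- The Besov norm of any part of the datum is small. -/
lemma besovNorm_datum_le (hr : 1 ≤ r) {t : Finset (ℕ × Bool)} (ht : t ⊆ datumIndex r) :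
    besovNorm (fun x => planeWaves t (datumFreq r N) (datumAmp r N) x)
      ≤ ENNReal.ofReal (8 / Gam2 r) := by
  have hΓ := one_le_Gam2 hr
  refine besovNorm_sum_cos_le t _ _ fun s hs => ?_
  have h1 : ∀ p ∈ datumIndex r, √s * (rexp (-(s * freqSq (datumFreq r N p))) * ‖datumAmp r N p‖)
      ≤ 2 / Gam2 r * ((8 ^ p.1 * (N * √s)) * rexp (-(8 ^ p.1 * (N * √s)) ^ 2)) := by
    intro p hp
    have h2 : ‖datumAmp r N p‖ ≤ 2 * (8 ^ p.1 * N / Gam2 r) :=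
      (norm_datumAmp_le hr p).trans (mul_le_mul_of_nonneg_left
        (datumSize_le hr (one_le_of_mem_datumIndex hp)) zero_le_two)
    have h3 : rexp (-(s * freqSq (datumFreq r N p))) ≤ rexp (-(8 ^ p.1 * (N * √s)) ^ 2) := by
      refine Real.exp_le_exp.2 (neg_le_neg ?_)
      have h4 := mul_le_mul_of_nonneg_left (sq_le_freqSq_datumFreq (r := r) (N := N) p) hs.le
      refine le_trans (le_of_eq ?_) h4
      rw [← mul_assoc, mul_pow, Real.sq_sqrt hs.le, mul_comm]
    calc √s * (rexp (-(s * freqSq (datumFreq r N p))) * ‖datumAmp r N p‖)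
        ≤ √s * (rexp (-(8 ^ p.1 * (N * √s)) ^ 2) * (2 * (8 ^ p.1 * N / Gam2 r))) := by gcongr
      _ = _ := by ring
  rw [Finset.mul_sum]
  calc ∑ p ∈ t, √s * (rexp (-(s * freqSq (datumFreq r N p))) * ‖datumAmp r N p‖)
      ≤ ∑ p ∈ datumIndex r, √s * (rexp (-(s * freqSq (datumFreq r N p))) * ‖datumAmp r N p‖) :=
        Finset.sum_le_sum_of_subset_of_nonneg ht fun _ _ _ => by positivity
    _ ≤ ∑ p ∈ datumIndex r,
          2 / Gam2 r * ((8 ^ p.1 * (N * √s)) * rexp (-(8 ^ p.1 * (N * √s)) ^ 2)) :=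
        Finset.sum_le_sum h1
    _ = 4 / Gam2 r * ∑ j ∈ Finset.Icc 1 (r ^ 3),
          (8 ^ j * (N * √s)) * rexp (-(8 ^ j * (N * √s)) ^ 2) := by
        rw [datumIndex, Finset.sum_product, Finset.mul_sum]
        refine Finset.sum_congr rfl fun j _ => ?_
        rw [Fintype.sum_bool]
        ring
    _ ≤ 4 / Gam2 r * 2 := mul_le_mul_of_nonneg_left (sum_lacunary_le (by positivity) _)
        (by positivity)
    _ = 8 / Gam2 r := by ring

/-- The harmonic sum over each group is comparable to `Γ₂(r)³`. -/
lemma Gam2_pow_three_sub_one_le (hr : 1 ≤ r) (g : Fin 3) :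
    Gam2 r ^ 3 - 1
      ≤ ∑ j ∈ (Finset.Icc 1 (r ^ 3)).filter fun j => waveGroup r j = g, 1 / (j : ℝ) := by
  have h2 : r ≤ r ^ 2 := Nat.le_self_pow (by norm_num) r
  have h3 : r ^ 2 ≤ r ^ 3 := Nat.pow_le_pow_right hr (by norm_num)
  have key : ∀ s ⊆ (Finset.Icc 1 (r ^ 3)).filter fun j => waveGroup r j = g,
      Gam2 r ^ 3 - 1 ≤ ∑ j ∈ s, 1 / (j : ℝ) → Gam2 r ^ 3 - 1
        ≤ ∑ j ∈ (Finset.Icc 1 (r ^ 3)).filter fun j => waveGroup r j = g, 1 / (j : ℝ) :=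
    fun s hs h => h.trans (Finset.sum_le_sum_of_subset_of_nonneg hs fun _ _ _ => by positivity)
  have hsub : ∀ s : Finset ℕ, (∀ j ∈ s, 1 ≤ j ∧ j ≤ r ^ 3 ∧ waveGroup r j = g) →
      s ⊆ (Finset.Icc 1 (r ^ 3)).filter fun j => waveGroup r j = g := fun s hs j hj =>
    Finset.mem_filter.2 ⟨Finset.mem_Icc.2 ⟨(hs j hj).1, (hs j hj).2.1⟩, (hs j hj).2.2⟩
  fin_cases g
  · refine key (Finset.Icc 1 r) (hsub _ fun j hj => ?_) (by rw [Gam2_pow_three]; linarith)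
    rw [Finset.mem_Icc] at hj
    exact ⟨hj.1, by omega, if_pos hj.2⟩
  · refine key (Finset.Ioc r (r ^ 2)) (hsub _ fun j hj => ?_) ?_
    · rw [Finset.mem_Ioc] at hj
      refine ⟨by omega, by omega, ?_⟩
      rw [waveGroup, if_neg (by omega), if_pos hj.2]
      rfl
    · rw [Gam2_pow_three, sq]
      exact sum_inv_le_sum_Ioc hr hr
  · refine key (Finset.Ioc (r ^ 2) (r ^ 3)) (hsub _ fun j hj => ?_) ?_
    · rw [Finset.mem_Ioc] at hj
      refine ⟨by omega, by omega, ?_⟩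
      rw [waveGroup, if_neg (by omega), if_neg (by omega)]
      rfl
    · rw [Gam2_pow_three, pow_succ' r 2]
      exact sum_inv_le_sum_Ioc (by omega) hr

end

/-! ### Norm inflation -/

/-- Lower bound for the low mode of a solution in a direction `e` not orthogonal to `lowDir g`: the
mode is `-i S lowDir g` up to `ε`. -/
lemma le_norm_sum_mul_lowFreq {r N : ℕ} {ν Th T ε S : ℝ} (hN : 1 ≤ N) {e : E3} (he : ‖e‖ = 1)
    {g : Fin 3} (hg : 1 / 10 ≤ |∑ i, e i * lowDir g i|) {a U : Fin 3 → Freq → TimeFn}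
    (hU : ∀ l, U l = heatFam ν Th
      (planeWaveCoeff (datumIndex r) (datumFreq r N) (datumAmp r N) l))
    (herr : ∀ i, ‖a i (lowFreq g) - (U i (lowFreq g)
      + nsDuhamel ν 0 Th (fun l k => conv (U l) (U k)) i (lowFreq g))‖ ≤ ε) (hS0 : 0 ≤ S)
    (hS : ∀ i, nsDuhamel ν 0 Th (fun l k => conv (U l) (U k)) i (lowFreq g) T
      = -Complex.I * (lowDir g i * S : ℝ)) :
    S / 10 - 3 * ε ≤ ‖∑ i, (e i : ℂ) * a i (lowFreq g) T‖ := by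
  have hU0 : ∀ i, U i (lowFreq g) = 0 := fun i => by
    rw [hU, heatFam, planeWaveCoeff_lowFreq hN, zero_smul]
  have h1 : ∀ i, ‖a i (lowFreq g) T - -Complex.I * (lowDir g i * S : ℝ)‖ ≤ ε := by
    intro i
    refine le_trans ?_ (herr i)
    rw [hU0, zero_add, ← hS i]
    exact (a i (lowFreq g) - nsDuhamel ν 0 Th (fun l k => conv (U l) (U k)) i
      (lowFreq g)).norm_coe_le_norm T
  have h2 : ∀ i, ‖(e i : ℂ) * (a i (lowFreq g) T - -Complex.I * (lowDir g i * S : ℝ))‖ ≤ ε := by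
    intro i
    rw [norm_mul, Complex.norm_real]
    refine (mul_le_of_le_one_left (norm_nonneg _) ?_).trans (h1 i)
    exact (PiLp.norm_apply_le e i).trans he.le
  have h3 : ‖∑ i, (e i : ℂ) * (a i (lowFreq g) T - -Complex.I * (lowDir g i * S : ℝ))‖ ≤ 3 * ε := by
    refine (norm_sum_le_of_le _ fun i _ => h2 i).trans (le_of_eq ?_)
    simp
  have h4 : ∑ i, (e i : ℂ) * (-Complex.I * (lowDir g i * S : ℝ))
      = -Complex.I * (((∑ i, e i * lowDir g i) * S : ℝ) : ℂ) := by
    rw [Finset.sum_mul, Complex.ofReal_sum, Finset.mul_sum]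
    refine Finset.sum_congr rfl fun i _ => ?_
    push_cast
    ring
  have h5 : ‖∑ i, (e i : ℂ) * (-Complex.I * (lowDir g i * S : ℝ))‖
      = |∑ i, e i * lowDir g i| * S := by
    rw [h4, norm_mul, norm_neg, Complex.norm_I, one_mul, Complex.norm_real, norm_mul,
      Real.norm_eq_abs, Real.norm_of_nonneg hS0]
  have h6 : S / 10 ≤ |∑ i, e i * lowDir g i| * S := by
    have := mul_le_mul_of_nonneg_right hg hS0
    linarith
  simp only [mul_sub, Finset.sum_sub_distrib] at h3
  have h7 := norm_sub_norm_le (∑ i, (e i : ℂ) * (-Complex.I * (lowDir g i * S : ℝ)))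
    (∑ i, (e i : ℂ) * a i (lowFreq g) T)
  rw [norm_sub_rev] at h7
  linarith

/-- For large `N`, the solution with the datum of wave vectors `𝐤_j`, `T = N⁻²`, exists on
`[0, 2T]`, and its low modes at time `T` are bounded from below by `Γ₂(r)`. -/
lemma exists_solution_datum {ν : ℝ} (hν : 0 < ν) {r : ℕ} (hr : 1 ≤ r) (hΓ : 2 ≤ Gam2 r) :
    ∃ N₀ : ℕ, ∀ N : ℕ, N₀ ≤ N → 1 ≤ N → ∃ a : Fin 3 → Freq → TimeFn,
      (∀ m i, SmoothFam (2 * ((N : ℝ) ^ 2)⁻¹) m (a i)) ∧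
      (∀ i m, ∀ s ∈ Ioo 0 (2 * ((N : ℝ) ^ 2)⁻¹), HasDerivAt (a i m) (nsVelocity ν a i m s) s) ∧
      (∀ i, reflectFam (a i) = a i) ∧ (∀ m, ∑ l, derivFam l (a l) m = 0) ∧
      velocity a 0 = planeWaveDatum r ((N : ℝ) ^ 2)⁻¹ ∧
      ∀ e : E3, ‖e‖ = 1 → ∃ g : Fin 3, rexp (-(12 * ν)) * Gam2 r / 80 - 1
        ≤ ‖∑ i, (e i : ℂ) * a i (lowFreq g) ((N : ℝ) ^ 2)⁻¹‖ := by
  have hr0 : (0 : ℝ) < r := by exact_mod_cast hr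
  set K : ℝ := 2 * r ^ 3 * 8 ^ r ^ 3 with hK
  have hK0 : 0 < K := by positivity
  -- the damping parameter is `lam / T`; it makes the linearised operator a contraction
  set lam : ℝ := (36 * K) ^ 2 / ν with hlam
  set ρ : ℝ := rexp (2 * lam) * (288 * K ^ 2) with hρ
  have hρ0 : 0 < ρ := by positivity
  -- the two conditions on `N` make the quadratic term small and bound the error in the low modes by
  -- `1 / 3`; the constants `ρ` and `K` do not depend on `N`
  obtain ⟨N₀, hN₀⟩ := exists_nat_ge (max (2 * ρ / K) (216 * (2 * K * ρ + ρ ^ 2)))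
  refine ⟨N₀, fun N hNN hN => ?_⟩
  have hN1 : (1 : ℝ) ≤ N := by exact_mod_cast hN
  have hN0 : (0 : ℝ) < N := by linarith
  have hNle : (N₀ : ℝ) ≤ N := by exact_mod_cast hNN
  have hNa : 2 * ρ / K ≤ N := (le_max_left _ _).trans (hN₀.trans hNle)
  have hNb : 216 * (2 * K * ρ + ρ ^ 2) ≤ N := (le_max_right _ _).trans (hN₀.trans hNle)
  set T : ℝ := ((N : ℝ) ^ 2)⁻¹ with hT
  have hT0 : 0 < T := by positivity
  have hTN : T * (N : ℝ) ^ 2 = 1 := inv_mul_cancel₀ (by positivity)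
  have hμ0 : 0 < lam * (N : ℝ) ^ 2 := by positivity
  have hsqrt : √(ν * (lam * (N : ℝ) ^ 2)) = 36 * (K * N) := by
    rw [Real.sqrt_eq_iff_mul_self_eq (by positivity) (by positivity), hlam]
    field_simp
  have hμT : lam * (N : ℝ) ^ 2 * (2 * T) = 2 * lam := by linear_combination 2 * lam * hTN
  have hTC : 144 * (2 * T) * (K * N) ^ 2 = 288 * K ^ 2 := by linear_combination 288 * K ^ 2 * hTN
  obtain ⟨a, hsm, hder, hreal, hdiv, hinit, herr⟩ := exists_solution_planeWaves
    (t := datumIndex r) (n := datumFreq r N) (v := datumAmp r N) (ν := ν)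
    (μ := lam * (N : ℝ) ^ 2) (Th := 2 * T) (C := K * N) hν hμ0 (by positivity)
    (fun p _ => sum_datumFreq_mul_datumAmp p) (fun p _ => datumAmp_two p)
    (fun p _ l hl => abs_datumFreq_le p hl) (sum_abs_datumAmp_le hr)
    (by
      rw [hsqrt]
      refine le_of_eq ?_
      field_simp
      norm_num)
    (by
      rw [hsqrt, hμT, hTC, mul_assoc, ← hρ]
      have : 2 * ρ ≤ N * K := (div_le_iff₀ hK0).1 hNa
      rw [mul_one_div, div_mul_eq_mul_div, div_le_div_iff₀ (by positivity) (by norm_num)]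
      linarith)
    (fun l => heatFam ν (2 * T) (planeWaveCoeff (datumIndex r) (datumFreq r N) (datumAmp r N) l))
    (fun _ => rfl)
  refine ⟨a, hsm, hder, hreal, hdiv, hinit.trans planeWaves_datum, fun e he => ?_⟩
  obtain ⟨g, hg⟩ := exists_abs_sum_mul_lowDir he
  obtain ⟨S, hS1, hS2⟩ := exists_nsDuhamel_datum_lowFreq (r := r) (T := T) (Th := 2 * T) hν.le hN hT
    (by linarith) (by linarith) _ (fun l => rfl) g
  have hS : rexp (-(12 * ν)) * Gam2 r / 8 ≤ S := by
    refine le_trans ?_ ((mul_le_mul_of_nonneg_left (Gam2_pow_three_sub_one_le hr g)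
      (by positivity)).trans hS1)
    rw [div_mul_eq_mul_div, div_le_div_iff₀ (by norm_num) (by positivity)]
    have h8 : (2 : ℝ) ^ 3 ≤ Gam2 r ^ 3 := pow_le_pow_left₀ (by norm_num) hΓ 3
    have := Real.exp_pos (-(12 * ν))
    nlinarith
  refine ⟨g, le_trans ?_ (le_norm_sum_mul_lowFreq (ε := 1 / 3) hN he hg (fun l => rfl) (fun i => ?_)
    (le_trans (by positivity) hS) hS2)⟩
  · linarith
  · refine (herr i (lowFreq g) (abs_lowFreq_le g)).trans ?_
    rw [hμT, hTC, ← hρ]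
    have h1 : 36 * (2 * T) * (2 * (K * N) * ρ + ρ ^ 2) ≤ 72 * T * (N * (2 * K * ρ + ρ ^ 2)) := by
      have : 2 * (K * N) * ρ + ρ ^ 2 ≤ N * (2 * K * ρ + ρ ^ 2) := by nlinarith [sq_nonneg ρ]
      calc _ = 72 * T * (2 * (K * N) * ρ + ρ ^ 2) := by ring
        _ ≤ _ := by gcongr
    refine h1.trans ?_
    have h2 : N * (216 * (2 * K * ρ + ρ ^ 2)) ≤ (N : ℝ) ^ 2 := by
      rw [sq (N : ℝ)]; exact mul_le_mul_of_nonneg_left hNb hN0.le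
    have h3 := mul_le_mul_of_nonneg_left h2 hT0.le
    rw [hTN] at h3
    linarith

theorem theoremA (ν : ℝ) (hν : 0 < ν) (δ : ℝ) (hδ0 : 0 < δ) (hδ1 : δ < 1) :
    ∃ uin ubar : E3 → E3,
      IsAdmissibleDatum uin ∧ IsAdmissibleDatum ubar ∧ IsShearDatum ubar ∧
      besovNorm (fun x => uin x - ubar x) = besovNorm (fun x => horiz (uin x) - horiz (ubar x)) ∧
      besovNorm (fun x => uin x - ubar x) < ENNReal.ofReal δ ∧
      ∃ T : ℝ, 0 < T ∧ T < δ ∧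
        (∃ r : ℕ, 1 ≤ r ∧ uin = planeWaveDatum r T) ∧
        ∃ u : ℝ → E3 → E3,
          IsSmoothNSSolution ν T uin u ∧
          ContinuousOn (fun z : ℝ × E3 => u z.1 z.2) (Icc 0 T ×ˢ univ) ∧ u 0 = uin ∧
          (∀ v : ℝ → E3 → E3, IsSmoothNSSolution ν T uin v → ∀ t ∈ Ioc 0 T, v t = u t) ∧
          ENNReal.ofReal (1 / δ) <
            ⨅ e : Metric.sphere (0 : E3) 1, besovNorm (fun x => inner ℝ (u T x) (e : E3)) := by
  -- `Γ₂(r) → ∞` serves both the smallness of `8 / Γ₂(r)` and the inflation; only then is `N` chosen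
  obtain ⟨r, ⟨hr, hΓ2⟩, hΓδ, hΓM⟩ := ((eventually_ge_atTop 1).and
    (tendsto_Gam2.eventually_ge_atTop 2) |>.and ((tendsto_Gam2.eventually_gt_atTop (8 / δ)).and
    (tendsto_Gam2.eventually_gt_atTop (80 * (rexp (12 * ν) * (rexp 6 * (1 / δ) + 1)))))).exists
  obtain ⟨N₀, hN₀⟩ := exists_solution_datum hν hr hΓ2
  obtain ⟨N₁, hN₁⟩ := exists_nat_gt (1 / δ)
  set N : ℕ := max N₀ (max N₁ 1) with hNdef
  have hN : 1 ≤ N := (le_max_right _ _).trans (le_max_right _ _)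
  have hN1 : (1 : ℝ) ≤ N := by exact_mod_cast hN
  have hNδ : 1 / δ < N := hN₁.trans_le (by
    exact_mod_cast (le_max_left _ _).trans (le_max_right _ _))
  obtain ⟨a, hsm, hder, hreal, hdiv, hinit, hinf⟩ := hN₀ N (le_max_left _ _) hN
  set T : ℝ := ((N : ℝ) ^ 2)⁻¹ with hT
  have hT0 : 0 < T := by positivity
  -- the solution lives on `(0, 2T)`, so that it is smooth up to the time `T` included
  have hTh : T < 2 * T := by linarith
  have hTδ : T < δ := by
    rw [one_div] at hNδ
    rw [hT]
    refine inv_lt_of_inv_lt₀ hδ0 (hNδ.trans_le ?_)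
    nlinarith
  have hs : ∀ i, Summable fun n => ‖a i n‖ := fun i => (hsm 0 i).rapidDecay.summable
  have huin : planeWaveDatum r T = planeWaves (datumIndex r) (datumFreq r N) (datumAmp r N) :=
    planeWaves_datum.symm
  have hadm := isAdmissibleDatum_of_subset_datumIndex (r := r) hN subset_rfl
  have hadm' := isAdmissibleDatum_of_subset_datumIndex (r := r) (t := shearIndex r) hN
    (Finset.filter_subset _ _)
  rw [← huin] at hadm
  have hsol := isSmoothNSSolution_velocity hTh hsm hder hreal hdiv
  rw [hinit] at hsol
  refine ⟨planeWaveDatum r T, planeWaves (shearIndex r) (datumFreq r N) (datumAmp r N), hadm, hadm',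
    isShearDatum_planeWaves r N, ?_, ?_, T, hT0, hTδ, ⟨r, hr, rfl⟩, velocity a, hsol,
    (continuous_velocity hs).continuousOn, hinit, ?_, ?_⟩
  · rw [← besovNorm_horiz fun x => by
      rw [PiLp.sub_apply, hadm.third_zero, hadm'.third_zero, sub_zero]]
    congr 1
    funext x
    ext i
    fin_cases i <;> simp [horiz]
  · simp only [huin, datum_sub_shear]
    refine (besovNorm_datum_le hr (Finset.filter_subset _ _)).trans_lt
      ((ENNReal.ofReal_lt_ofReal_iff hδ0).2 ?_)
    rw [div_lt_comm₀ (by linarith) hδ0]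
    exact hΓδ
  · obtain ⟨G, hG⟩ := exists_abs_pd_velocity_le hTh hsm
    exact fun v hv => hsol.eq_of_bounded_gradient hν.le hadm.smooth.continuous hv hG
  · have hM : 1 / δ < rexp (-6) * (rexp (-(12 * ν)) * Gam2 r / 80 - 1) := by
      have h1 : rexp (-(12 * ν)) * rexp (12 * ν) = 1 := by rw [← Real.exp_add]; simp
      have h2 : rexp (-6) * rexp 6 = 1 := by rw [← Real.exp_add]; simp
      have h3 := mul_lt_mul_of_pos_left hΓM (Real.exp_pos (-(12 * ν)))
      have h4 : rexp (-(12 * ν)) * (80 * (rexp (12 * ν) * (rexp 6 * (1 / δ) + 1)))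
          = 80 * (rexp 6 * (1 / δ) + 1) := by
        linear_combination 80 * (rexp 6 * (1 / δ) + 1) * h1
      rw [h4] at h3
      have h5 : rexp 6 * (1 / δ) < rexp (-(12 * ν)) * Gam2 r / 80 - 1 := by linarith
      have h6 := mul_lt_mul_of_pos_left h5 (Real.exp_pos (-6))
      rwa [← mul_assoc, h2, one_mul] at h6
    have hpos : 0 < rexp (-6) * (rexp (-(12 * ν)) * Gam2 r / 80 - 1) :=
      (by positivity : 0 < 1 / δ).trans hM
    refine ((ENNReal.ofReal_lt_ofReal_iff hpos).2 hM).trans_le (le_iInf fun e => ?_)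
    obtain ⟨g, hg⟩ := hinf e (by simp)
    refine le_trans (ENNReal.ofReal_le_ofReal ?_)
      (ofReal_norm_mode_le_besovNorm hs hreal T e (lowFreq g))
    refine (mul_le_mul_of_nonneg_left hg (Real.exp_pos _).le).trans
      (mul_le_mul_of_nonneg_right (Real.exp_le_exp.2 ?_) (norm_nonneg _))
    exact neg_le_neg (freqSq_lowFreq_le g)
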